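/- **Setting.** Let $U\subset\mathbb R^4$ be a simply connected open coordinate domain with coordinates $x^\alpha$, $\alpha=0,1,2,3$, and let $g$ be a smooth Lorentzian metric on $U$ of signature $(+,-,-,-)$; put $o_{jk}=o^{jk}=\mathrm{diag}(1,-1,-1,-1)$. All fields are smooth, tensor indices are raised and lowered by $g$, and differential forms are identified with antisymmetric tensors. Two complex fields on $U$ are equal modulo $\mathrm U(1)$ if they differ by a *constant* complex factor of modulus $1$. Fix a reference coframe $\boldsymbol\vartheta$ on $U$, i.e. real covector fields $\boldsymbol\vartheta^j$ with $g=o_{jk}\boldsymbol\vartheta^j\otimes\boldsymbol\vartheta^k$ and $\det\boldsymbol\vartheta^j_\alpha>0$. A *coframe* is a quartet of real covector fields $\vartheta^j$ with $g=o_{jk}\vartheta^j\otimes\vartheta^k$, $\det\vartheta^j_\alpha>0$ and $\boldsymbol\vartheta^0\cdot\vartheta^0>0$. For a coframe put $$l=\vartheta^0+\vartheta^3,\quad m=\vartheta^1+i\vartheta^2,\quad n=\vartheta^0-\vartheta^3,\quad T^{\mathrm{ax}}=\tfrac13\,o_{jk}\,\vartheta^j\wedge d\vartheta^k .$$ **Pauli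 matrices.** Let $\sigma_{\alpha a\dot b}$ be Hermitian $2\times2$ matrix fields on $U$ with $\sigma^\alpha{}_{a\dot b}\sigma^{\beta c\dot b}+\sigma^\beta{}_{a\dot b}\sigma^{\alpha c\dot b}=2g^{\alpha\beta}\delta_a{}^c$, where spinor indices are raised by $S^{a\dot b}=\epsilon^{ac}\epsilon^{\dot b\dot d}S_{c\dot d}$, $\epsilon=\begin{pmatrix}0&1\\-1&0\end{pmatrix}$. Assume that at each point the covectors $\sigma_{\alpha a\dot b}\zeta^a\bar\zeta^{\dot b}$, $\zeta\neq0$, form the forward light cone $\{c_j\boldsymbol\vartheta^j: o^{jk}c_jc_k=0,\ c_0>0\}$, and that $\sigma_{\alpha\beta ac}:=\frac12(\sigma_{\alpha a\dot b}\epsilon^{\dot b\dot d}\sigma_{\beta c\dot d}-\sigma_{\beta a\dot b}\epsilon^{\dot b\dot d}\sigma_{\alpha c\dot d})$ satisfies $*\sigma=-i\sigma$, where $(*\sigma)_{\gamma\delta ab}=\frac12\sqrt{|\det g|}\,\sigma^{\alpha\beta}{}_{ab}\,\varepsilon_{\alpha\beta\gamma\delta}$, $\varepsilon_{0123}=1$.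 For a spinor field $\xi^a$ put $$\{\nabla\}_\alpha\xi^a=\partial_\alpha\xi^a+\tfrac14\sigma_\beta{}^{a\dot c}\bigl(\partial_\alpha\sigma^\beta{}_{b\dot c}+\{\Gamma\}^\beta{}_{\alpha\gamma}\sigma^\gamma{}_{b\dot c}\bigr)\xi^b,$$ $$L_{\mathrm{Weyl}}(\xi)=\tfrac i2\bigl(\bar\xi^{\dot b}\sigma^\alpha{}_{a\dot b}\{\nabla\}_\alpha\xi^a-\xi^a\sigma^\alpha{}_{a\dot b}\{\nabla\}_\alpha\bar\xi^{\dot b}\bigr)*1,$$ where $\{\Gamma\}$ are the Christoffel symbols of $g$, $\{\nabla\}_\alpha\bar\xi$ is the complex conjugate of $\{\nabla\}_\alpha\xi$, and $*1$ is the volume form. **Equivalence.** Let $H$ be the group of proper Lorentz transformations $\vartheta^j\mapsto\Lambda^j{}_k\vartheta^k$ ($\Lambda$ a smooth matrix function with $o_{jk}\Lambda^j{}_r\Lambda^k{}_s=o_{rs}$, $\det\Lambda>0$, $\Lambda^0{}_0>0$) which preserve the 2-form $l\wedge m$ modulo $\mathrm U(1)$, acting trivially on scalars; let $J$ be the group of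 transformations $(l,m,n,s)\mapsto(e^{-k}l,m,e^kn,e^ks)$ with $k$ an arbitrary smooth real function; let $\tilde H$ be the group generated by $H$ and $J$. Pairs $(\vartheta,s)$, with $\vartheta$ a coframe and $s$ a smooth positive function, are equivalent if they differ by an element of $\tilde H$. Nowhere vanishing spinor fields are equivalent if they are equal modulo $\mathrm U(1)$. **Theorem.** There is a bijection between the equivalence classes of pairs $(\vartheta,s)$ and the equivalence classes of nowhere vanishing spinor fields $\xi$ such that, for arbitrary representatives, the class of $(\vartheta,s)$ corresponds to the class of $\xi$ if and only if $$s\,(l\wedge m)_{\alpha\beta}=\sigma_{\alpha\beta ab}\,\xi^a\xi^b\quad\text{modulo }\mathrm U(1).$$ Moreover, whenever this relation holds, $$s\;l\wedge T^{\mathrm{ax}}=-\tfrac43\,L_{\mathrm{Weyl}}(\xi).$$ -/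

import Mathlib

open scoped ContDiff

noncomputable section

namespace Teleparallel

/-! ## Tensors in local coordinates

Points of the coordinate domain are elements of `Fin 4 → ℝ`. Differential forms are identified
with antisymmetric tensors, given by all their components in the coordinates. Fields are functions
on the whole of `Fin 4 → ℝ`, and only their values on the domain `U` matter. -/

/-- Points of the coordinate space. -/
abbrev Pt := Fin 4 → ℝ

/-- `∂_α f` at the point `x`. -/
def pderiv {F : Type*} [NormedAddCommGroup F] [NormedSpace ℝ F]
    (α : Fin 4) (f : Pt → F) (x : Pt) : F :=
  fderiv ℝ f x (Pi.single α 1)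

/-- `(u ∧ v)_{αβ}` for covectors `u`, `v`. -/
def wedge11 {R : Type*} [CommRing R] (u v : Fin 4 → R) (α β : Fin 4) : R :=
  u α * v β - u β * v α

/-- `(u ∧ F)_{αβγ}` for a covector `u` and a 2-form `F`. -/
def wedge12 {R : Type*} [CommRing R] (u : Fin 4 → R) (F : Fin 4 → Fin 4 → R)
    (α β γ : Fin 4) : R :=
  u α * F β γ + u β * F γ α + u γ * F α β

/-- `(u ∧ T)_{αβγδ}` for a covector `u` and a 3-form `T`. -/
def wedge13 {R : Type*} [CommRing R] (u : Fin 4 → R) (T : Fin 4 → Fin 4 → Fin 4 → R)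
    (α β γ δ : Fin 4) : R :=
  u α * T β γ δ - u β * T α γ δ + u γ * T α β δ - u δ * T α β γ

/-- `(du)_{αβ} = ∂_α u_β - ∂_β u_α` for a real covector field `u`. -/
def extDer (u : Pt → Fin 4 → ℝ) (x : Pt) (α β : Fin 4) : ℝ :=
  pderiv α (fun y => u y β) x - pderiv β (fun y => u y α) x

/-- The totally antisymmetric symbol with `ε_{0123} = 1`. -/
def leviCivita (α β γ δ : Fin 4) : ℤ :=
  (Matrix.of fun i j : Fin 4 => if ![α, β, γ, δ] i = j then (1 : ℤ) else 0).det

/-- `o_{jk} = diag(1, -1, -1, -1)`. -/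
def minkowski : Matrix (Fin 4) (Fin 4) ℝ := Matrix.diagonal ![1, -1, -1, -1]

/-- `g` is a smooth symmetric covariant 2-tensor of signature `(+, -, -, -)` on `U`. -/
structure IsLorentzianMetric (U : Set Pt) (g : Pt → Matrix (Fin 4) (Fin 4) ℝ) : Prop where
  smooth : ∀ α β, ContDiffOn ℝ ∞ (fun x => g x α β) U
  signature : ∀ x ∈ U, ∃ P : Matrix (Fin 4) (Fin 4) ℝ,
    IsUnit P.det ∧ g x = P.transpose * minkowski * P

/-- `√|det g|` at `x`. -/
def volDensity (g : Pt → Matrix (Fin 4) (Fin 4) ℝ) (x : Pt) : ℝ := Real.sqrt |(g x).det|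

/-- The volume form `*1`. -/
def volForm (g : Pt → Matrix (Fin 4) (Fin 4) ℝ) (x : Pt) (α β γ δ : Fin 4) : ℝ :=
  volDensity g x * leviCivita α β γ δ

/-- The Hodge star of a complex 2-form `R` at `x`:
`(*R)_{γδ} = (1/2) √|det g| R^{αβ} ε_{αβγδ}`. -/
def hodge2 (g : Pt → Matrix (Fin 4) (Fin 4) ℝ) (x : Pt) (R : Fin 4 → Fin 4 → ℂ)
    (γ δ : Fin 4) : ℂ :=
  (1 / 2) * (volDensity g x : ℂ) *
    ∑ α, ∑ β, (∑ μ, ∑ ν, ((g x)⁻¹ α μ : ℂ) * ((g x)⁻¹ β ν : ℂ) * R μ ν) * (leviCivita α β γ δ : ℂ)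

/-- The Christoffel symbols `{Γ}^β_{αγ}` of `g`. -/
def christoffel (g : Pt → Matrix (Fin 4) (Fin 4) ℝ) (x : Pt) (β α γ : Fin 4) : ℝ :=
  (1 / 2) * ∑ δ, (g x)⁻¹ β δ *
    (pderiv α (fun y => g y γ δ) x + pderiv γ (fun y => g y α δ) x - pderiv δ (fun y => g y α γ) x)

/-- Equality modulo `U(1)` on `U`: the fields differ by a constant complex factor of modulus 1. -/
def EqModU1 {V : Type*} [SMul ℂ V] (U : Set Pt) (A B : Pt → V) : Prop :=
  ∃ c : ℂ, ‖c‖ = 1 ∧ ∀ x ∈ U, A x = c • B x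

/-! ## Coframes

A quartet of real covector fields is a matrix field `θ` with `θ x j α` the component `ϑ^j_α`. -/

/-- `ϑ^j` are smooth, `g_{αβ} = o_{jk} ϑ^j_α ϑ^k_β` and `det ϑ^j_α > 0` on `U`. -/
structure IsOrientedCoframe (U : Set Pt) (g θ : Pt → Matrix (Fin 4) (Fin 4) ℝ) : Prop where
  smooth : ∀ j α, ContDiffOn ℝ ∞ (fun x => θ x j α) U
  metric : ∀ x ∈ U, ∀ α β, g x α β = ∑ j, ∑ k, minkowski j k * θ x j α * θ x k β
  orient : ∀ x ∈ U, 0 < (θ x).det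

/-- The coframes serving as dynamical variable: they are oriented, and future directed with
respect to the reference coframe `θ₀`, that is, `ϑ₀^0 · ϑ^0 > 0`. -/
structure Coframe (U : Set Pt) (g θ₀ : Pt → Matrix (Fin 4) (Fin 4) ℝ) where
  /-- the components `ϑ^j_α` -/
  θ : Pt → Matrix (Fin 4) (Fin 4) ℝ
  isOriented : IsOrientedCoframe U g θ
  time : ∀ x ∈ U, 0 < ∑ α, ∑ β, (g x)⁻¹ α β * θ₀ x 0 α * θ x 0 β

/-- `l = ϑ^0 + ϑ^3`. -/
def covL (θ : Pt → Matrix (Fin 4) (Fin 4) ℝ) (x : Pt) (α : Fin 4) : ℝ := θ x 0 α + θ x 3 α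

/-- `m = ϑ^1 + i ϑ^2`. -/
def covM (θ : Pt → Matrix (Fin 4) (Fin 4) ℝ) (x : Pt) (α : Fin 4) : ℂ :=
  θ x 1 α + Complex.I * θ x 2 α

/-- The complex 2-form `l ∧ m`. -/
def lWedgeM (θ : Pt → Matrix (Fin 4) (Fin 4) ℝ) (x : Pt) : Fin 4 → Fin 4 → ℂ :=
  wedge11 (fun α => (covL θ x α : ℂ)) (covM θ x)

/-- Axial torsion `T^ax = (1/3) o_{jk} ϑ^j ∧ dϑ^k`. -/
def axialTorsion (θ : Pt → Matrix (Fin 4) (Fin 4) ℝ) (x : Pt) (α β γ : Fin 4) : ℝ :=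
  (1 / 3) * ∑ j, ∑ k, minkowski j k * wedge12 (θ x j) (extDer (fun y => θ y k) x) α β γ

/-- `L_tele(ϑ) = l ∧ T^ax`. -/
def teleLagrangian (θ : Pt → Matrix (Fin 4) (Fin 4) ℝ) (x : Pt) (α β γ δ : Fin 4) : ℝ :=
  wedge13 (covL θ x) (axialTorsion θ x) α β γ δ

/-- The modified Lagrangian `s L_tele(ϑ) = s l ∧ T^ax`. -/
def modTeleLagrangian (θ : Pt → Matrix (Fin 4) (Fin 4) ℝ) (s : Pt → ℝ) (x : Pt)
    (α β γ δ : Fin 4) : ℝ :=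
  s x * teleLagrangian θ x α β γ δ

/-- The dynamical variables "coframe + smooth positive scalar". -/
structure CoframeScalar (U : Set Pt) (g θ₀ : Pt → Matrix (Fin 4) (Fin 4) ℝ) extends
    Coframe U g θ₀ where
  /-- the scalar -/
  s : Pt → ℝ
  smooth_s : ContDiffOn ℝ ∞ s U
  pos : ∀ x ∈ U, 0 < s x

/-! ## The gauge groups -/

/-- Proper Lorentz matrices. -/
structure IsProperLorentz (Λ : Matrix (Fin 4) (Fin 4) ℝ) : Prop where
  lorentz : ∀ r t, ∑ j, ∑ k, minkowski j k * Λ j r * Λ k t = minkowski r t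
  det_pos : 0 < Λ.det
  time : 0 < Λ 0 0

/-- Pointwise transformations of "coframe + scalar": a pair `(Λ, κ)` acts by
`ϑ ↦ Λ ϑ`, `s ↦ κ s`. -/
abbrev Transf := Pt → GL (Fin 4) ℝ × ℝˣ

/-- The coframe `Λ ϑ`, i.e. `ϑ̃^j = Λ^j_k ϑ^k`. -/
def Transf.actFrame (h : Transf) (θ : Pt → Matrix (Fin 4) (Fin 4) ℝ) :
    Pt → Matrix (Fin 4) (Fin 4) ℝ :=
  fun x => ((h x).1 : Matrix (Fin 4) (Fin 4) ℝ) * θ x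

/-- The scalar `κ s`. -/
def Transf.actScalar (h : Transf) (s : Pt → ℝ) : Pt → ℝ := fun x => ((h x).2 : ℝ) * s x

/-- The group `H`: smooth proper Lorentz transformations `Λ` of the coframe which preserve
`l ∧ m` modulo `U(1)`; they leave the scalar unchanged. -/
def transfH (U : Set Pt) (g θ₀ : Pt → Matrix (Fin 4) (Fin 4) ℝ) : Set Transf :=
  {h | (∀ j k, ContDiffOn ℝ ∞ (fun x => ((h x).1 : Matrix (Fin 4) (Fin 4) ℝ) j k) U) ∧
    (∀ x ∈ U, IsProperLorentz ((h x).1 : Matrix (Fin 4) (Fin 4) ℝ) ∧ (h x).2 = 1) ∧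
    ∀ θ : Coframe U g θ₀, EqModU1 U (lWedgeM θ.θ) (lWedgeM (h.actFrame θ.θ))}

/-- The matrix of the Lorentz boost `ϑ^0 ↦ cosh k ϑ^0 - sinh k ϑ^3`,
`ϑ^3 ↦ -sinh k ϑ^0 + cosh k ϑ^3`. -/
def boost (k : ℝ) : Matrix (Fin 4) (Fin 4) ℝ :=
  !![Real.cosh k, 0, 0, -Real.sinh k;
     0, 1, 0, 0;
     0, 0, 1, 0;
     -Real.sinh k, 0, 0, Real.cosh k]

/-- The group `J`: `(l, m, n, s) ↦ (e^{-k} l, m, e^k n, e^k s)`, where `n = ϑ^0 - ϑ^3` and `k` is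
an arbitrary smooth real function. -/
def transfJ (U : Set Pt) : Set Transf :=
  {h | ∃ k : Pt → ℝ, ContDiffOn ℝ ∞ k U ∧ ∀ x ∈ U,
    ((h x).1 : Matrix (Fin 4) (Fin 4) ℝ) = boost (k x) ∧ ((h x).2 : ℝ) = Real.exp (k x)}

/-- The extended gauge group, generated by `H` and `J`. -/
def extGroup (U : Set Pt) (g θ₀ : Pt → Matrix (Fin 4) (Fin 4) ℝ) : Subgroup Transf :=
  Subgroup.closure (transfH U g θ₀ ∪ transfJ U)

/-- Two sets of dynamical variables are equivalent if they differ (on `U`) by a transformation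
from the extended gauge group. -/
def coframeScalarSetoid (U : Set Pt) (g θ₀ : Pt → Matrix (Fin 4) (Fin 4) ℝ) :
    Setoid (CoframeScalar U g θ₀) where
  r a b := ∃ h ∈ extGroup U g θ₀, ∀ x ∈ U,
    b.θ x = h.actFrame a.θ x ∧ b.s x = h.actScalar a.s x
  iseqv :=
    { refl := fun a => ⟨1, one_mem _, fun x _ => by
        simp [Transf.actFrame, Transf.actScalar]⟩
      symm := by
        rintro a b ⟨h, hh, H⟩
        refine ⟨h⁻¹, inv_mem hh, fun x hx => ?_⟩
        obtain ⟨h1, h2⟩ := H x hx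
        constructor
        · simp only [Transf.actFrame, h1, Pi.inv_apply, Prod.fst_inv, ← Matrix.mul_assoc]
          rw [Units.inv_mul, Matrix.one_mul]
        · simp only [Transf.actScalar, h2, Pi.inv_apply, Prod.snd_inv, ← mul_assoc]
          rw [Units.inv_mul, one_mul]
      trans := by
        rintro a b c ⟨h, hh, H⟩ ⟨h', hh', H'⟩
        refine ⟨h' * h, mul_mem hh' hh, fun x hx => ?_⟩
        obtain ⟨h1, h2⟩ := H x hx
        obtain ⟨h1', h2'⟩ := H' x hx
        constructor
        · rw [h1']
          simp only [Transf.actFrame, h1, Pi.mul_apply, Prod.fst_mul, Units.val_mul,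
            Matrix.mul_assoc]
        · rw [h2']
          simp only [Transf.actScalar, h2, Pi.mul_apply, Prod.snd_mul, Units.val_mul, mul_assoc] }

/-! ## Spinors

Pauli matrices are given by `σ x α a b`, the components `σ_{α a ḃ}` with lower tensor index. -/

/-- `ε_{ab}`, also with dotted or upper indices. -/
def spinEps : Matrix (Fin 2) (Fin 2) ℂ := !![0, 1; -1, 0]

/-- `σ^α_{a ḃ} = g^{αβ} σ_{β a ḃ}`. -/
def sigmaUp (g : Pt → Matrix (Fin 4) (Fin 4) ℝ) (σ : Pt → Fin 4 → Matrix (Fin 2) (Fin 2) ℂ)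
    (x : Pt) (α : Fin 4) (a b : Fin 2) : ℂ :=
  ∑ β, ((g x)⁻¹ α β : ℂ) * σ x β a b

/-- Raising both spinor indices: `S^{a ḃ} = ε^{ac} ε^{ḃḋ} S_{c ḋ}`. -/
def raiseSpin (S : Fin 2 → Fin 2 → ℂ) (a b : Fin 2) : ℂ :=
  ∑ c, ∑ d, spinEps a c * spinEps b d * S c d

/-- The second order Pauli matrices
`σ_{αβac} = (1/2) (σ_{α a ḃ} ε^{ḃḋ} σ_{β c ḋ} - σ_{β a ḃ} ε^{ḃḋ} σ_{α c ḋ})`. -/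
def sigma2 (σ : Pt → Fin 4 → Matrix (Fin 2) (Fin 2) ℂ) (x : Pt) (α β : Fin 4)
    (a c : Fin 2) : ℂ :=
  (1 / 2) * ∑ b, ∑ d, (σ x α a b * spinEps b d * σ x β c d - σ x β a b * spinEps b d * σ x α c d)

/-- The complex 2-form `σ_{αβab} ξ^a ξ^b`. -/
def sigmaXiXi (σ : Pt → Fin 4 → Matrix (Fin 2) (Fin 2) ℂ) (ξ : Pt → Fin 2 → ℂ) (x : Pt)
    (α β : Fin 4) : ℂ :=
  ∑ a, ∑ b, sigma2 σ x α β a b * ξ x a * ξ x b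

/-- The forward light cone at `x`: covectors `c_j ϑ^j` with `o^{jk} c_j c_k = 0`, `c_0 > 0`. -/
def forwardCone (θ : Pt → Matrix (Fin 4) (Fin 4) ℝ) (x : Pt) : Set (Fin 4 → ℝ) :=
  {v | ∃ c : Fin 4 → ℝ, ∑ j, ∑ k, minkowski j k * c j * c k = 0 ∧ 0 < c 0 ∧
    ∀ α, v α = ∑ j, c j * θ x j α}

/-- The covectors `σ_{α a ḃ} ζ^a ζ̄^ḃ`, `ζ ≠ 0`, at `x`. -/
def pauliCone (σ : Pt → Fin 4 → Matrix (Fin 2) (Fin 2) ℂ) (x : Pt) : Set (Fin 4 → ℝ) :=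
  {v | ∃ ζ : Fin 2 → ℂ, ζ ≠ 0 ∧
    ∀ α, (v α : ℂ) = ∑ a, ∑ b, σ x α a b * ζ a * starRingEnd ℂ (ζ b)}

/-- `σ` are Pauli matrices on `U`, with the time direction and the orientation of `θ₀`. -/
structure IsPauli (U : Set Pt) (g θ₀ : Pt → Matrix (Fin 4) (Fin 4) ℝ)
    (σ : Pt → Fin 4 → Matrix (Fin 2) (Fin 2) ℂ) : Prop where
  smooth : ∀ α a b, ContDiffOn ℝ ∞ (fun x => σ x α a b) U
  hermitian : ∀ x ∈ U, ∀ α, (σ x α).IsHermitian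
  /-- `σ^α_{aḃ} σ^{βcḃ} + σ^β_{aḃ} σ^{αcḃ} = 2 g^{αβ} δ_a^c` -/
  clifford : ∀ x ∈ U, ∀ α β a c,
    ∑ b, (sigmaUp g σ x α a b * raiseSpin (sigmaUp g σ x β) c b +
      sigmaUp g σ x β a b * raiseSpin (sigmaUp g σ x α) c b) =
    2 * ((g x)⁻¹ α β : ℂ) * (if a = c then 1 else 0)
  time : ∀ x ∈ U, pauliCone σ x = forwardCone θ₀ x
  /-- `*σ = -iσ` -/
  polarized : ∀ x ∈ U, ∀ γ δ a b,
    hodge2 g x (fun α β => sigma2 σ x α β a b) γ δ = -Complex.I * sigma2 σ x γ δ a b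

/-- The Levi-Civita covariant derivative of a spinor field,
`{∇}_α ξ^a = ∂_α ξ^a + (1/4) σ_β^{aċ} (∂_α σ^β_{bċ} + {Γ}^β_{αγ} σ^γ_{bċ}) ξ^b`. -/
def spinCovDeriv (g : Pt → Matrix (Fin 4) (Fin 4) ℝ)
    (σ : Pt → Fin 4 → Matrix (Fin 2) (Fin 2) ℂ) (ξ : Pt → Fin 2 → ℂ) (x : Pt)
    (α : Fin 4) (a : Fin 2) : ℂ :=
  pderiv α (fun y => ξ y a) x +
    (1 / 4) * ∑ β, ∑ c, ∑ b, raiseSpin (σ x β) a c *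
      (pderiv α (fun y => sigmaUp g σ y β b c) x +
        ∑ γ, (christoffel g x β α γ : ℂ) * sigmaUp g σ x γ b c) * ξ x b

/-- The Weyl Lagrangian
`L_Weyl(ξ) = (i/2) (ξ̄^ḃ σ^α_{aḃ} {∇}_α ξ^a - ξ^a σ^α_{aḃ} {∇}_α ξ̄^ḃ) *1`,
where `{∇}_α ξ̄` is the complex conjugate of `{∇}_α ξ`. -/
def weylLagrangian (g : Pt → Matrix (Fin 4) (Fin 4) ℝ)
    (σ : Pt → Fin 4 → Matrix (Fin 2) (Fin 2) ℂ) (ξ : Pt → Fin 2 → ℂ) (x : Pt)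
    (α β γ δ : Fin 4) : ℂ :=
  (Complex.I / 2) * (∑ μ, ∑ a, ∑ b,
    (starRingEnd ℂ (ξ x b) * sigmaUp g σ x μ a b * spinCovDeriv g σ ξ x μ a -
      ξ x a * sigmaUp g σ x μ a b * starRingEnd ℂ (spinCovDeriv g σ ξ x μ b))) *
    (volForm g x α β γ δ : ℂ)

/-- Smooth 2-component spinor fields that do not vanish at any point of `U`. -/
structure NonvanishingSpinor (U : Set Pt) where
  /-- the components `ξ^a` -/
  ξ : Pt → Fin 2 → ℂ
  smooth : ContDiffOn ℝ ∞ ξ U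
  nonvanishing : ∀ x ∈ U, ξ x ≠ 0

/-- Equality of spinor fields modulo `U(1)`. -/
def spinorSetoid (U : Set Pt) : Setoid (NonvanishingSpinor U) where
  r a b := EqModU1 U a.ξ b.ξ
  iseqv :=
    { refl := fun _ => ⟨1, by simp, fun x _ => by simp⟩
      symm := by
        rintro a b ⟨c, hc, H⟩
        have hc0 : c ≠ 0 := by
          rintro rfl
          simp at hc
        refine ⟨c⁻¹, by simp [hc], fun x hx => ?_⟩
        rw [H x hx, smul_smul, inv_mul_cancel₀ hc0, one_smul]
      trans := by
        rintro a b d ⟨c, hc, H⟩ ⟨c', hc', H'⟩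
        refine ⟨c * c', by simp [hc, hc'], fun x hx => ?_⟩
        rw [H x hx, H' x hx, smul_smul] }

end Teleparallel

end

open Teleparallel

/-! The Pauli matrices define a coframe `e = pauliFrame σ` in which they become the constant
matrices `pauliMat`. Every coframe is `ϑ = Λ e` with `Λ` proper Lorentz. In components along `e`,
both sides of the relation become explicit: `l ∧ m` is `pull Λ (spinForm 1 0 0)`, and `σ ξ ξ` is
`spinForm (ξ₀²) (ξ₀ξ₁) (ξ₁²)`.

Bijection. The form `s l ∧ m` is self-dual and decomposable, so its spinor components satisfy `XZ =
Y²` and are not all zero. The map `ξ ↦ ξ ⊗ ξ` is a double covering of this punctured cone with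
fibres `±ξ`. Simple connectedness of `U` therefore gives a continuous root, local branches of the
square root make it smooth (`exists_spinor_sqrt`), and connectedness makes the root unique up to a
constant phase (`eqModU1_of_sq_eq`). Conversely, completing `ξ` to a unimodular dyad `(ξ, η)` gives
the null tetrad `l = σξξ̄`, `m = σξη̄`, `n = σηη̄`. The Clifford relation, the polarization and the
light cone condition make it a coframe with the required orientations. On the coframe side, the
generators of the gauge group preserve `s l ∧ m` up to phase. When two such forms agree up to phase,
the transition matrix is an element of `H` times the boost that carries one scalar to the other
(`coframeScalar_equiv_of_form`).

Lagrangians. Differentiating the relation expresses `∂ξ` through the antisymmetric matrix `W = Λᵀ o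
∂Λ` in the spin representation, plus the real multiple `∂s / (2s)` of `ξ` (`spinor_deriv_eq`). The
real multiple drops out of `Im (ξ̄ σ^μ ∇_μ ξ)`. The 4-form `l ∧ o_{jk} ϑ^j ∧ dϑ^k` is a sum of
determinants with coefficients `ϑᵀ o ∂_μ ϑ`, which split into the contribution of `W`, that of the
spin connection of `e`, and a Christoffel term killed by its symmetry (`sum_rowDet_dmat`). The first
two match the imaginary part of the current, by `rowDet_connection` and `pauliMat_triple`. This
leaves a factor `4/3` against `-1`. -/

namespace Teleparallel

open Matrix Topology

/-! ### Four-fold wedge products as determinants -/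

/-- The determinant of the matrix with rows `u`, `v`, `w`, `z`. -/
def rowDet {R : Type*} [CommRing R] (u v w z : Fin 4 → R) : R :=
  (Matrix.of ![u, v, w, z]).det

section RowDet

variable {R : Type*} [CommRing R]

theorem rowDet_eq (u v w z : Fin 4 → R) : rowDet u v w z =
    (u 0 * v 1 - u 1 * v 0) * (w 2 * z 3 - w 3 * z 2) -
    (u 0 * v 2 - u 2 * v 0) * (w 1 * z 3 - w 3 * z 1) +
    (u 0 * v 3 - u 3 * v 0) * (w 1 * z 2 - w 2 * z 1) +
    (u 1 * v 2 - u 2 * v 1) * (w 0 * z 3 - w 3 * z 0) -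
    (u 1 * v 3 - u 3 * v 1) * (w 0 * z 2 - w 2 * z 0) +
    (u 2 * v 3 - u 3 * v 2) * (w 0 * z 1 - w 1 * z 0) := by
  simp [rowDet, Matrix.det_succ_row_zero, Fin.sum_univ_succ, Fin.succAbove]
  ring

theorem rowDet_mul_det (u v w z : Fin 4 → R) (A : Matrix (Fin 4) (Fin 4) R) :
    rowDet (u ᵥ* A) (v ᵥ* A) (w ᵥ* A) (z ᵥ* A) = rowDet u v w z * A.det := by
  rw [rowDet, rowDet, ← Matrix.det_mul]
  congr 1
  ext i j
  fin_cases i <;> rfl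

theorem rowDet_sum_left (c : Fin 4 → R) (u : Fin 4 → Fin 4 → R) (v w z : Fin 4 → R) :
    rowDet (fun i => ∑ k, c k * u k i) v w z = ∑ k, c k * rowDet (u k) v w z := by
  simp only [rowDet_eq, Fin.sum_univ_four]; ring

theorem rowDet_sum_second (c : Fin 4 → R) (v : Fin 4 → Fin 4 → R) (u w z : Fin 4 → R) :
    rowDet u (fun i => ∑ k, c k * v k i) w z = ∑ k, c k * rowDet u (v k) w z := by
  simp only [rowDet_eq, Fin.sum_univ_four]; ring

theorem rowDet_sum_third (c : Fin 4 → R) (w : Fin 4 → Fin 4 → R) (u v z : Fin 4 → R) :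
    rowDet u v (fun i => ∑ k, c k * w k i) z = ∑ k, c k * rowDet u v (w k) z := by
  simp only [rowDet_eq, Fin.sum_univ_four]; ring

theorem rowDet_sum_fourth (c : Fin 4 → R) (z : Fin 4 → Fin 4 → R) (u v w : Fin 4 → R) :
    rowDet u v w (fun i => ∑ k, c k * z k i) = ∑ k, c k * rowDet u v w (z k) := by
  simp only [rowDet_eq, Fin.sum_univ_four]; ring

theorem leviCivita_eq_rowDet (α β γ δ : Fin 4) :
    (leviCivita α β γ δ : R) =
      rowDet (Pi.single α 1) (Pi.single β 1) (Pi.single γ 1) (Pi.single δ 1) := by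
  rw [leviCivita, rowDet]
  refine ((Int.castRingHom R).map_det _).trans ?_
  congr 1
  ext i j
  fin_cases i <;> simp [Pi.single_apply, eq_comm]

/-- The components of a product of four covectors. -/
theorem rowDet_mul_leviCivita (u v w z : Fin 4 → R) (α β γ δ : Fin 4) :
    rowDet u v w z * (leviCivita α β γ δ : R) =
      rowDet (fun i => u (![α, β, γ, δ] i)) (fun i => v (![α, β, γ, δ] i))
        (fun i => w (![α, β, γ, δ] i)) (fun i => z (![α, β, γ, δ] i)) := by
  -- Right multiplication by the transpose of the matrix of basis rows selects the components with
  -- indices `α, β, γ, δ`, so multiplicativity of the determinant finishes.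
  rw [leviCivita_eq_rowDet, rowDet, rowDet, ← Matrix.det_transpose (Matrix.of ![Pi.single α 1, _, _, _]),
    ← Matrix.det_mul, rowDet]
  congr 1
  ext i j
  fin_cases i <;> fin_cases j <;> simp [Matrix.mul_apply, Pi.single_apply]

theorem wedge13_wedge12_wedge11 (u v a b : Fin 4 → R) (α β γ δ : Fin 4) :
    wedge13 u (wedge12 v (wedge11 a b)) α β γ δ =
      rowDet u v a b * (leviCivita α β γ δ : R) := by
  rw [rowDet_mul_leviCivita, rowDet_eq]
  simp only [wedge13, wedge12, wedge11]
  simp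
  ring

end RowDet

/-! ### Minkowski metric, pull-back of 2-forms, and the Hodge star -/

theorem minkowski_apply (i j : Fin 4) :
    minkowski i j = if i = j then (![1, -1, -1, -1] : Fin 4 → ℝ) i else 0 := by
  simp [minkowski, Matrix.diagonal_apply]

theorem minkowski_mul_self : minkowski * minkowski = 1 := by
  ext i j
  fin_cases i <;> fin_cases j <;> simp [minkowski]

theorem minkowski_transpose : minkowskiᵀ = minkowski := by simp [minkowski]

theorem minkowski_inv : minkowski⁻¹ = minkowski := Matrix.inv_eq_right_inv minkowski_mul_self

theorem minkowski_det : minkowski.det = -1 := by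
  simp [minkowski, Fin.prod_univ_four]

/-- The complexification of a real matrix. -/
def cplx (A : Matrix (Fin 4) (Fin 4) ℝ) : Matrix (Fin 4) (Fin 4) ℂ := A.map Complex.ofRealHom

@[simp] theorem cplx_apply (A : Matrix (Fin 4) (Fin 4) ℝ) (i j : Fin 4) :
    cplx A i j = (A i j : ℂ) := rfl

theorem cplx_mul (A B : Matrix (Fin 4) (Fin 4) ℝ) : cplx (A * B) = cplx A * cplx B :=
  Matrix.map_mul

theorem cplx_one : cplx 1 = 1 := by simp [cplx]

theorem cplx_transpose (A : Matrix (Fin 4) (Fin 4) ℝ) : cplx Aᵀ = (cplx A)ᵀ := rfl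

theorem cplx_det (A : Matrix (Fin 4) (Fin 4) ℝ) : (cplx A).det = (A.det : ℂ) :=
  (RingHom.map_det Complex.ofRealHom A).symm

/-- Pulling a complex 2-form back along a frame. -/
def pull (A : Matrix (Fin 4) (Fin 4) ℝ) (M : Matrix (Fin 4) (Fin 4) ℂ) :
    Matrix (Fin 4) (Fin 4) ℂ :=
  (cplx A)ᵀ * M * cplx A

theorem pull_mul (A B : Matrix (Fin 4) (Fin 4) ℝ) (M : Matrix (Fin 4) (Fin 4) ℂ) :
    pull (A * B) M = pull B (pull A M) := by
  simp [pull, cplx_mul, Matrix.mul_assoc]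

theorem pull_one (M : Matrix (Fin 4) (Fin 4) ℂ) : pull 1 M = M := by simp [pull, cplx_one]

theorem pull_smul (A : Matrix (Fin 4) (Fin 4) ℝ) (c : ℂ) (M : Matrix (Fin 4) (Fin 4) ℂ) :
    pull A (c • M) = c • pull A M := by simp [pull]

/-- An invertible frame loses no information. This is how identities between 2-forms on `U` are
reduced to identities between spinor components. -/
theorem pull_injective {A : Matrix (Fin 4) (Fin 4) ℝ} (hA : A.det ≠ 0)
    {M N : Matrix (Fin 4) (Fin 4) ℂ} (h : pull A M = pull A N) : M = N := by
  have h1 : A * A⁻¹ = 1 := Matrix.mul_nonsing_inv A (isUnit_iff_ne_zero.2 hA)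
  rw [← pull_one M, ← pull_one N, ← h1, pull_mul, pull_mul, h]

theorem pull_zero (A : Matrix (Fin 4) (Fin 4) ℝ) : pull A 0 = 0 := by simp [pull]

/-- The self-dual 2-form with spinor components `X`, `Y`, `Z` with respect to the standard frame. -/
def spinForm (X Y Z : ℂ) : Matrix (Fin 4) (Fin 4) ℂ :=
  !![0, X - Z, Complex.I * (X + Z), -2 * Y;
     Z - X, 0, 2 * Complex.I * Y, -X - Z;
     -(Complex.I * (X + Z)), -(2 * Complex.I * Y), 0, Complex.I * (Z - X);
     2 * Y, X + Z, Complex.I * (X - Z), 0]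

theorem spinForm_smul (c X Y Z : ℂ) : c • spinForm X Y Z = spinForm (c * X) (c * Y) (c * Z) := by
  ext i j
  fin_cases i <;> fin_cases j <;> simp [spinForm] <;> ring

theorem spinForm_injective {X Y Z X' Y' Z' : ℂ} (h : spinForm X Y Z = spinForm X' Y' Z') :
    X = X' ∧ Y = Y' ∧ Z = Z' := by
  have h1 : X - Z = X' - Z' := by simpa [spinForm] using congrFun (congrFun h 0) 1
  have h2 : X + Z = X' + Z' := by simpa [spinForm] using congrFun (congrFun h 3) 1
  have h3 : Y = Y' := by simpa [spinForm] using congrFun (congrFun h 3) 0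
  exact ⟨by linear_combination (h1 + h2) / 2, h3, by linear_combination (h2 - h1) / 2⟩

theorem spinForm_zero : spinForm 0 0 0 = 0 := by
  ext i j
  fin_cases i <;> fin_cases j <;> simp [spinForm]

/-- In its own frame `l ∧ m` has constant components, namely those of the spinor `(1, 0)`. -/
theorem lWedgeM_eq_pull (θ : Pt → Matrix (Fin 4) (Fin 4) ℝ) (x : Pt) :
    lWedgeM θ x = pull (θ x) (spinForm 1 0 0) := by
  ext α β
  simp [lWedgeM, wedge11, covL, covM, pull, Matrix.mul_apply, Fin.sum_univ_four, spinForm]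
  ring

/-- The density contributes `|det e|` while the Levi-Civita symbol transforms with `det e`, so the
star commutes with a change of frame exactly up to the sign of `det e`. This sign is what later
detects orientation. -/
theorem hodge2_pull {g : Pt → Matrix (Fin 4) (Fin 4) ℝ} {x : Pt} {e : Matrix (Fin 4) (Fin 4) ℝ}
    (he : e.det ≠ 0) (hg : g x = eᵀ * minkowski * e) (M : Matrix (Fin 4) (Fin 4) ℂ) (γ δ : Fin 4) :
    (e.det : ℂ) * hodge2 g x (pull e M) γ δ =
      (|e.det| : ℝ) * pull e (Matrix.of (hodge2 (fun _ => minkowski) x M)) γ δ := by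
  have hu := isUnit_iff_ne_zero.2 he
  set E := e⁻¹ with hE
  have h1 : e * E = 1 := Matrix.mul_nonsing_inv e hu
  have h2 : E * e = 1 := Matrix.nonsing_inv_mul e hu
  have hgi : (g x)⁻¹ = E * minkowski * Eᵀ := by
    apply Matrix.inv_eq_right_inv
    rw [hg]
    calc eᵀ * minkowski * e * (E * minkowski * Eᵀ)
        = eᵀ * minkowski * (e * E) * minkowski * Eᵀ := by simp only [Matrix.mul_assoc]
      _ = eᵀ * (minkowski * minkowski) * Eᵀ := by rw [h1]; simp only [Matrix.mul_one, Matrix.mul_assoc]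
      _ = (E * e)ᵀ := by rw [minkowski_mul_self, Matrix.mul_one, Matrix.transpose_mul]
      _ = 1 := by rw [h2, Matrix.transpose_one]
  have hvol : volDensity g x = |e.det| := by
    rw [volDensity, hg, Matrix.det_mul, Matrix.det_mul, Matrix.det_transpose, minkowski_det]
    rw [show e.det * -1 * e.det = -(e.det ^ 2) by ring, abs_neg, abs_of_nonneg (sq_nonneg _),
      Real.sqrt_sq_eq_abs]
  have hvol' : volDensity (fun _ => minkowski) x = 1 := by
    rw [volDensity, minkowski_det]; simp
  have hraise : ∀ (G : Matrix (Fin 4) (Fin 4) ℝ) (N : Matrix (Fin 4) (Fin 4) ℂ) (α β : Fin 4),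
      ∑ μ, ∑ ν, (G α μ : ℂ) * (G β ν : ℂ) * N μ ν = (cplx G * N * (cplx G)ᵀ) α β := by
    intro G N α β
    simp only [Matrix.mul_apply, Finset.sum_mul, cplx_apply, Matrix.transpose_apply]
    rw [Finset.sum_comm]
    exact Finset.sum_congr rfl fun _ _ => Finset.sum_congr rfl fun _ _ => by ring
  set N : Matrix (Fin 4) (Fin 4) ℂ := cplx minkowski * M * (cplx minkowski)ᵀ with hN
  have h2c : (cplx e) * cplx E = 1 := by rw [← cplx_mul, h1, cplx_one]
  have hNE : cplx (g x)⁻¹ * pull e M * (cplx (g x)⁻¹)ᵀ = cplx E * N * (cplx E)ᵀ := by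
    rw [hgi, pull, hN]
    simp only [cplx_mul, cplx_transpose, Matrix.transpose_mul, Matrix.transpose_transpose]
    have h3 : (cplx E)ᵀ * (cplx e)ᵀ = 1 := by rw [← Matrix.transpose_mul, h2c, Matrix.transpose_one]
    calc _ = cplx E * cplx minkowski * ((cplx E)ᵀ * (cplx e)ᵀ) * M * (cplx e * cplx E) *
          (cplx minkowski)ᵀ * (cplx E)ᵀ := by simp only [Matrix.mul_assoc]
      _ = _ := by rw [h3, h2c]; simp only [Matrix.mul_one, Matrix.mul_assoc]
  -- Transformation law of `ε`: two slots carry columns of `e⁻¹` and two carry basis vectors.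
  -- Applying `e` to all four turns them into basis vectors and columns of `e`, and multiplies the
  -- determinant by `det e`.
  have key : ∀ i j, (e.det : ℂ) * ∑ α, ∑ β, (E α i : ℂ) * (E β j : ℂ) * (leviCivita α β γ δ : ℂ) =
      ∑ k, ∑ l, (e k γ : ℂ) * (e l δ : ℂ) * (leviCivita i j k l : ℂ) := by
    intro i j
    have a1 : ∑ α, ∑ β, (E α i : ℂ) * (E β j : ℂ) * (leviCivita α β γ δ : ℂ) =
        rowDet (fun a => (E a i : ℂ)) (fun a => (E a j : ℂ)) (Pi.single γ 1) (Pi.single δ 1) := by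
      have b1 : ∀ u : Fin 4 → ℂ, u = fun a => ∑ k, u k * (Pi.single k 1 : Fin 4 → ℂ) a := by
        intro u; ext a; simp [Pi.single_apply]
      rw [b1 (fun a => (E a i : ℂ)), b1 (fun a => (E a j : ℂ)), rowDet_sum_left]
      simp only [rowDet_sum_second, leviCivita_eq_rowDet, Finset.mul_sum, mul_assoc]
    have a2 : ∑ k, ∑ l, (e k γ : ℂ) * (e l δ : ℂ) * (leviCivita i j k l : ℂ) =
        rowDet (Pi.single i 1) (Pi.single j 1) (fun a => (e a γ : ℂ)) (fun a => (e a δ : ℂ)) := by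
      have b1 : ∀ u : Fin 4 → ℂ, u = fun a => ∑ k, u k * (Pi.single k 1 : Fin 4 → ℂ) a := by
        intro u; ext a; simp [Pi.single_apply]
      rw [b1 (fun a => (e a γ : ℂ)), b1 (fun a => (e a δ : ℂ)), rowDet_sum_third]
      simp only [rowDet_sum_fourth, leviCivita_eq_rowDet, Finset.mul_sum, mul_assoc]
    rw [a1, a2, mul_comm, ← cplx_det, ← Matrix.det_transpose, ← rowDet_mul_det]
    have c1 : ∀ i, (fun a => (E a i : ℂ)) ᵥ* (cplx e)ᵀ = Pi.single i 1 := by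
      intro i
      ext b
      have := congrFun (congrFun h2c b) i
      simp only [Matrix.mul_apply, cplx_apply] at this
      simp only [Matrix.vecMul, dotProduct, Matrix.transpose_apply, cplx_apply]
      rw [Pi.single_apply, ← Matrix.one_apply, ← this]
      exact Finset.sum_congr rfl fun _ _ => mul_comm _ _
    have c2 : ∀ γ, (Pi.single γ 1 : Fin 4 → ℂ) ᵥ* (cplx e)ᵀ = fun a => (e a γ : ℂ) := by
      intro γ
      ext b
      simp
    rw [c1, c1, c2, c2]
  have hl : hodge2 g x (pull e M) γ δ = (1 / 2) * (|e.det| : ℝ) *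
      ∑ i, ∑ j, N i j * ∑ α, ∑ β, (E α i : ℂ) * (E β j : ℂ) * (leviCivita α β γ δ : ℂ) := by
    unfold hodge2
    rw [hvol]
    congr 1
    simp only [hraise, hNE]
    simp only [Matrix.mul_apply, Finset.sum_mul, Finset.mul_sum, cplx_apply, Matrix.transpose_apply]
    simp only [Fin.sum_univ_four]
    ring
  have hr : ∀ k l, hodge2 (fun _ => minkowski) x M k l = (1 / 2) *
      ∑ i, ∑ j, N i j * (leviCivita i j k l : ℂ) := by
    intro k l
    unfold hodge2
    rw [hvol']
    simp only [hraise, minkowski_inv, Complex.ofReal_one, mul_one, hN]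
  rw [hl]
  calc _ = (1 / 2) * (|e.det| : ℝ) * ∑ i, ∑ j, N i j *
        ((e.det : ℂ) * ∑ α, ∑ β, (E α i : ℂ) * (E β j : ℂ) * (leviCivita α β γ δ : ℂ)) := by
        simp only [Finset.mul_sum]
        refine Finset.sum_congr rfl fun _ _ => Finset.sum_congr rfl fun _ _ =>
          Finset.sum_congr rfl fun _ _ => Finset.sum_congr rfl fun _ _ => by ring
    _ = _ := by
        simp only [key, pull, Matrix.mul_apply, Matrix.of_apply, hr, Matrix.transpose_apply, cplx_apply]
        simp only [Fin.sum_univ_four]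
        ring


/-! ### Spinor dyads and the coframe of the Pauli matrices -/

/-- The complex covector `σ_{α a ḃ} u^a v̄^ḃ`. -/
noncomputable def spinCovector (σ : Pt → Fin 4 → Matrix (Fin 2) (Fin 2) ℂ) (x : Pt) (u v : Fin 2 → ℂ)
    (α : Fin 4) : ℂ :=
  ∑ a, ∑ b, σ x α a b * u a * starRingEnd ℂ (v b)

/-- The quartet of covectors whose null tetrad is
`l = σ ξ ξ̄`, `m = σ ξ η̄`, `n = σ η η̄`. -/
noncomputable def spinFrame (σ : Pt → Fin 4 → Matrix (Fin 2) (Fin 2) ℂ) (ξ η : Pt → Fin 2 → ℂ) (x : Pt) :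
    Matrix (Fin 4) (Fin 4) ℝ :=
  Matrix.of ![fun α => ((spinCovector σ x (ξ x) (ξ x) α).re +
      (spinCovector σ x (η x) (η x) α).re) / 2,
    fun α => (spinCovector σ x (ξ x) (η x) α).re,
    fun α => (spinCovector σ x (ξ x) (η x) α).im,
    fun α => ((spinCovector σ x (ξ x) (ξ x) α).re - (spinCovector σ x (η x) (η x) α).re) / 2]

/-- The coframe `e` with `σ_α = τ_j e^j_α` for the standard Pauli matrices `τ_j`. -/
noncomputable def pauliFrame (σ : Pt → Fin 4 → Matrix (Fin 2) (Fin 2) ℂ) : Pt → Matrix (Fin 4) (Fin 4) ℝ :=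
  spinFrame σ (fun _ => ![1, 0]) (fun _ => ![0, 1])

section Metric

variable {U : Set Pt} {g θ₀ : Pt → Matrix (Fin 4) (Fin 4) ℝ}

theorem IsLorentzianMetric.det_ne_zero (hg : IsLorentzianMetric U g) {x : Pt} (hx : x ∈ U) :
    (g x).det ≠ 0 := by
  obtain ⟨P, hP, h⟩ := hg.signature x hx
  rw [h, Matrix.det_mul, Matrix.det_mul, Matrix.det_transpose, minkowski_det]
  have := hP.ne_zero
  simp [this]

theorem IsLorentzianMetric.symm (hg : IsLorentzianMetric U g) {x : Pt} (hx : x ∈ U) :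
    (g x)ᵀ = g x := by
  obtain ⟨P, -, h⟩ := hg.signature x hx
  rw [h]
  simp [Matrix.transpose_mul, minkowski_transpose, Matrix.mul_assoc]

theorem sum_minkowski (θ : Matrix (Fin 4) (Fin 4) ℝ) (α β : Fin 4) :
    ∑ j, ∑ k, minkowski j k * θ j α * θ k β = (θᵀ * minkowski * θ) α β := by
  simp [Matrix.mul_apply, Fin.sum_univ_four, minkowski_apply]

theorem IsOrientedCoframe.metric_eq {θ : Pt → Matrix (Fin 4) (Fin 4) ℝ}
    (h : IsOrientedCoframe U g θ) {x : Pt} (hx : x ∈ U) : g x = (θ x)ᵀ * minkowski * θ x := by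
  ext α β
  rw [h.metric x hx, sum_minkowski]

theorem IsProperLorentz.eq {Λ : Matrix (Fin 4) (Fin 4) ℝ} (h : IsProperLorentz Λ) :
    Λᵀ * minkowski * Λ = minkowski := by
  ext α β
  rw [← h.lorentz, sum_minkowski]

theorem inv_metric {g e : Matrix (Fin 4) (Fin 4) ℝ}
    (hg : g = eᵀ * minkowski * e) : g⁻¹ = e⁻¹ * minkowski * (e⁻¹)ᵀ := by
  rw [hg, Matrix.mul_inv_rev, Matrix.mul_inv_rev, minkowski_inv, Matrix.transpose_nonsing_inv,
    Matrix.mul_assoc]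

end Metric

section Pauli

variable {U : Set Pt} {g θ₀ : Pt → Matrix (Fin 4) (Fin 4) ℝ}
  {σ : Pt → Fin 4 → Matrix (Fin 2) (Fin 2) ℂ}

/-- The Clifford relation says that the polarization of the `2 × 2` determinant of `σ` is the
metric. Lowering both tensor indices brings it to the covariant form. -/
theorem IsPauli.clifford_lower (hσ : IsPauli U g θ₀ σ) (hg : IsLorentzianMetric U g) {x : Pt}
    (hx : x ∈ U) (α β : Fin 4) :
    σ x α 0 0 * σ x β 1 1 + σ x β 0 0 * σ x α 1 1 - σ x α 0 1 * σ x β 1 0 - σ x β 0 1 * σ x α 1 0 =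
      2 * (g x α β : ℂ) := by
  set s : Fin 2 → Fin 2 → Fin 4 → ℂ := fun a b α => σ x α a b with hs
  set G := cplx (g x) with hG
  set H := cplx (g x)⁻¹ with hH
  have hu := isUnit_iff_ne_zero.2 (hg.det_ne_zero hx)
  have hGH : G * H = 1 := by rw [hG, hH, ← cplx_mul, Matrix.mul_nonsing_inv _ hu, cplx_one]
  have hsymm : Gᵀ = G := by rw [hG, ← cplx_transpose, hg.symm hx]
  have hup : ∀ μ a b, sigmaUp g σ x μ a b = (H *ᵥ s a b) μ := fun μ a b => rfl
  have hv : ∀ u v : Fin 4 → ℂ, G * Matrix.vecMulVec (H *ᵥ u) (H *ᵥ v) * G = Matrix.vecMulVec u v := by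
    intro u v
    rw [Matrix.mul_vecMulVec, Matrix.vecMulVec_mul, Matrix.mulVec_mulVec, hGH, Matrix.one_mulVec,
      ← Matrix.mulVec_transpose, hsymm, Matrix.mulVec_mulVec, hGH, Matrix.one_mulVec]
  have hcl : Matrix.vecMulVec (H *ᵥ s 0 0) (H *ᵥ s 1 1) + Matrix.vecMulVec (H *ᵥ s 1 1) (H *ᵥ s 0 0) -
      Matrix.vecMulVec (H *ᵥ s 0 1) (H *ᵥ s 1 0) - Matrix.vecMulVec (H *ᵥ s 1 0) (H *ᵥ s 0 1) =
      (2 : ℂ) • H := by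
    ext μ ν
    -- The component `a = c = 0` already contains the whole polarized determinant.
    have := hσ.clifford x hx μ ν 0 0
    simp only [Fin.sum_univ_two, raiseSpin, spinEps, hup] at this
    simp at this
    simp only [Matrix.sub_apply, Matrix.add_apply, Matrix.vecMulVec_apply, Matrix.smul_apply,
      smul_eq_mul, hH, cplx_apply]
    rw [← this]
    ring
  have := congrArg (fun M => (G * M * G) α β) hcl
  simp only [Matrix.mul_sub, Matrix.mul_add, Matrix.sub_mul, Matrix.add_mul, hv] at this
  rw [Matrix.mul_smul, hGH, Matrix.smul_mul, Matrix.one_mul] at this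
  simp only [Matrix.sub_apply, Matrix.add_apply, Matrix.vecMulVec_apply, Matrix.smul_apply,
      smul_eq_mul, hG, cplx_apply, hs] at this
  rw [← this]
  ring

theorem IsPauli.star_spinCovector (hσ : IsPauli U g θ₀ σ) {x : Pt} (hx : x ∈ U)
    (u v : Fin 2 → ℂ) (α : Fin 4) :
    starRingEnd ℂ (spinCovector σ x u v α) = spinCovector σ x v u α := by
  have h : ∀ a b, starRingEnd ℂ (σ x α a b) = σ x α b a := fun a b => (hσ.hermitian x hx α).apply b a
  simp only [spinCovector, Fin.sum_univ_two, map_add, map_mul, h, Complex.conj_conj]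
  ring

theorem IsPauli.spinCovector_re (hσ : IsPauli U g θ₀ σ) {x : Pt} (hx : x ∈ U)
    (u : Fin 2 → ℂ) (α : Fin 4) :
    ((spinCovector σ x u u α).re : ℂ) = spinCovector σ x u u α :=
  Complex.conj_eq_iff_re.1 (hσ.star_spinCovector hx u u α)

/-- Hermiticity replaces real and imaginary parts by linear combinations of `σξξ̄`, `σξη̄`, `σηξ̄`,
`σηη̄`, so that identities for the frame become polynomial ones over `ℂ`. -/
theorem IsPauli.spinFrame_cplx (hσ : IsPauli U g θ₀ σ) {x : Pt} (hx : x ∈ U)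
    (ξ η : Pt → Fin 2 → ℂ) (α : Fin 4) :
    ((spinFrame σ ξ η x 0 α : ℝ) : ℂ) =
        (spinCovector σ x (ξ x) (ξ x) α + spinCovector σ x (η x) (η x) α) / 2 ∧
      ((spinFrame σ ξ η x 1 α : ℝ) : ℂ) =
        (spinCovector σ x (ξ x) (η x) α + spinCovector σ x (η x) (ξ x) α) / 2 ∧
      ((spinFrame σ ξ η x 2 α : ℝ) : ℂ) =
        Complex.I * (spinCovector σ x (η x) (ξ x) α - spinCovector σ x (ξ x) (η x) α) / 2 ∧
      ((spinFrame σ ξ η x 3 α : ℝ) : ℂ) =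
        (spinCovector σ x (ξ x) (ξ x) α - spinCovector σ x (η x) (η x) α) / 2 := by
  have h1 := hσ.spinCovector_re hx (ξ x) α
  have h2 := hσ.spinCovector_re hx (η x) α
  refine ⟨?_, ?_, ?_, ?_⟩
  · simp [spinFrame, h1, h2]
  · rw [← hσ.star_spinCovector hx (ξ x)]
    rw [Complex.add_conj]; simp [spinFrame]
  · rw [← hσ.star_spinCovector hx (ξ x)]
    rw [← neg_sub, Complex.sub_conj]
    simp only [spinFrame]
    simp
    linear_combination ((spinCovector σ x (ξ x) (η x) α).im : ℂ) * Complex.I_mul_I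
  · simp [spinFrame, h1, h2]

/-- The symmetric tensor `(l n + n l - m m̄ - m̄ m) / 2` equals half the polarized determinant of
`σ` times `|ξ₀η₁ - ξ₁η₀|²`, and this modulus is `1` for a unimodular dyad. -/
theorem IsPauli.spinFrame_metric (hσ : IsPauli U g θ₀ σ) (hg : IsLorentzianMetric U g) {x : Pt}
    (hx : x ∈ U) {ξ η : Pt → Fin 2 → ℂ} (h : ξ x 0 * η x 1 - ξ x 1 * η x 0 = 1) :
    g x = (spinFrame σ ξ η x)ᵀ * minkowski * spinFrame σ ξ η x := by
  ext α β
  rw [← sum_minkowski]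
  simp only [Fin.sum_univ_four, minkowski_apply]
  simp
  have hc : starRingEnd ℂ (ξ x 0) * starRingEnd ℂ (η x 1) -
      starRingEnd ℂ (ξ x 1) * starRingEnd ℂ (η x 0) = 1 := by
    rw [← map_mul, ← map_mul, ← map_sub, h, map_one]
  apply Complex.ofReal_injective
  push_cast
  obtain ⟨a0, a1, a2, a3⟩ := hσ.spinFrame_cplx hx ξ η α
  obtain ⟨b0, b1, b2, b3⟩ := hσ.spinFrame_cplx hx ξ η β
  rw [a0, a1, a2, a3, b0, b1, b2, b3]
  have hcl := hσ.clifford_lower hg hx α β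
  have e1 : (g x α β : ℂ) = (ξ x 0 * η x 1 - ξ x 1 * η x 0) * (starRingEnd ℂ (ξ x 0) *
      starRingEnd ℂ (η x 1) - starRingEnd ℂ (ξ x 1) * starRingEnd ℂ (η x 0)) *
      (σ x α 0 0 * σ x β 1 1 + σ x β 0 0 * σ x α 1 1 - σ x α 0 1 * σ x β 1 0
        - σ x β 0 1 * σ x α 1 0) / 2 := by
    rw [h, hc, hcl]; ring
  rw [e1]
  simp only [spinCovector, Fin.sum_univ_two]
  ring_nf
  simp only [Complex.I_sq]
  ring

/-- Antisymmetrizing `σξξ̄ ⊗ σξη̄` in the tensor indices antisymmetrizes the dotted spinor indices.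
This leaves `σ ξ ξ` times the conjugate of `ξ₀η₁ - ξ₁η₀ = 1`. -/
theorem IsPauli.lWedgeM_spinFrame (hσ : IsPauli U g θ₀ σ) {x : Pt}
    (hx : x ∈ U) {ξ η : Pt → Fin 2 → ℂ} (h : ξ x 0 * η x 1 - ξ x 1 * η x 0 = 1) :
    lWedgeM (spinFrame σ ξ η) x = sigmaXiXi σ ξ x := by
  ext α β
  have hc : starRingEnd ℂ (ξ x 0) * starRingEnd ℂ (η x 1) -
      starRingEnd ℂ (ξ x 1) * starRingEnd ℂ (η x 0) = 1 := by
    rw [← map_mul, ← map_mul, ← map_sub, h, map_one]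
  simp only [lWedgeM, wedge11, covL, covM]
  push_cast
  obtain ⟨a0, a1, a2, a3⟩ := hσ.spinFrame_cplx hx ξ η α
  obtain ⟨b0, b1, b2, b3⟩ := hσ.spinFrame_cplx hx ξ η β
  rw [a0, a1, a2, a3, b0, b1, b2, b3]
  have hm : ∀ u v : ℂ, (u + v) / 2 + Complex.I * (Complex.I * (v - u) / 2) = u := by
    intro u v; linear_combination ((v - u) / 2) * Complex.I_mul_I
  rw [hm, hm]
  have e1 : sigmaXiXi σ ξ x α β = (starRingEnd ℂ (ξ x 0) * starRingEnd ℂ (η x 1) -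
      starRingEnd ℂ (ξ x 1) * starRingEnd ℂ (η x 0)) * sigmaXiXi σ ξ x α β := by rw [hc, one_mul]
  rw [e1]
  simp only [spinCovector, sigmaXiXi, sigma2, spinEps, Fin.sum_univ_two]
  simp
  ring

theorem spinCovector_basis (x : Pt) (u v : Fin 2 → ℂ) (α : Fin 4) :
    spinCovector σ x u v α = σ x α 0 0 * u 0 * starRingEnd ℂ (v 0) +
      σ x α 0 1 * u 0 * starRingEnd ℂ (v 1) + σ x α 1 0 * u 1 * starRingEnd ℂ (v 0) +
      σ x α 1 1 * u 1 * starRingEnd ℂ (v 1) := by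
  simp [spinCovector, Fin.sum_univ_two]; ring

/-- The Pauli matrices in terms of the coframe they define. -/
theorem IsPauli.eq_pauliFrame (hσ : IsPauli U g θ₀ σ) {x : Pt} (hx : x ∈ U) (α : Fin 4) :
    σ x α 0 0 = pauliFrame σ x 0 α + pauliFrame σ x 3 α ∧
    σ x α 0 1 = pauliFrame σ x 1 α + Complex.I * pauliFrame σ x 2 α ∧
    σ x α 1 0 = pauliFrame σ x 1 α - Complex.I * pauliFrame σ x 2 α ∧
    σ x α 1 1 = pauliFrame σ x 0 α - pauliFrame σ x 3 α := by
  obtain ⟨a0, a1, a2, a3⟩ := hσ.spinFrame_cplx hx (fun _ => ![1, 0]) (fun _ => ![0, 1]) α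
  simp only [pauliFrame, a0, a1, a2, a3, spinCovector_basis]
  simp
  refine ⟨by ring, ?_, ?_, by ring⟩
  · linear_combination (-(σ x α 1 0 - σ x α 0 1) / 2) * Complex.I_mul_I
  · linear_combination ((σ x α 1 0 - σ x α 0 1) / 2) * Complex.I_mul_I

/-- Writing `σ` in its own coframe makes the second order Pauli matrices constant. The entries of
`spinForm` are these constants contracted with `ξ ⊗ ξ`. -/
theorem IsPauli.sigmaXiXi_eq_pull (hσ : IsPauli U g θ₀ σ) {x : Pt} (hx : x ∈ U)
    (ξ : Pt → Fin 2 → ℂ) : sigmaXiXi σ ξ x =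
      pull (pauliFrame σ x) (spinForm (ξ x 0 ^ 2) (ξ x 0 * ξ x 1) (ξ x 1 ^ 2)) := by
  ext α β
  obtain ⟨a0, a1, a2, a3⟩ := hσ.eq_pauliFrame hx α
  obtain ⟨b0, b1, b2, b3⟩ := hσ.eq_pauliFrame hx β
  simp only [sigmaXiXi, sigma2, spinEps, Fin.sum_univ_two, pull, Matrix.mul_apply,
    Matrix.transpose_apply, cplx_apply, Fin.sum_univ_four, a0, a1, a2, a3, b0, b1, b2, b3]
  simp [spinForm]
  ring

theorem IsPauli.hodge2_sigmaXiXi (hσ : IsPauli U g θ₀ σ) {x : Pt} (hx : x ∈ U)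
    (ξ : Pt → Fin 2 → ℂ) (γ δ : Fin 4) :
    hodge2 g x (sigmaXiXi σ ξ x) γ δ = -Complex.I * sigmaXiXi σ ξ x γ δ := by
  have h1 : hodge2 g x (sigmaXiXi σ ξ x) γ δ =
      ∑ a, ∑ b, hodge2 g x (fun α β => sigma2 σ x α β a b) γ δ * ξ x a * ξ x b := by
    unfold hodge2
    have hs : ∀ α β, ∑ μ, ∑ ν, ((g x)⁻¹ α μ : ℂ) * ((g x)⁻¹ β ν : ℂ) * sigmaXiXi σ ξ x μ ν =
        ∑ a, ∑ b, (∑ μ, ∑ ν, ((g x)⁻¹ α μ : ℂ) * ((g x)⁻¹ β ν : ℂ) * sigma2 σ x μ ν a b) *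
          ξ x a * ξ x b := by
      intro α β
      simp only [sigmaXiXi, Fin.sum_univ_two, Fin.sum_univ_four]
      ring
    simp only [hs]
    generalize ht : (fun α β a b => ∑ μ, ∑ ν, ((g x)⁻¹ α μ : ℂ) * ((g x)⁻¹ β ν : ℂ) *
      sigma2 σ x μ ν a b) = t
    have ht' : ∀ α β a b, ∑ μ, ∑ ν, ((g x)⁻¹ α μ : ℂ) * ((g x)⁻¹ β ν : ℂ) *
      sigma2 σ x μ ν a b = t α β a b := fun α β a b => by rw [← ht]
    simp only [ht']
    simp only [Fin.sum_univ_two, Finset.mul_sum, Finset.sum_mul, ← Finset.sum_add_distrib]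
    refine Finset.sum_congr rfl fun _ _ => Finset.sum_congr rfl fun _ _ => by ring
  rw [h1]
  simp only [hσ.polarized x hx, sigmaXiXi, Finset.mul_sum]
  refine Finset.sum_congr rfl fun _ _ => Finset.sum_congr rfl fun _ _ => by ring

theorem det_ne_zero_of_metric {g e : Matrix (Fin 4) (Fin 4) ℝ} (hg : g.det ≠ 0)
    (h : g = eᵀ * minkowski * e) : e.det ≠ 0 := by
  rintro h0
  apply hg
  rw [h, Matrix.det_mul, h0, mul_zero]

theorem hodge2_minkowski (x : Pt) (M : Matrix (Fin 4) (Fin 4) ℂ) (γ δ : Fin 4) :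
    hodge2 (fun _ => minkowski) x M γ δ = (1 / 2) *
      ∑ i, ∑ j, (minkowski i i : ℂ) * (minkowski j j : ℂ) * M i j *
        rowDet (Pi.single i 1) (Pi.single j 1) (Pi.single γ 1) (Pi.single δ 1) := by
  have hv : volDensity (fun _ => minkowski) x = 1 := by
    rw [volDensity, minkowski_det]; simp
  have hs : ∀ i j, ∑ μ, ∑ ν, ((minkowski)⁻¹ i μ : ℂ) * ((minkowski)⁻¹ j ν : ℂ) * M μ ν =
      (minkowski i i : ℂ) * (minkowski j j : ℂ) * M i j := by
    intro i j
    rw [minkowski_inv, Finset.sum_eq_single i, Finset.sum_eq_single j]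
    · intro b _ hb; simp [minkowski_apply, hb.symm]
    · simp
    · intro b _ hb
      simp [minkowski_apply, hb.symm]
    · simp
  unfold hodge2
  simp only [hv, hs, leviCivita_eq_rowDet, Complex.ofReal_one, mul_one]

set_option maxHeartbeats 1000000 in
-- Fixes the sign convention: `spinForm` lies in the eigenspace `-i` of the star, the same one as in
-- `IsPauli.polarized`.
theorem hodge2_spinForm_one (x : Pt) :
    Matrix.of (hodge2 (fun _ => minkowski) x (spinForm 1 0 0)) =
      (-Complex.I) • spinForm 1 0 0 := by
  ext γ δ
  rw [Matrix.of_apply, hodge2_minkowski, Matrix.smul_apply]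
  simp only [Fin.sum_univ_four, spinForm, minkowski_apply, rowDet_eq]
  fin_cases γ <;> fin_cases δ <;> simp <;> norm_num <;> ring

/-- For `F = σ ξ ξ` the polarization gives `*F = -iF`, while transport from the standard frame gives
`(det e) *F = |det e| (-iF)`. Since `F ≠ 0`, it follows that `det e = |det e|`. -/
theorem IsPauli.spinFrame_det_pos (hσ : IsPauli U g θ₀ σ) (hg : IsLorentzianMetric U g) {x : Pt}
    (hx : x ∈ U) {ξ η : Pt → Fin 2 → ℂ} (h : ξ x 0 * η x 1 - ξ x 1 * η x 0 = 1) :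
    0 < (spinFrame σ ξ η x).det := by
  have hm := hσ.spinFrame_metric hg hx h
  have hd := det_ne_zero_of_metric (hg.det_ne_zero hx) hm
  set e := spinFrame σ ξ η x with he
  have hF : sigmaXiXi σ ξ x = pull e (spinForm 1 0 0) := by
    rw [← hσ.lWedgeM_spinFrame hx h, lWedgeM_eq_pull]
  have key : (e.det : ℂ) • pull e (spinForm 1 0 0) = ((|e.det| : ℝ) : ℂ) • pull e (spinForm 1 0 0) := by
    have h1 : ∀ γ δ, (e.det : ℂ) * (-Complex.I * pull e (spinForm 1 0 0) γ δ) =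
        (|e.det| : ℝ) * (-Complex.I * pull e (spinForm 1 0 0) γ δ) := by
      intro γ δ
      have h2 := hodge2_pull hd hm (spinForm 1 0 0) γ δ
      rw [hodge2_spinForm_one, pull_smul, ← hF, hσ.hodge2_sigmaXiXi hx, hF] at h2
      exact h2
    ext γ δ
    have := h1 γ δ
    simp only [Matrix.smul_apply, smul_eq_mul]
    linear_combination Complex.I * this +
      ((e.det : ℂ) - (|e.det| : ℝ)) * pull e (spinForm 1 0 0) γ δ * Complex.I_mul_I
  rw [← pull_smul, ← pull_smul] at key
  have h3 := pull_injective hd key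
  rw [spinForm_smul, spinForm_smul] at h3
  have h4 := (spinForm_injective h3).1
  simp only [mul_one, Complex.ofReal_inj] at h4
  exact lt_of_le_of_ne (h4 ▸ abs_nonneg _) hd.symm

/-- Here `ϑ^0` is the half-sum of `σξξ̄` and `σηη̄`, both on the forward cone, and the product of
the reference `ϑ^0` with a covector `c_j ϑ^j` of that cone is `c_0 > 0`. -/
theorem IsPauli.spinFrame_time (hσ : IsPauli U g θ₀ σ) (hθ₀ : IsOrientedCoframe U g θ₀) {x : Pt}
    (hx : x ∈ U) {ξ η : Pt → Fin 2 → ℂ} (h : ξ x 0 * η x 1 - ξ x 1 * η x 0 = 1) :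
    0 < ∑ α, ∑ β, (g x)⁻¹ α β * θ₀ x 0 α * spinFrame σ ξ η x 0 β := by
  have hd := (hθ₀.orient x hx).ne'
  have hi := inv_metric (hθ₀.metric_eq hx)
  have h1 : (θ₀ x)⁻¹ * θ₀ x = 1 := Matrix.nonsing_inv_mul _ (isUnit_iff_ne_zero.2 hd)
  have h2 : θ₀ x * (θ₀ x)⁻¹ = 1 := Matrix.mul_nonsing_inv _ (isUnit_iff_ne_zero.2 hd)
  have key : ∀ ζ : Fin 2 → ℂ, ζ ≠ 0 → 0 < ∑ α, ∑ β, (g x)⁻¹ α β * θ₀ x 0 α *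
      (spinCovector σ x ζ ζ β).re := by
    intro ζ hζ
    have hm : (fun α => (spinCovector σ x ζ ζ α).re) ∈ pauliCone σ x :=
      ⟨ζ, hζ, fun α => hσ.spinCovector_re hx ζ α⟩
    rw [hσ.time x hx] at hm
    obtain ⟨c, -, hc0, hc⟩ := hm
    have : ∑ α, ∑ β, (g x)⁻¹ α β * θ₀ x 0 α * (spinCovector σ x ζ ζ β).re = c 0 := by
      have h3 : ∀ v : Fin 4 → ℝ, ∑ α, ∑ β, (g x)⁻¹ α β * θ₀ x 0 α * v β =
          (θ₀ x *ᵥ ((g x)⁻¹ *ᵥ v)) 0 := by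
        intro v
        simp only [Matrix.mulVec, dotProduct, Finset.mul_sum]
        refine Finset.sum_congr rfl fun _ _ => Finset.sum_congr rfl fun _ _ => by ring
      have h4 : (fun α => (spinCovector σ x ζ ζ α).re) = (θ₀ x)ᵀ *ᵥ c := by
        ext α
        refine (hc α).trans ?_
        simp only [Matrix.mulVec, dotProduct, Matrix.transpose_apply]
        exact Finset.sum_congr rfl fun _ _ => mul_comm _ _
      have h5 := h3 (fun α => (spinCovector σ x ζ ζ α).re)
      rw [h5, h4, Matrix.mulVec_mulVec, Matrix.mulVec_mulVec, hi, Matrix.mul_assoc]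
      have h6 : θ₀ x * ((θ₀ x)⁻¹ * minkowski * ((θ₀ x)⁻¹)ᵀ * (θ₀ x)ᵀ) = minkowski := by
        rw [Matrix.mul_assoc _ ((θ₀ x)⁻¹)ᵀ, ← Matrix.transpose_mul, h2, Matrix.transpose_one,
          Matrix.mul_one, ← Matrix.mul_assoc, h2, Matrix.one_mul]
      rw [h6]
      simp [Matrix.mulVec, dotProduct, minkowski_apply]
    rw [this]
    exact hc0
  have hξ : ξ x ≠ 0 := by
    intro h0
    simp [h0] at h
  have hη : η x ≠ 0 := by
    intro h0
    simp [h0] at h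
  have := add_pos (key _ hξ) (key _ hη)
  rw [← Finset.sum_add_distrib] at this
  simp only [← Finset.sum_add_distrib] at this
  have e1 : ∑ α, ∑ β, (g x)⁻¹ α β * θ₀ x 0 α * spinFrame σ ξ η x 0 β =
      (∑ α, ∑ β, ((g x)⁻¹ α β * θ₀ x 0 α * (spinCovector σ x (ξ x) (ξ x) β).re +
        (g x)⁻¹ α β * θ₀ x 0 α * (spinCovector σ x (η x) (η x) β).re)) / 2 := by
    simp only [Finset.sum_div]
    refine Finset.sum_congr rfl fun _ _ => Finset.sum_congr rfl fun _ _ => ?_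
    simp only [spinFrame]
    simp
    ring
  rw [e1]
  exact half_pos this

theorem IsPauli.spinFrame_smooth (hσ : IsPauli U g θ₀ σ) {ξ η : Pt → Fin 2 → ℂ}
    (hξ : ContDiffOn ℝ ∞ ξ U) (hη : ContDiffOn ℝ ∞ η U) (j α : Fin 4) :
    ContDiffOn ℝ ∞ (fun x => spinFrame σ ξ η x j α) U := by
  have key : ∀ u v : Pt → Fin 2 → ℂ, ContDiffOn ℝ ∞ u U → ContDiffOn ℝ ∞ v U →
      ContDiffOn ℝ ∞ (fun x => spinCovector σ x (u x) (v x) α) U := by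
    intro u v hu hv
    unfold spinCovector
    refine ContDiffOn.sum fun a _ => ContDiffOn.sum fun b _ => ?_
    refine ((hσ.smooth α a b).mul (contDiffOn_pi.1 hu a)).mul ?_
    exact Complex.conjCLE.contDiff.comp_contDiffOn (contDiffOn_pi.1 hv b)
  have hre : ∀ f : Pt → ℂ, ContDiffOn ℝ ∞ f U → ContDiffOn ℝ ∞ (fun x => (f x).re) U :=
    fun f hf => Complex.reCLM.contDiff.comp_contDiffOn hf
  have him : ∀ f : Pt → ℂ, ContDiffOn ℝ ∞ f U → ContDiffOn ℝ ∞ (fun x => (f x).im) U :=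
    fun f hf => Complex.imCLM.contDiff.comp_contDiffOn hf
  fin_cases j
  · exact ((hre _ (key ξ ξ hξ hξ)).add (hre _ (key η η hη hη))).div_const 2
  · exact hre _ (key ξ η hξ hη)
  · exact him _ (key ξ η hξ hη)
  · exact ((hre _ (key ξ ξ hξ hξ)).sub (hre _ (key η η hη hη))).div_const 2

/-- A unimodular spinor dyad defines a coframe. -/
noncomputable def IsPauli.spinCoframe (hσ : IsPauli U g θ₀ σ) (hg : IsLorentzianMetric U g)
    (hθ₀ : IsOrientedCoframe U g θ₀) {ξ η : Pt → Fin 2 → ℂ}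
    (hξ : ContDiffOn ℝ ∞ ξ U) (hη : ContDiffOn ℝ ∞ η U)
    (h : ∀ x ∈ U, ξ x 0 * η x 1 - ξ x 1 * η x 0 = 1) : Coframe U g θ₀ where
  θ := spinFrame σ ξ η
  isOriented :=
    { smooth := hσ.spinFrame_smooth hξ hη
      metric := fun x hx α β => by
        rw [sum_minkowski, ← hσ.spinFrame_metric hg hx (h x hx)]
      orient := fun x hx => hσ.spinFrame_det_pos hg hx (h x hx) }
  time := fun x hx => hσ.spinFrame_time hθ₀ hx (h x hx)

/-- The coframe of the Pauli matrices. -/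
noncomputable def IsPauli.coframe (hσ : IsPauli U g θ₀ σ) (hg : IsLorentzianMetric U g)
    (hθ₀ : IsOrientedCoframe U g θ₀) : Coframe U g θ₀ :=
  hσ.spinCoframe hg hθ₀ (ξ := fun _ => ![1, 0]) (η := fun _ => ![0, 1]) contDiffOn_const
    contDiffOn_const (fun x _ => by simp)

end Pauli


/-! ### Smoothness of matrix operations -/

section Smooth

variable {U : Set Pt}

theorem contDiffOn_det {n : ℕ} {A : Pt → Matrix (Fin n) (Fin n) ℝ}
    (h : ∀ i j, ContDiffOn ℝ ∞ (fun x => A x i j) U) : ContDiffOn ℝ ∞ (fun x => (A x).det) U := by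
  simp only [Matrix.det_apply']
  exact ContDiffOn.sum fun p _ => contDiffOn_const.mul (contDiffOn_prod fun i _ => h _ _)

theorem contDiffOn_matrix_mul {A B : Pt → Matrix (Fin 4) (Fin 4) ℝ}
    (hA : ∀ i j, ContDiffOn ℝ ∞ (fun x => A x i j) U)
    (hB : ∀ i j, ContDiffOn ℝ ∞ (fun x => B x i j) U) (i j : Fin 4) :
    ContDiffOn ℝ ∞ (fun x => (A x * B x) i j) U := by
  simp only [Matrix.mul_apply]
  exact ContDiffOn.sum fun k _ => (hA i k).mul (hB k j)

theorem contDiffOn_matrix_inv {A : Pt → Matrix (Fin 4) (Fin 4) ℝ}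
    (hA : ∀ i j, ContDiffOn ℝ ∞ (fun x => A x i j) U) (h0 : ∀ x ∈ U, (A x).det ≠ 0)
    (i j : Fin 4) : ContDiffOn ℝ ∞ (fun x => (A x)⁻¹ i j) U := by
  simp only [Matrix.inv_def, Matrix.smul_apply, Ring.inverse_eq_inv', Matrix.adjugate_apply]
  refine (ContDiffOn.inv (contDiffOn_det hA) h0).smul (contDiffOn_det fun k l => ?_)
  simp only [Matrix.updateRow_apply]
  split_ifs
  · exact contDiffOn_const
  · exact hA k l

end Smooth

/-! ### Proper Lorentz matrices and boosts -/

section Lorentz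

theorem IsProperLorentz.det_eq_one {Λ : Matrix (Fin 4) (Fin 4) ℝ} (h : IsProperLorentz Λ) :
    Λ.det = 1 := by
  have h1 := congrArg Matrix.det h.eq
  rw [Matrix.det_mul, Matrix.det_mul, Matrix.det_transpose, minkowski_det] at h1
  nlinarith [h.det_pos]

/-- The relation exhibits `o Λᵀ o` as a left inverse of `Λ`. For square matrices it is also a right
inverse. -/
theorem minkowski_swap {Λ : Matrix (Fin 4) (Fin 4) ℝ} (h : Λᵀ * minkowski * Λ = minkowski) :
    Λ * minkowski * Λᵀ = minkowski := by
  have h1 : (minkowski * Λᵀ * minkowski) * Λ = 1 := by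
    rw [Matrix.mul_assoc, Matrix.mul_assoc, ← Matrix.mul_assoc Λᵀ, h, minkowski_mul_self]
  have h2 := mul_eq_one_comm.1 h1
  calc Λ * minkowski * Λᵀ = (Λ * (minkowski * Λᵀ * minkowski)) * minkowski := by
        simp only [Matrix.mul_assoc, minkowski_mul_self, Matrix.mul_one]
    _ = minkowski := by rw [h2, Matrix.one_mul]

theorem time_sq {Λ : Matrix (Fin 4) (Fin 4) ℝ} (h : Λ * minkowski * Λᵀ = minkowski) :
    Λ 0 0 ^ 2 = 1 + Λ 0 1 ^ 2 + Λ 0 2 ^ 2 + Λ 0 3 ^ 2 := by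
  have := congrFun (congrFun h 0) 0
  simp [Matrix.mul_apply, Fin.sum_univ_four, minkowski_apply] at this
  linarith

/-- Reversed Cauchy–Schwarz: two future unit timelike vectors have positive product. This is why
time orientation survives products and inverses. -/
theorem dot_lt_mul {a0 a1 a2 a3 b0 b1 b2 b3 : ℝ} (ha : 0 < a0) (hb : 0 < b0)
    (ha2 : a0 ^ 2 = 1 + a1 ^ 2 + a2 ^ 2 + a3 ^ 2) (hb2 : b0 ^ 2 = 1 + b1 ^ 2 + b2 ^ 2 + b3 ^ 2) :
    0 < a0 * b0 - a1 * b1 - a2 * b2 - a3 * b3 := by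
  have h : (a1 * b1 + a2 * b2 + a3 * b3) ^ 2 < (a0 * b0) ^ 2 := by
    rw [mul_pow, ha2, hb2]
    nlinarith [sq_nonneg (a1 * b2 - a2 * b1), sq_nonneg (a1 * b3 - a3 * b1),
      sq_nonneg (a2 * b3 - a3 * b2), sq_nonneg a1, sq_nonneg a2, sq_nonneg a3, sq_nonneg b1,
      sq_nonneg b2, sq_nonneg b3]
  have := abs_lt_of_sq_lt_sq h (by positivity)
  linarith [(abs_lt.1 this).2]

theorem IsProperLorentz.mul {A B : Matrix (Fin 4) (Fin 4) ℝ} (hA : IsProperLorentz A)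
    (hB : IsProperLorentz B) : IsProperLorentz (A * B) where
  lorentz := fun r t => by
    rw [sum_minkowski, Matrix.transpose_mul]
    calc (Bᵀ * Aᵀ * minkowski * (A * B)) r t = (Bᵀ * (Aᵀ * minkowski * A) * B) r t := by
          simp only [Matrix.mul_assoc]
      _ = minkowski r t := by rw [hA.eq, hB.eq]
  det_pos := by rw [Matrix.det_mul]; exact mul_pos hA.det_pos hB.det_pos
  time := by
    have h1 := time_sq (minkowski_swap hA.eq)
    have h2 := congrFun (congrFun hB.eq 0) 0
    simp [Matrix.mul_apply, Fin.sum_univ_four, minkowski_apply] at h2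
    -- The entry `(AB)₀₀` is a Euclidean sum, so the spatial entries of the column of `B` are
    -- negated to turn it into a Minkowski product.
    have := dot_lt_mul (b1 := -B 1 0) (b2 := -B 2 0) (b3 := -B 3 0) hA.time hB.time h1
      (by linarith)
    rw [Matrix.mul_apply, Fin.sum_univ_four]
    linarith

theorem boost_isProperLorentz (k : ℝ) : IsProperLorentz (boost k) := by
  have h := Real.cosh_sq k
  refine ⟨fun r t => ?_, ?_, ?_⟩
  · fin_cases r <;> fin_cases t <;>
      simp [boost, Fin.sum_univ_four, minkowski_apply] <;> linarith
  · have : (boost k).det = 1 := by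
      simp [boost, Matrix.det_succ_row_zero, Fin.sum_univ_succ, Fin.succAbove]
      linarith
    rw [this]; exact one_pos
  · simpa [boost] using Real.cosh_pos k

theorem pull_boost (k : ℝ) :
    pull (boost k) (spinForm 1 0 0) = (Real.exp (-k) : ℂ) • spinForm 1 0 0 := by
  have h : (Real.exp (-k) : ℂ) = Real.cosh k - Real.sinh k := by
    rw [← Complex.ofReal_sub, Real.cosh_sub_sinh]
  rw [h, boost]
  generalize Real.cosh k = C
  generalize Real.sinh k = S
  ext i j
  fin_cases i <;> fin_cases j <;>
    simp [pull, Matrix.mul_apply, Fin.sum_univ_four, spinForm] <;> ring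

theorem boost_mul_neg (k : ℝ) : boost (-k) * boost k = 1 := by
  have h := Real.cosh_sq k
  ext i j
  fin_cases i <;> fin_cases j <;>
    simp [Matrix.mul_apply, Fin.sum_univ_four, boost] <;> linarith

end Lorentz

/-! ### Transition matrices between coframes -/

section Transition

variable {U : Set Pt} {g θ₀ : Pt → Matrix (Fin 4) (Fin 4) ℝ}

theorem Coframe.det_ne_zero (θ : Coframe U g θ₀) {x : Pt} (hx : x ∈ U) : (θ.θ x).det ≠ 0 :=
  (θ.isOriented.orient x hx).ne'

theorem Coframe.inv_mul (θ : Coframe U g θ₀) {x : Pt} (hx : x ∈ U) : (θ.θ x)⁻¹ * θ.θ x = 1 :=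
  Matrix.nonsing_inv_mul _ (isUnit_iff_ne_zero.2 (θ.det_ne_zero hx))

theorem Coframe.mul_inv (θ : Coframe U g θ₀) {x : Pt} (hx : x ∈ U) : θ.θ x * (θ.θ x)⁻¹ = 1 :=
  Matrix.mul_nonsing_inv _ (isUnit_iff_ne_zero.2 (θ.det_ne_zero hx))

theorem inv_metric_sum {gi A B : Matrix (Fin 4) (Fin 4) ℝ} (i : Fin 4) :
    ∑ α, ∑ β, gi α β * A i α * B i β = (A * gi * Bᵀ) i i := by
  simp only [Matrix.mul_apply, Finset.sum_mul, Matrix.transpose_apply]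
  rw [Finset.sum_comm]
  exact Finset.sum_congr rfl fun _ _ => Finset.sum_congr rfl fun _ _ => by ring

/-- Two coframes differ by a proper Lorentz transformation. -/
theorem Coframe.transition (θ θ' : Coframe U g θ₀) (hθ₀ : IsOrientedCoframe U g θ₀) {x : Pt}
    (hx : x ∈ U) : IsProperLorentz (θ'.θ x * (θ.θ x)⁻¹) := by
  have hm := θ.isOriented.metric_eq hx
  have hm' := θ'.isOriented.metric_eq hx
  have h1 := θ.inv_mul hx
  have h2 := θ.mul_inv hx
  set A := θ.θ x with hA
  set B := θ'.θ x with hB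
  have d0 := (hθ₀.orient x hx).ne'
  have h01 : (θ₀ x)⁻¹ * θ₀ x = 1 := Matrix.nonsing_inv_mul _ (isUnit_iff_ne_zero.2 d0)
  have h02 : θ₀ x * (θ₀ x)⁻¹ = 1 := Matrix.mul_nonsing_inv _ (isUnit_iff_ne_zero.2 d0)
  have hm0 := hθ₀.metric_eq hx
  have hlor : ∀ C D : Matrix (Fin 4) (Fin 4) ℝ, D * D⁻¹ = 1 → g x = Cᵀ * minkowski * C →
      g x = Dᵀ * minkowski * D → (C * D⁻¹)ᵀ * minkowski * (C * D⁻¹) = minkowski := by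
    intro C D hD hC hD'
    have h3 : (D⁻¹)ᵀ * Dᵀ = 1 := by rw [← Matrix.transpose_mul, hD, Matrix.transpose_one]
    calc (C * D⁻¹)ᵀ * minkowski * (C * D⁻¹) = (D⁻¹)ᵀ * (Cᵀ * minkowski * C) * D⁻¹ := by
          simp only [Matrix.transpose_mul, Matrix.mul_assoc]
      _ = ((D⁻¹)ᵀ * Dᵀ) * minkowski * (D * D⁻¹) := by
          rw [← hC, hD']; simp only [Matrix.mul_assoc]
      _ = minkowski := by rw [h3, hD, Matrix.one_mul, Matrix.mul_one]
  have htime : ∀ C : Matrix (Fin 4) (Fin 4) ℝ,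
      0 < ∑ α, ∑ β, (g x)⁻¹ α β * θ₀ x 0 α * C 0 β → 0 < (C * (θ₀ x)⁻¹) 0 0 := by
    intro C hC
    rw [inv_metric_sum, inv_metric hm0] at hC
    have : θ₀ x * ((θ₀ x)⁻¹ * minkowski * ((θ₀ x)⁻¹)ᵀ) * Cᵀ =
        minkowski * (C * (θ₀ x)⁻¹)ᵀ := by
      calc _ = (θ₀ x * (θ₀ x)⁻¹) * minkowski * (((θ₀ x)⁻¹)ᵀ * Cᵀ) := by
            simp only [Matrix.mul_assoc]
        _ = _ := by rw [h02, Matrix.one_mul, ← Matrix.transpose_mul]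
    rw [this, Matrix.mul_apply, Fin.sum_univ_four] at hC
    simpa [minkowski_apply] using hC
  refine ⟨fun r t => by rw [sum_minkowski, hlor B A h2 hm' hm], ?_, ?_⟩
  · have e1 : A.det * (A⁻¹).det = 1 := by rw [← Matrix.det_mul, h2, Matrix.det_one]
    have e2 : 0 < A.det := θ.isOriented.orient x hx
    have e3 : 0 < (A⁻¹).det := by
      by_contra h
      nlinarith [mul_nonneg e2.le (neg_nonneg.2 (not_lt.1 h))]
    rw [Matrix.det_mul]
    exact mul_pos (θ'.isOriented.orient x hx) e3
  · have tA := htime A (θ.time x hx)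
    have tB := htime B (θ'.time x hx)
    have lA := minkowski_swap (hlor A (θ₀ x) h02 hm hm0)
    have lB := minkowski_swap (hlor B (θ₀ x) h02 hm' hm0)
    set P := A * (θ₀ x)⁻¹ with hP
    set Q := B * (θ₀ x)⁻¹ with hQ
    -- With `P`, `Q` the transitions from the reference coframe and `P⁻¹ = o Pᵀ o`, the entry `(B
    -- A⁻¹)₀₀` is the Minkowski product of the zeroth rows of `Q` and `P`, both future unit vectors.
    have : B * A⁻¹ = Q * (minkowski * Pᵀ * minkowski) := by
      have h3 : P * (minkowski * Pᵀ * minkowski) = 1 := by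
        rw [← Matrix.mul_assoc, ← Matrix.mul_assoc, lA, minkowski_mul_self]
      have h4 : P * (θ₀ x * A⁻¹) = 1 := by
        rw [hP, Matrix.mul_assoc, ← Matrix.mul_assoc _ (θ₀ x), h01, Matrix.one_mul, h2]
      have h5 : minkowski * Pᵀ * minkowski = θ₀ x * A⁻¹ := by
        have h6 := mul_eq_one_comm.1 h4
        calc _ = (θ₀ x * A⁻¹ * P) * (minkowski * Pᵀ * minkowski) := by rw [h6, Matrix.one_mul]
          _ = θ₀ x * A⁻¹ := by rw [Matrix.mul_assoc, h3, Matrix.mul_one]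
      rw [h5, hQ, Matrix.mul_assoc, ← Matrix.mul_assoc _ (θ₀ x), h01, Matrix.one_mul]
    rw [this]
    have := dot_lt_mul tB tA (time_sq lB) (time_sq lA)
    simp [Matrix.mul_apply, Fin.sum_univ_four, minkowski_apply] at this ⊢
    linarith

end Transition

/-! ### The gauge group as stabilizer of `s l ∧ m` -/

section Group

variable {U : Set Pt} {g θ₀ : Pt → Matrix (Fin 4) (Fin 4) ℝ}

theorem GL_pull_inv (A : GL (Fin 4) ℝ) (M : Matrix (Fin 4) (Fin 4) ℂ) :
    pull (A⁻¹ : GL (Fin 4) ℝ).val (pull A.val M) = M := by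
  rw [← pull_mul, ← Units.val_mul, mul_inv_cancel, Units.val_one, pull_one]

/-- The transformations that preserve `s l ∧ m` modulo `U(1)`. -/
def formStabilizer (U : Set Pt) : Subgroup Transf where
  carrier := {h | ∃ c : ℂ, ‖c‖ = 1 ∧ ∀ x ∈ U,
    ((h x).2 : ℂ) • pull (h x).1.val (spinForm 1 0 0) = c • spinForm 1 0 0}
  one_mem' := ⟨1, by simp, fun x _ => by simp [pull_one]⟩
  mul_mem' := by
    rintro h h' ⟨c, hc, H⟩ ⟨c', hc', H'⟩
    refine ⟨c * c', by simp [hc, hc'], fun x hx => ?_⟩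
    have h1 := H x hx
    have h2 := H' x hx
    simp only [Pi.mul_apply, Prod.snd_mul, Prod.fst_mul, Units.val_mul, Complex.ofReal_mul,
      pull_mul]
    rw [mul_comm, mul_smul, ← pull_smul, h1, pull_smul, smul_comm, h2, smul_smul]
  inv_mem' := by
    rintro h ⟨c, hc, H⟩
    have hc0 : c ≠ 0 := by rintro rfl; simp at hc
    refine ⟨c⁻¹, by simp [hc], fun x hx => ?_⟩
    have h1 := congrArg (pull (h x).1⁻¹.val) (H x hx)
    rw [pull_smul, GL_pull_inv, pull_smul] at h1
    have h2 : (((h x).2 : ℝ) : ℂ) ≠ 0 := by exact_mod_cast (h x).2.ne_zero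
    simp only [Pi.inv_apply, Prod.snd_inv, Prod.fst_inv]
    rw [eq_inv_smul_iff₀ hc0, smul_comm, ← h1, smul_smul, ← Complex.ofReal_mul,
      Units.inv_mul, Complex.ofReal_one, one_smul]

/-- It suffices to check generators. For `H`, testing on the single coframe `θ` is enough: it is
invertible, so it can be cancelled, leaving a condition on the matrix alone. For `J`, the boost
gives `e^{-k}` and the scalar gives `e^k`. -/
theorem extGroup_le_formStabilizer (θ : Coframe U g θ₀) :
    extGroup U g θ₀ ≤ formStabilizer U := by
  refine (Subgroup.closure_le _).2 ?_
  rintro h (⟨-, hl, hθ⟩ | ⟨k, -, hk⟩)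
  · obtain ⟨c, hc, H⟩ := hθ θ
    have hc0 : c ≠ 0 := by rintro rfl; simp at hc
    refine ⟨c⁻¹, by simp [hc], fun x hx => ?_⟩
    have h1 := H x hx
    rw [lWedgeM_eq_pull, lWedgeM_eq_pull, Transf.actFrame, pull_mul] at h1
    have h2 := pull_injective (θ.det_ne_zero hx) (h1.trans (pull_smul _ _ _).symm)
    rw [(hl x hx).2, Units.val_one, Complex.ofReal_one, one_smul, eq_inv_smul_iff₀ hc0, ← h2]
  · refine ⟨1, by simp, fun x hx => ?_⟩
    rw [(hk x hx).1, (hk x hx).2, pull_boost, smul_smul, ← Complex.ofReal_mul, ← Real.exp_add]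
    simp

open Classical in
/-- Two pairs whose forms `s l ∧ m` agree modulo `U(1)` are equivalent. -/
theorem coframeScalar_equiv_of_form (hθ₀ : IsOrientedCoframe U g θ₀) (p p' : CoframeScalar U g θ₀)
    (h : EqModU1 U (fun x => (p'.s x : ℂ) • lWedgeM p'.θ x) (fun x => (p.s x : ℂ) • lWedgeM p.θ x)) :
    (coframeScalarSetoid U g θ₀).r p p' := by
  obtain ⟨c, hc, H⟩ := h
  -- The element of `J` with this `k` carries `s` to `s'`. What remains of the transition matrix
  -- must then lie in `H`.
  set k : Pt → ℝ := fun x => Real.log (p'.s x / p.s x) with hk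
  have hks : ContDiffOn ℝ ∞ k U :=
    (p'.smooth_s.div p.smooth_s fun x hx => (p.pos x hx).ne').log
      fun x hx => (div_pos (p'.pos x hx) (p.pos x hx)).ne'
  have hke : ∀ x ∈ U, Real.exp (k x) = p'.s x / p.s x := fun x hx =>
    Real.exp_log (div_pos (p'.pos x hx) (p.pos x hx))
  set Λ : Pt → Matrix (Fin 4) (Fin 4) ℝ := fun x => p'.θ x * (p.θ x)⁻¹ with hΛ
  have hΛl : ∀ x ∈ U, IsProperLorentz (Λ x) := fun x hx => p.transition p'.toCoframe hθ₀ hx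
  set K : Pt → Matrix (Fin 4) (Fin 4) ℝ := fun x => Λ x * boost (-k x) with hK
  have hKl : ∀ x ∈ U, IsProperLorentz (K x) := fun x hx =>
    (hΛl x hx).mul (boost_isProperLorentz _)
  have hboost : ∀ x, (boost (k x)).det ≠ 0 := fun x => by
    rw [(boost_isProperLorentz _).det_eq_one]; exact one_ne_zero
  have hKd : ∀ x ∈ U, (K x).det ≠ 0 := fun x hx => (hKl x hx).det_pos.ne'
  let hJ : Transf := fun x => (Matrix.GeneralLinearGroup.mkOfDetNeZero (boost (k x)) (hboost x),
    Units.mk0 (Real.exp (k x)) (Real.exp_pos _).ne')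
  -- Invertibility of `K` is known only on `U`, so the identity is used elsewhere.
  let hH : Transf := fun x => if hx : x ∈ U then
    (Matrix.GeneralLinearGroup.mkOfDetNeZero (K x) (hKd x hx), 1) else 1
  have hHx : ∀ x ∈ U, (hH x).1.val = K x ∧ (hH x).2 = 1 := fun x hx => by
    simp only [hH, dif_pos hx]
    exact ⟨rfl, trivial⟩
  have hKθ : ∀ x ∈ U, K x * boost (k x) * p.θ x = p'.θ x := by
    intro x hx
    simp only [hK, hΛ]
    rw [Matrix.mul_assoc _ (boost (-k x)) (boost (k x)), boost_mul_neg, Matrix.mul_one, Matrix.mul_assoc,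
      p.inv_mul hx, Matrix.mul_one]
  -- Once the boost has absorbed the ratio of the scalars, only the constant phase `c` is left.
  -- Being a statement about `K` alone, this gives membership in `H` for every coframe at once.
  have hKB : ∀ x ∈ U, pull (K x) (spinForm 1 0 0) = c • spinForm 1 0 0 := by
    intro x hx
    have h1 := H x hx
    simp only [lWedgeM_eq_pull] at h1
    change (p'.s x : ℂ) • pull (p'.θ x) (spinForm 1 0 0) =
      c • (p.s x : ℂ) • pull (p.θ x) (spinForm 1 0 0) at h1
    rw [← hKθ x hx, pull_mul, ← pull_smul, ← pull_smul (p.θ x) (p.s x : ℂ),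
      ← pull_smul (p.θ x) c] at h1
    have h3 := pull_injective (p.det_ne_zero hx) h1
    have h4 := p.pos x hx
    have h5 := p'.pos x hx
    have h6 : (Real.exp (-k x) : ℂ) * (p'.s x : ℂ) = p.s x := by
      rw [← Complex.ofReal_mul, Real.exp_neg, hke x hx]
      congr 1
      field_simp
    have h7 : pull (boost (k x)) ((p'.s x : ℂ) • pull (K x) (spinForm 1 0 0)) =
        pull (boost (k x)) ((p'.s x : ℂ) • c • spinForm 1 0 0) := by
      rw [pull_smul, ← pull_mul, h3, pull_smul, pull_smul, pull_boost, ← h6]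
      simp only [smul_smul]
      congr 1
      ring
    have h8 := pull_injective (hboost x) h7
    exact smul_right_injective _ (by exact_mod_cast h5.ne' : (p'.s x : ℂ) ≠ 0) h8
  refine ⟨hH * hJ, mul_mem (Subgroup.subset_closure (Or.inl ⟨?_, ?_, ?_⟩))
    (Subgroup.subset_closure (Or.inr ⟨k, hks, fun x hx => ⟨rfl, rfl⟩⟩)), ?_⟩
  · intro i j
    have hb : ∀ i j, ContDiffOn ℝ ∞ (fun x => boost (-k x) i j) U := by
      intro i j
      fin_cases i <;> fin_cases j <;> simp [boost] <;>
        first | exact contDiffOn_const | exact hks.cosh | exact hks.sinh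
    have hKs : ContDiffOn ℝ ∞ (fun x => K x i j) U :=
      contDiffOn_matrix_mul (contDiffOn_matrix_mul p'.isOriented.smooth
        (contDiffOn_matrix_inv p.isOriented.smooth fun x hx => p.det_ne_zero hx)) hb i j
    exact hKs.congr fun x hx => by rw [(hHx x hx).1]
  · intro x hx
    rw [(hHx x hx).1]
    exact ⟨hKl x hx, (hHx x hx).2⟩
  · intro θ
    have hc0 : c ≠ 0 := by rintro rfl; simp at hc
    refine ⟨c⁻¹, by simp [hc], fun x hx => ?_⟩
    rw [lWedgeM_eq_pull, lWedgeM_eq_pull, Transf.actFrame, pull_mul, (hHx x hx).1, hKB x hx,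
      pull_smul]
    exact (inv_smul_smul₀ hc0 _).symm
  · intro x hx
    simp only [Transf.actFrame, Transf.actScalar, Pi.mul_apply, Prod.fst_mul, Prod.snd_mul,
      Units.val_mul]
    rw [(hHx x hx).1, (hHx x hx).2]
    constructor
    · exact (hKθ x hx).symm
    · change _ = 1 * Real.exp (k x) * p.s x
      rw [hke x hx, one_mul, div_mul_cancel₀ _ (p.pos x hx).ne']

end Group


/-! ### The double covering `ξ ↦ ξ ⊗ ξ` and lifting through it -/

section SpinorLift

/-- Near `r²` the quotient `z / r²` is near `1`, where the principal logarithm is smooth. Half of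
it, exponentiated and multiplied by `r`, is the branch with value `r`. -/
theorem exists_local_sqrt {r : ℂ} (hr : r ≠ 0) :
    ∃ τ : ℂ → ℂ, ContDiffAt ℝ ∞ τ (r ^ 2) ∧ τ (r ^ 2) = r ∧ ∀ᶠ z in 𝓝 (r ^ 2), τ z ^ 2 = z := by
  have hr2 : r ^ 2 ≠ 0 := pow_ne_zero 2 hr
  refine ⟨fun z => r * Complex.exp (Complex.log (z / r ^ 2) / 2), ?_, ?_, ?_⟩
  · have h1 : ContDiffAt ℂ ∞ (fun z : ℂ => r * Complex.exp (Complex.log (z / r ^ 2) / 2)) (r ^ 2) := by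
      refine contDiffAt_const.mul (ContDiffAt.cexp (ContDiffAt.div_const ?_ 2))
      refine ContDiffAt.comp (g := Complex.log) (r ^ 2) ?_ (contDiffAt_id.div_const (r ^ 2))
      exact Complex.contDiffAt_log (by simp [div_self hr2])
    exact h1.restrict_scalars ℝ
  · simp [div_self hr2]
  · filter_upwards [isOpen_ne.mem_nhds hr2] with z hz
    have hz' : z / r ^ 2 ≠ 0 := div_ne_zero hz hr2
    rw [mul_pow, ← Complex.exp_nat_mul]
    have : ((2 : ℕ) : ℂ) * (Complex.log (z / r ^ 2) / 2) = Complex.log (z / r ^ 2) := by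
      push_cast; ring
    rw [this, Complex.exp_log hz']
    field_simp

/-- A continuous square root agrees near `x` with the smooth branch `τ ∘ X`, because their sum stays
away from zero and the product of sum and difference vanishes. The other component is then `Y / a`.
-/
theorem contDiffAt_of_sq_eq {a b X Y : Pt → ℂ} {x : Pt} (ha : ContinuousAt a x) (h0 : a x ≠ 0)
    (hX : ContDiffAt ℝ ∞ X x) (hY : ContDiffAt ℝ ∞ Y x)
    (haX : ∀ᶠ y in 𝓝 x, a y ^ 2 = X y) (habY : ∀ᶠ y in 𝓝 x, a y * b y = Y y) :
    ContDiffAt ℝ ∞ a x ∧ ContDiffAt ℝ ∞ b x := by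
  obtain ⟨τ, hτs, hτ0, hτ⟩ := exists_local_sqrt h0
  have hXx : a x ^ 2 = X x := haX.self_of_nhds
  rw [hXx] at hτs hτ0 hτ
  have h1 : ContDiffAt ℝ ∞ (fun y => τ (X y)) x := hτs.comp x hX
  have h2 : ∀ᶠ y in 𝓝 x, a y + τ (X y) ≠ 0 := by
    refine (ha.add h1.continuousAt).eventually_ne ?_
    change a x + τ (X x) ≠ 0
    rw [hτ0, ← two_mul]
    exact mul_ne_zero two_ne_zero h0
  have h3 : a =ᶠ[𝓝 x] fun y => τ (X y) := by
    filter_upwards [h2, haX, hX.continuousAt.eventually hτ] with y hy1 hy2 hy3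
    have : (a y + τ (X y)) * (a y - τ (X y)) = 0 := by linear_combination hy2 - hy3
    exact sub_eq_zero.1 ((mul_eq_zero.1 this).resolve_left hy1)
  have h4 : ContDiffAt ℝ ∞ a x := h1.congr_of_eventuallyEq h3
  refine ⟨h4, (hY.mul (h4.inv h0)).congr_of_eventuallyEq ?_⟩
  filter_upwards [habY, ha.eventually_ne h0] with y hy1 hy2
  change b y = Y y * (a y)⁻¹
  rw [← div_eq_mul_inv, eq_div_iff hy2, mul_comm, hy1]

/-- The nonzero spinors. -/
def NonzeroSpinor : Type := {v : Fin 2 → ℂ // v ≠ 0}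

noncomputable instance : TopologicalSpace NonzeroSpinor := instTopologicalSpaceSubtype

noncomputable instance : MulAction ℤˣ NonzeroSpinor where
  smul u v := ⟨((u : ℤ) : ℂ) • v.1, smul_ne_zero (by simp) v.2⟩
  one_smul v := Subtype.ext (by change ((1 : ℤ) : ℂ) • v.1 = v.1; simp)
  mul_smul u u' v := Subtype.ext (by
    change (((u * u' : ℤˣ) : ℤ) : ℂ) • v.1 = ((u : ℤ) : ℂ) • ((u' : ℤ) : ℂ) • v.1
    simp [mul_smul])

theorem NonzeroSpinor.coe_smul (u : ℤˣ) (v : NonzeroSpinor) : (u • v).1 = ((u : ℤ) : ℂ) • v.1 := rfl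

instance : ContinuousConstSMul ℤˣ NonzeroSpinor where
  continuous_const_smul u := by
    refine Continuous.subtype_mk ?_ _
    exact (continuous_const_smul ((u : ℤ) : ℂ)).comp continuous_subtype_val

/-- The nonzero symmetric spinors of rank one. -/
def SpinorCone : Type := {w : Fin 3 → ℂ // w 0 * w 2 = w 1 ^ 2 ∧ (w 0 ≠ 0 ∨ w 2 ≠ 0)}

noncomputable instance : TopologicalSpace SpinorCone := instTopologicalSpaceSubtype

/-- The map `ξ ↦ ξ ⊗ ξ`. -/
noncomputable def spinorSq (v : NonzeroSpinor) : SpinorCone :=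
  ⟨![v.1 0 ^ 2, v.1 0 * v.1 1, v.1 1 ^ 2], by simp; ring, by
    by_contra! h
    simp at h
    exact v.2 (by ext i; fin_cases i; exacts [h.1, h.2])⟩

theorem continuous_spinorSq : Continuous spinorSq := by
  have h : ∀ i, Continuous fun v : NonzeroSpinor => v.1 i := fun i =>
    (continuous_apply i).comp continuous_subtype_val
  refine Continuous.subtype_mk ?_ _
  refine continuous_pi fun i => ?_
  fin_cases i
  · exact (h 0).pow 2
  · exact (h 0).mul (h 1)
  · exact (h 1).pow 2

/-- The squares fix each component up to sign. If the two signs differ, the mixed product forces one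
component to vanish, so a common sign can always be chosen. -/
theorem spinorSq_eq_iff (v v' : NonzeroSpinor) :
    spinorSq v = spinorSq v' ↔ v ∈ MulAction.orbit ℤˣ v' := by
  constructor
  · intro h
    have h1 := congrArg Subtype.val h
    have e0 : v.1 0 ^ 2 = v'.1 0 ^ 2 := congrFun h1 0
    have e1 : v.1 0 * v.1 1 = v'.1 0 * v'.1 1 := congrFun h1 1
    have e2 : v.1 1 ^ 2 = v'.1 1 ^ 2 := congrFun h1 2
    have hor : v.1 = v'.1 ∨ v.1 = -v'.1 := by
      have hn : v'.1 0 ≠ 0 ∨ v'.1 1 ≠ 0 := by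
        by_contra! hh
        exact v'.2 (by ext i; fin_cases i; exacts [hh.1, hh.2])
      rcases sq_eq_sq_iff_eq_or_eq_neg.1 e0 with a0 | a0 <;>
        rcases sq_eq_sq_iff_eq_or_eq_neg.1 e2 with a1 | a1
      · left; ext i; fin_cases i; exacts [a0, a1]
      · rw [a0, a1] at e1
        have : v'.1 0 * v'.1 1 = 0 := by linear_combination (-1 / 2 : ℂ) * e1
        rcases mul_eq_zero.1 this with b | b
        · right; ext i; fin_cases i
          · simp [a0, b]
          · simp [a1]
        · left; ext i; fin_cases i
          · simp [a0]
          · simp [a1, b]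
      · rw [a0, a1] at e1
        have : v'.1 0 * v'.1 1 = 0 := by linear_combination (-1 / 2 : ℂ) * e1
        rcases mul_eq_zero.1 this with b | b
        · left; ext i; fin_cases i
          · simp [a0, b]
          · simp [a1]
        · right; ext i; fin_cases i
          · simp [a0]
          · simp [a1, b]
      · right; ext i; fin_cases i; exacts [a0, a1]
    rcases hor with h | h
    · exact ⟨1, Subtype.ext (by change ((1 : ℤ) : ℂ) • v'.1 = v.1; simp [h])⟩
    · exact ⟨-1, Subtype.ext (by change ((-1 : ℤ) : ℂ) • v'.1 = v.1; simp [h])⟩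
  · rintro ⟨u, rfl⟩
    apply Subtype.ext
    have hu : ((u : ℤ) : ℂ) ^ 2 = 1 := by
      rcases Int.units_eq_one_or u with rfl | rfl <;> simp
    ext i
    fin_cases i <;> simp [spinorSq, NonzeroSpinor.coe_smul, mul_pow, hu]
    linear_combination (v'.1 0 * v'.1 1) * hu

theorem spinorSq_surjective : Function.Surjective spinorSq := by
  rintro ⟨w, h1, h2⟩
  rcases h2 with h | h
  · obtain ⟨r, hr⟩ := IsAlgClosed.exists_pow_nat_eq (w 0) (n := 2) two_pos
    have hr0 : r ≠ 0 := by rintro rfl; apply h; rw [← hr]; ring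
    refine ⟨⟨![r, w 1 / r], fun h0 => hr0 (congrFun h0 0)⟩, Subtype.ext ?_⟩
    ext i
    fin_cases i
    · simp [spinorSq, hr]
    · simp [spinorSq]; field_simp
    · simp [spinorSq]; field_simp; rw [hr, ← h1]
  · obtain ⟨r, hr⟩ := IsAlgClosed.exists_pow_nat_eq (w 2) (n := 2) two_pos
    have hr0 : r ≠ 0 := by rintro rfl; apply h; rw [← hr]; ring
    refine ⟨⟨![w 1 / r, r], fun h0 => hr0 (congrFun h0 1)⟩, Subtype.ext ?_⟩
    ext i
    fin_cases i
    · simp [spinorSq]; field_simp; rw [hr, ← h1]; ring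
    · simp [spinorSq]; field_simp
    · simp [spinorSq, hr]

/-- Take a root of whichever extreme component is nonzero and divide the mixed component by it.
These local sections show that the cone carries the quotient topology. -/
theorem spinorSq_local_section (v : NonzeroSpinor) :
    ∃ S : SpinorCone → Fin 2 → ℂ, ContinuousAt S (spinorSq v) ∧ S (spinorSq v) = v.1 ∧
      ∀ᶠ w in 𝓝 (spinorSq v), S w 0 ^ 2 = w.1 0 ∧ S w 0 * S w 1 = w.1 1 ∧ S w 1 ^ 2 = w.1 2 := by
  have hn : v.1 0 ≠ 0 ∨ v.1 1 ≠ 0 := by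
    by_contra! hh
    exact v.2 (by ext i; fin_cases i; exacts [hh.1, hh.2])
  have hc : ∀ i, ContinuousAt (fun w : SpinorCone => w.1 i) (spinorSq v) := fun i =>
    ((continuous_apply i).comp continuous_subtype_val).continuousAt
  rcases hn with h | h
  · obtain ⟨τ, hτs, hτ0, hτ⟩ := exists_local_sqrt h
    have h1 : ContinuousAt (fun w : SpinorCone => τ (w.1 0)) (spinorSq v) :=
      ContinuousAt.comp (g := τ) hτs.continuousAt (hc 0)
    have h2 : τ ((spinorSq v).1 0) ≠ 0 := by
      change τ (v.1 0 ^ 2) ≠ 0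
      rwa [hτ0]
    refine ⟨fun w => ![τ (w.1 0), w.1 1 / τ (w.1 0)], ?_, ?_, ?_⟩
    · refine continuousAt_pi.2 fun i => ?_
      fin_cases i
      · exact h1
      · exact (hc 1).div h1 h2
    · ext i
      fin_cases i
      · exact hτ0
      · change v.1 0 * v.1 1 / τ (v.1 0 ^ 2) = v.1 1
        rw [hτ0]; field_simp
    · filter_upwards [(hc 0).eventually hτ, h1.eventually_ne h2] with w hw1 hw2
      have hw := w.2.1
      refine ⟨hw1, ?_, ?_⟩
      · change τ (w.1 0) * (w.1 1 / τ (w.1 0)) = w.1 1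
        field_simp
      · change (w.1 1 / τ (w.1 0)) ^ 2 = w.1 2
        rw [div_pow, ← hw, hw1]
        have : w.1 0 ≠ 0 := by rw [← hw1]; exact pow_ne_zero 2 hw2
        field_simp
  · obtain ⟨τ, hτs, hτ0, hτ⟩ := exists_local_sqrt h
    have h1 : ContinuousAt (fun w : SpinorCone => τ (w.1 2)) (spinorSq v) :=
      ContinuousAt.comp (g := τ) hτs.continuousAt (hc 2)
    have h2 : τ ((spinorSq v).1 2) ≠ 0 := by
      change τ (v.1 1 ^ 2) ≠ 0
      rwa [hτ0]
    refine ⟨fun w => ![w.1 1 / τ (w.1 2), τ (w.1 2)], ?_, ?_, ?_⟩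
    · refine continuousAt_pi.2 fun i => ?_
      fin_cases i
      · exact (hc 1).div h1 h2
      · exact h1
    · ext i
      fin_cases i
      · change v.1 0 * v.1 1 / τ (v.1 1 ^ 2) = v.1 0
        rw [hτ0]; field_simp
      · exact hτ0
    · filter_upwards [(hc 2).eventually hτ, h1.eventually_ne h2] with w hw1 hw2
      have hw := w.2.1
      refine ⟨?_, ?_, hw1⟩
      · change (w.1 1 / τ (w.1 2)) ^ 2 = w.1 0
        rw [div_pow, ← hw, hw1]
        have : w.1 2 ≠ 0 := by rw [← hw1]; exact pow_ne_zero 2 hw2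
        field_simp
      · change w.1 1 / τ (w.1 2) * τ (w.1 2) = w.1 1
        field_simp

theorem isQuotientMap_spinorSq : IsQuotientMap spinorSq := by
  refine ⟨isCoinducing_iff.2 fun s => ⟨fun h => ?_, fun h => h.preimage continuous_spinorSq⟩,
    spinorSq_surjective⟩
  rw [isOpen_iff_mem_nhds]
  intro w hw
  obtain ⟨v, rfl⟩ := spinorSq_surjective w
  obtain ⟨O, hO, hOs⟩ := isOpen_induced_iff.1 h
  obtain ⟨S, hS, hSv, hSe⟩ := spinorSq_local_section v
  have hvO : v.1 ∈ O := (Set.ext_iff.1 hOs v).2 hw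
  have h1 : ∀ᶠ w in 𝓝 (spinorSq v), S w ∈ O :=
    hS.eventually (by rw [hSv]; exact hO.mem_nhds hvO)
  have h2 : ∀ᶠ w in 𝓝 (spinorSq v), S w ≠ 0 := hS.eventually_ne (by rw [hSv]; exact v.2)
  filter_upwards [h1, h2, hSe] with w hw1 hw2 hw3
  have h4 : (⟨S w, hw2⟩ : NonzeroSpinor) ∈ spinorSq ⁻¹' s :=
    (Set.ext_iff.1 hOs ⟨S w, hw2⟩).1 hw1
  have h5 : spinorSq ⟨S w, hw2⟩ = w := by
    apply Subtype.ext
    ext i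
    fin_cases i
    exacts [hw3.1, hw3.2.1, hw3.2.2]
  rw [← h5]
  exact h4

theorem isQuotientCoveringMap_spinorSq : IsQuotientCoveringMap spinorSq ℤˣ where
  __ := isQuotientMap_spinorSq
  continuous_const_smul := continuous_const_smul
  apply_eq_iff_mem_orbit {v v'} := spinorSq_eq_iff v v'
  disjoint v := by
    have hv : 0 < ‖v.1‖ := norm_pos_iff.2 v.2
    -- The points `v` and `-v` are `2‖v‖` apart, so a ball of radius `‖v‖` cannot contain both `w`
    -- and `-w`.
    refine ⟨Subtype.val ⁻¹' Metric.ball v.1 ‖v.1‖,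
      (Metric.isOpen_ball.preimage continuous_subtype_val).mem_nhds (Metric.mem_ball_self hv), ?_⟩
    rintro u ⟨_, ⟨w, hw, rfl⟩, hw'⟩
    rcases Int.units_eq_one_or u with rfl | rfl
    · rfl
    · exfalso
      have h1 : ‖w.1 - v.1‖ < ‖v.1‖ := mem_ball_iff_norm.1 hw
      have h2 : ‖((-1 : ℤˣ) • w).1 - v.1‖ < ‖v.1‖ := mem_ball_iff_norm.1 hw'
      have h3 : ((-1 : ℤˣ) • w).1 = -w.1 := by
        rw [NonzeroSpinor.coe_smul]; simp
      rw [h3] at h2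
      have h4 : ‖(w.1 - v.1) + (-w.1 - v.1)‖ = 2 * ‖v.1‖ := by
        rw [show (w.1 - v.1) + (-w.1 - v.1) = (-2 : ℝ) • v.1 by
          rw [neg_smul, two_smul]; abel, norm_smul]
        simp
      have := norm_add_le (w.1 - v.1) (-w.1 - v.1)
      linarith

/-- A smooth field of nonzero rank one symmetric spinors on a simply connected domain is the
square of a smooth spinor field. -/
theorem exists_spinor_sqrt {U : Set Pt} (hU : IsOpen U) (hUsc : SimplyConnectedSpace U)
    {X Y Z : Pt → ℂ} (hX : ContDiffOn ℝ ∞ X U) (hY : ContDiffOn ℝ ∞ Y U)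
    (hZ : ContDiffOn ℝ ∞ Z U) (hXZ : ∀ x ∈ U, X x * Z x = Y x ^ 2)
    (h0 : ∀ x ∈ U, X x ≠ 0 ∨ Z x ≠ 0) :
    ∃ ξ : NonvanishingSpinor U, ∀ x ∈ U,
      ξ.ξ x 0 ^ 2 = X x ∧ ξ.ξ x 0 * ξ.ξ x 1 = Y x ∧ ξ.ξ x 1 ^ 2 = Z x := by
  classical
  have : LocallyPathConnectedSpace U := hU.locallyPathConnectedSpace
  let f : C(U, SpinorCone) :=
    ⟨fun x => ⟨![X x, Y x, Z x], hXZ x x.2, h0 x x.2⟩, by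
      refine Continuous.subtype_mk (continuous_pi fun i => ?_) _
      fin_cases i
      exacts [hX.continuousOn.domRestrict, hY.continuousOn.domRestrict, hZ.continuousOn.domRestrict]⟩
  obtain ⟨x₀⟩ : Nonempty U := inferInstance
  obtain ⟨v₀, hv₀⟩ := spinorSq_surjective (f x₀)
  -- `U` is simply connected and, being open, locally path connected, so the map into the cone lifts
  -- through the covering.
  obtain ⟨F, ⟨-, hF⟩, -⟩ :=
    isQuotientCoveringMap_spinorSq.isCoveringMap.existsUnique_continuousMap_lifts f x₀ v₀ hv₀
  let ξ : Pt → Fin 2 → ℂ := fun x => if hx : x ∈ U then (F ⟨x, hx⟩).1 else 0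
  have hξ : ∀ x (hx : x ∈ U), ξ x = (F ⟨x, hx⟩).1 := fun x hx => dif_pos hx
  have hsq : ∀ x ∈ U, ξ x 0 ^ 2 = X x ∧ ξ x 0 * ξ x 1 = Y x ∧ ξ x 1 ^ 2 = Z x := by
    intro x hx
    have h1 := congrArg Subtype.val (congrFun hF ⟨x, hx⟩)
    rw [hξ x hx]
    exact ⟨congrFun h1 0, congrFun h1 1, congrFun h1 2⟩
  have hcont : ContinuousOn ξ U := by
    rw [continuousOn_iff_continuous_domRestrict]
    have : U.domRestrict ξ = fun x => (F x).1 := by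
      ext1 x
      exact hξ x x.2
    rw [this]
    exact continuous_subtype_val.comp F.continuous
  have hne : ∀ x ∈ U, ξ x ≠ 0 := fun x hx => by rw [hξ x hx]; exact (F ⟨x, hx⟩).2
  refine ⟨⟨ξ, fun x hx => ?_, hne⟩, hsq⟩
  have hxU := hU.mem_nhds hx
  refine (contDiffAt_pi.2 fun i => ?_).contDiffWithinAt
  have hc : ∀ i, ContinuousAt (fun y => ξ y i) x := fun i =>
    (continuous_apply i).continuousAt.comp (hcont.continuousAt hxU)
  have hn : ξ x 0 ≠ 0 ∨ ξ x 1 ≠ 0 := by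
    by_contra! hh
    exact hne x hx (by ext i; fin_cases i; exacts [hh.1, hh.2])
  have e0 : ∀ᶠ y in 𝓝 x, ξ y 0 ^ 2 = X y := by filter_upwards [hxU] with y hy using (hsq y hy).1
  have e1 : ∀ᶠ y in 𝓝 x, ξ y 0 * ξ y 1 = Y y := by
    filter_upwards [hxU] with y hy using (hsq y hy).2.1
  have e1' : ∀ᶠ y in 𝓝 x, ξ y 1 * ξ y 0 = Y y := by
    filter_upwards [e1] with y hy using by rw [mul_comm, hy]
  have e2 : ∀ᶠ y in 𝓝 x, ξ y 1 ^ 2 = Z y := by filter_upwards [hxU] with y hy using (hsq y hy).2.2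
  -- The lift is only known to be continuous. Smoothness is recovered at `x` from a component that
  -- does not vanish there.
  rcases hn with h | h
  · have := contDiffAt_of_sq_eq (hc 0) h (hX.contDiffAt hxU) (hY.contDiffAt hxU) e0 e1
    fin_cases i
    exacts [this.1, this.2]
  · have := contDiffAt_of_sq_eq (hc 1) h (hZ.contDiffAt hxU) (hY.contDiffAt hxU) e2 e1'
    fin_cases i
    exacts [this.2, this.1]

/-- Spinor fields with the same square up to a phase agree up to a phase. -/
theorem eqModU1_of_sq_eq {U : Set Pt} (hUc : IsPreconnected U) {ξ ξ' : Pt → Fin 2 → ℂ}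
    (hξ : ContinuousOn ξ U) (hξ' : ContinuousOn ξ' U) (hne : ∀ x ∈ U, ξ x ≠ 0) {c : ℂ}
    (hc : ‖c‖ = 1)
    (h : ∀ x ∈ U, ξ' x 0 ^ 2 = c * ξ x 0 ^ 2 ∧ ξ' x 0 * ξ' x 1 = c * (ξ x 0 * ξ x 1) ∧
      ξ' x 1 ^ 2 = c * ξ x 1 ^ 2) : EqModU1 U ξ' ξ := by
  obtain ⟨d, hd⟩ := IsAlgClosed.exists_pow_nat_eq c (n := 2) two_pos
  have hdn : ‖d‖ = 1 := by
    have : ‖d‖ ^ 2 = 1 := by rw [← norm_pow, hd, hc]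
    nlinarith [norm_nonneg d]
  have hd0 : d ≠ 0 := by rintro rfl; simp at hdn
  let N : Pt → ℂ := fun x => ξ x 0 * starRingEnd ℂ (ξ x 0) + ξ x 1 * starRingEnd ℂ (ξ x 1)
  -- Hermitian projection of `ξ'` onto `ξ`, normalized by a fixed root `d` of `c`: the only
  -- candidate for the ratio, and visibly continuous.
  let q : Pt → ℂ := fun x => (ξ' x 0 * starRingEnd ℂ (ξ x 0) + ξ' x 1 * starRingEnd ℂ (ξ x 1)) /
    (d * N x)
  have hN : ∀ x ∈ U, N x ≠ 0 := by
    intro x hx h0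
    apply hne x hx
    simp only [N, Complex.mul_conj, ← Complex.ofReal_add, Complex.ofReal_eq_zero] at h0
    have h1 := Complex.normSq_nonneg (ξ x 0)
    have h2 := Complex.normSq_nonneg (ξ x 1)
    have h3 : ξ x 0 = 0 := Complex.normSq_eq_zero.1 (by linarith)
    have h4 : ξ x 1 = 0 := Complex.normSq_eq_zero.1 (by linarith)
    ext i
    fin_cases i
    exacts [h3, h4]
  have hc' : ∀ (f : Pt → Fin 2 → ℂ), ContinuousOn f U → ∀ i, ContinuousOn (fun x => f x i) U :=
    fun f hf i => (continuous_apply i).comp_continuousOn hf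
  have hcj : ∀ i, ContinuousOn (fun x => starRingEnd ℂ (ξ x i)) U := fun i =>
    Complex.continuous_conj.comp_continuousOn (hc' ξ hξ i)
  have hq : ContinuousOn q U := by
    refine ContinuousOn.div (((hc' ξ' hξ' 0).mul (hcj 0)).add ((hc' ξ' hξ' 1).mul (hcj 1)))
      (continuousOn_const.mul (((hc' ξ hξ 0).mul (hcj 0)).add ((hc' ξ hξ 1).mul (hcj 1)))) ?_
    intro x hx
    exact mul_ne_zero hd0 (hN x hx)
  have hqξ : ∀ x ∈ U, ξ' x = (q x * d) • ξ x := by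
    intro x hx
    obtain ⟨e0, e1, e2⟩ := h x hx
    have hN' := hN x hx
    -- Equal squares up to a factor make the determinant of the two spinors square to zero, so they
    -- are proportional.
    have key : ∀ z w z' w' : ℂ, z' ^ 2 = c * z ^ 2 → z' * w' = c * (z * w) → w' ^ 2 = c * w ^ 2 →
        z' * w = w' * z := by
      intro z w z' w' h1 h2 h3
      have h4 : (z' * w - w' * z) ^ 2 = 0 := by
        linear_combination w ^ 2 * h1 - 2 * z * w * h2 + z ^ 2 * h3
      exact sub_eq_zero.1 (pow_eq_zero_iff two_ne_zero |>.1 h4)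
    have h5 := key _ _ _ _ e0 e1 e2
    ext i
    simp only [Pi.smul_apply, smul_eq_mul, q]
    rw [div_mul_eq_mul_div, div_mul_eq_mul_div, eq_div_iff (mul_ne_zero hd0 hN')]
    fin_cases i
    · simp only [N, Fin.zero_eta]
      linear_combination d * starRingEnd ℂ (ξ x 1) * h5
    · simp only [N, Fin.mk_one]
      linear_combination -d * starRingEnd ℂ (ξ x 0) * h5
  have hq2 : Set.EqOn (q ^ 2) 1 U := by
    intro x hx
    obtain ⟨e0, e1, e2⟩ := h x hx
    rw [hqξ x hx, ← hd] at e0 e2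
    simp only [Pi.smul_apply, smul_eq_mul] at e0 e2
    have : (q x ^ 2 - 1) * ξ x 0 ^ 2 = 0 := by
      have : d ^ 2 * ((q x ^ 2 - 1) * ξ x 0 ^ 2) = 0 := by linear_combination e0
      exact (mul_eq_zero.1 this).resolve_left (pow_ne_zero 2 hd0)
    have h2 : (q x ^ 2 - 1) * ξ x 1 ^ 2 = 0 := by
      have : d ^ 2 * ((q x ^ 2 - 1) * ξ x 1 ^ 2) = 0 := by linear_combination e2
      exact (mul_eq_zero.1 this).resolve_left (pow_ne_zero 2 hd0)
    by_contra hne'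
    have h3 : q x ^ 2 - 1 ≠ 0 := fun h => hne' (sub_eq_zero.1 h)
    apply hne x hx
    ext i
    fin_cases i
    · exact pow_eq_zero_iff two_ne_zero |>.1 ((mul_eq_zero.1 this).resolve_left h3)
    · exact pow_eq_zero_iff two_ne_zero |>.1 ((mul_eq_zero.1 h2).resolve_left h3)
  -- A continuous function with square `1` on a preconnected set is constantly `1` or constantly
  -- `-1`.
  rcases hUc.eq_one_or_eq_neg_one_of_sq_eq hq hq2 with h1 | h1
  · exact ⟨d, hdn, fun x hx => by rw [hqξ x hx, h1 hx]; simp⟩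
  · exact ⟨-d, by simpa using hdn, fun x hx => by rw [hqξ x hx, h1 hx]; simp⟩

end SpinorLift


/-! ### Self-dual null forms of Lorentz frames -/

section SelfDual

theorem pull_spinForm_one_apply (Λ : Matrix (Fin 4) (Fin 4) ℝ) (i j : Fin 4) :
    pull Λ (spinForm 1 0 0) i j =
      ((Λ 0 i : ℂ) + Λ 3 i) * ((Λ 1 j : ℂ) + Complex.I * Λ 2 j) -
        ((Λ 0 j : ℂ) + Λ 3 j) * ((Λ 1 i : ℂ) + Complex.I * Λ 2 i) := by
  have := congrFun (congrFun (lWedgeM_eq_pull (fun _ => Λ) 0) i) j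
  rw [← this]
  simp [lWedgeM, wedge11, covL, covM]

/-- The form `l ∧ m` of a proper Lorentz frame is self-dual and null. -/
theorem IsProperLorentz.pull_spinForm_one {Λ : Matrix (Fin 4) (Fin 4) ℝ} (h : IsProperLorentz Λ) :
    ∃ X Y Z : ℂ, X = (pull Λ (spinForm 1 0 0) 0 1 - Complex.I * pull Λ (spinForm 1 0 0) 0 2) / 2 ∧
      Y = -pull Λ (spinForm 1 0 0) 0 3 / 2 ∧
      Z = (-pull Λ (spinForm 1 0 0) 0 1 - Complex.I * pull Λ (spinForm 1 0 0) 0 2) / 2 ∧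
      pull Λ (spinForm 1 0 0) = spinForm X Y Z ∧ X * Z = Y ^ 2 := by
  refine ⟨_, _, _, rfl, rfl, rfl, ?_⟩
  have hgL : (fun _ : Pt => minkowski) 0 = Λᵀ * minkowski * Λ := h.eq.symm
  -- A proper Lorentz matrix preserves the metric and has determinant `1`, so it commutes with the
  -- star.
  have hd : ∀ i j, hodge2 (fun _ => minkowski) 0 (pull Λ (spinForm 1 0 0)) i j =
      -Complex.I * pull Λ (spinForm 1 0 0) i j := by
    intro i j
    have h1 := hodge2_pull h.det_pos.ne' hgL (spinForm 1 0 0) i j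
    rw [h.det_eq_one, hodge2_spinForm_one, pull_smul] at h1
    simp only [abs_one, Complex.ofReal_one, one_mul, Matrix.smul_apply, smul_eq_mul] at h1
    exact h1
  -- The Pfaffian of a decomposable 2-form vanishes.
  have hpf : pull Λ (spinForm 1 0 0) 0 1 * pull Λ (spinForm 1 0 0) 2 3 -
      pull Λ (spinForm 1 0 0) 0 2 * pull Λ (spinForm 1 0 0) 1 3 +
      pull Λ (spinForm 1 0 0) 0 3 * pull Λ (spinForm 1 0 0) 1 2 = 0 := by
    simp only [pull_spinForm_one_apply]; ring
  have hanti : ∀ i j, pull Λ (spinForm 1 0 0) i j = -pull Λ (spinForm 1 0 0) j i := by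
    intro i j
    simp only [pull_spinForm_one_apply]; ring
  generalize pull Λ (spinForm 1 0 0) = G at hd hpf hanti ⊢
  have hdiag : ∀ i, G i i = 0 := fun i => by linear_combination (1 / 2 : ℂ) * hanti i i
  have h01 := hd 0 1
  have h02 := hd 0 2
  have h03 := hd 0 3
  rw [hodge2_minkowski] at h01 h02 h03
  simp [Fin.sum_univ_four, minkowski_apply, rowDet_eq] at h01 h02 h03
  -- Self-duality determines the spatial components from the row `G 0 i`, which leaves the three
  -- spinor components. The Pfaffian relation then reads `XZ = Y²`.
  have e23 : G 2 3 = -Complex.I * G 0 1 := by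
    linear_combination h01 + (1 / 2 : ℂ) * hanti 2 3
  have e13 : G 1 3 = Complex.I * G 0 2 := by
    linear_combination -h02 + (1 / 2 : ℂ) * hanti 1 3
  have e12 : G 1 2 = -Complex.I * G 0 3 := by
    linear_combination h03 + (1 / 2 : ℂ) * hanti 1 2
  have hI := Complex.I_mul_I
  constructor
  · ext i j
    fin_cases i <;> fin_cases j <;> simp [spinForm, hdiag]
    · ring
    · linear_combination G 0 2 * hI
    · ring
    · rw [hanti 1 0]; ring
    · rw [e12]; ring
    · rw [e13]; ring
    · rw [hanti 2 0]; linear_combination -G 0 2 * hI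
    · rw [hanti 2 1, e12]; ring
    · rw [e23]; ring
    · rw [hanti 3 0]; ring
    · rw [hanti 3 1, e13]; ring
    · rw [hanti 3 2, e23]; ring
  · rw [e23, e13, e12] at hpf
    linear_combination (-Complex.I / 4) * hpf +
      (G 0 2 ^ 2 / 4 - (G 0 1 ^ 2 + G 0 2 ^ 2 + G 0 3 ^ 2) / 4) * hI

end SelfDual

/-! ### The correspondence between pairs and spinors -/

section Correspondence

variable {U : Set Pt} {g θ₀ : Pt → Matrix (Fin 4) (Fin 4) ℝ}
  {σ : Pt → Fin 4 → Matrix (Fin 2) (Fin 2) ℂ}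

theorem spinForm_one_ne_zero : spinForm 1 0 0 ≠ 0 := by
  rw [← spinForm_zero]
  intro h
  exact one_ne_zero (spinForm_injective h).1

/-- Every coframe with a positive scalar comes from a spinor field. -/
theorem IsPauli.exists_spinor (hσ : IsPauli U g θ₀ σ) (hg : IsLorentzianMetric U g)
    (hθ₀ : IsOrientedCoframe U g θ₀) (hU : IsOpen U) (hUsc : SimplyConnectedSpace U)
    (p : CoframeScalar U g θ₀) : ∃ ξ : NonvanishingSpinor U, ∀ x ∈ U,
      (p.s x : ℂ) • lWedgeM p.θ x = sigmaXiXi σ ξ.ξ x := by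
  set e := hσ.coframe hg hθ₀ with he
  set Λ : Pt → Matrix (Fin 4) (Fin 4) ℝ := fun x => p.θ x * (e.θ x)⁻¹ with hΛ
  have hΛl : ∀ x ∈ U, IsProperLorentz (Λ x) := fun x hx => e.transition p.toCoframe hθ₀ hx
  have hΛs : ∀ i j, ContDiffOn ℝ ∞ (fun x => (Λ x i j : ℂ)) U := fun i j =>
    Complex.ofRealCLM.contDiff.comp_contDiffOn (contDiffOn_matrix_mul p.isOriented.smooth
      (contDiffOn_matrix_inv e.isOriented.smooth fun x hx => e.det_ne_zero hx) i j)
  have hGs : ∀ i j, ContDiffOn ℝ ∞ (fun x => pull (Λ x) (spinForm 1 0 0) i j) U := by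
    intro i j
    simp only [pull_spinForm_one_apply]
    exact (((hΛs 0 i).add (hΛs 3 i)).mul ((hΛs 1 j).add (contDiffOn_const.mul (hΛs 2 j)))).sub
      (((hΛs 0 j).add (hΛs 3 j)).mul ((hΛs 1 i).add (contDiffOn_const.mul (hΛs 2 i))))
  have hss : ContDiffOn ℝ ∞ (fun x => (p.s x : ℂ)) U :=
    Complex.ofRealCLM.contDiff.comp_contDiffOn p.smooth_s
  -- `X`, `Y`, `Z` are the spinor components of `s l ∧ m` in the coframe of the Pauli matrices.
  let X : Pt → ℂ := fun x => p.s x * ((pull (Λ x) (spinForm 1 0 0) 0 1 -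
    Complex.I * pull (Λ x) (spinForm 1 0 0) 0 2) / 2)
  let Y : Pt → ℂ := fun x => p.s x * (-pull (Λ x) (spinForm 1 0 0) 0 3 / 2)
  let Z : Pt → ℂ := fun x => p.s x * ((-pull (Λ x) (spinForm 1 0 0) 0 1 -
    Complex.I * pull (Λ x) (spinForm 1 0 0) 0 2) / 2)
  have hXYZ : ∀ x ∈ U, (p.s x : ℂ) • pull (Λ x) (spinForm 1 0 0) = spinForm (X x) (Y x) (Z x) ∧
      X x * Z x = Y x ^ 2 := by
    intro x hx
    obtain ⟨X', Y', Z', hX, hY, hZ, h1, h2⟩ := (hΛl x hx).pull_spinForm_one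
    have eX : X x = p.s x * X' := by rw [hX]
    have eY : Y x = p.s x * Y' := by rw [hY]
    have eZ : Z x = p.s x * Z' := by rw [hZ]
    rw [eX, eY, eZ]
    exact ⟨by rw [h1, spinForm_smul], by linear_combination (p.s x : ℂ) ^ 2 * h2⟩
  -- If both extreme components vanish, `XZ = Y²` kills the third, and then `l ∧ m = 0`, which is
  -- impossible in an invertible frame.
  have hne : ∀ x ∈ U, X x ≠ 0 ∨ Z x ≠ 0 := by
    intro x hx
    by_contra! h0
    obtain ⟨h1, h2⟩ := hXYZ x hx
    rw [h0.1, zero_mul] at h2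
    have h3 : Y x = 0 := pow_eq_zero_iff two_ne_zero |>.1 h2.symm
    rw [h0.1, h0.2, h3, spinForm_zero] at h1
    have h4 : (p.s x : ℂ) ≠ 0 := by exact_mod_cast (p.pos x hx).ne'
    have h5 := (smul_eq_zero.1 h1).resolve_left h4
    rw [← pull_zero (Λ x)] at h5
    exact spinForm_one_ne_zero (pull_injective (hΛl x hx).det_pos.ne' h5)
  obtain ⟨ξ, hξ⟩ := exists_spinor_sqrt hU hUsc
    (hss.mul (((hGs 0 1).sub (contDiffOn_const.mul (hGs 0 2))).div_const 2))
    (hss.mul ((hGs 0 3).neg.div_const 2))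
    (hss.mul (((hGs 0 1).neg.sub (contDiffOn_const.mul (hGs 0 2))).div_const 2))
    (fun x hx => (hXYZ x hx).2) hne
  refine ⟨ξ, fun x hx => ?_⟩
  obtain ⟨h1, h2, h3⟩ := hξ x hx
  rw [hσ.sigmaXiXi_eq_pull hx, h1, h2, h3, lWedgeM_eq_pull]
  change _ = pull (pauliFrame σ x) (spinForm (X x) (Y x) (Z x))
  rw [← (hXYZ x hx).1, pull_smul, ← pull_mul]
  congr 2
  change _ = p.θ x * (e.θ x)⁻¹ * e.θ x
  rw [Matrix.mul_assoc, e.inv_mul hx, Matrix.mul_one]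

/-- Every nonvanishing spinor field comes from a coframe, with scalar `1`. -/
theorem IsPauli.exists_coframeScalar (hσ : IsPauli U g θ₀ σ) (hg : IsLorentzianMetric U g)
    (hθ₀ : IsOrientedCoframe U g θ₀) (ξ : NonvanishingSpinor U) :
    ∃ p : CoframeScalar U g θ₀, ∀ x ∈ U, (p.s x : ℂ) • lWedgeM p.θ x = sigmaXiXi σ ξ.ξ x := by
  let N : Pt → ℂ := fun x =>
    ξ.ξ x 0 * starRingEnd ℂ (ξ.ξ x 0) + ξ.ξ x 1 * starRingEnd ℂ (ξ.ξ x 1)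
  have hN : ∀ x ∈ U, N x ≠ 0 := by
    intro x hx h0
    apply ξ.nonvanishing x hx
    simp only [N, Complex.mul_conj, ← Complex.ofReal_add, Complex.ofReal_eq_zero] at h0
    have h1 := Complex.normSq_nonneg (ξ.ξ x 0)
    have h2 := Complex.normSq_nonneg (ξ.ξ x 1)
    have h3 : ξ.ξ x 0 = 0 := Complex.normSq_eq_zero.1 (by linarith)
    have h4 : ξ.ξ x 1 = 0 := Complex.normSq_eq_zero.1 (by linarith)
    ext i
    fin_cases i
    exacts [h3, h4]
  -- The Hermitian orthogonal complement of `ξ` divided by `|ξ|²`: a smooth global choice with `ξ₀η₁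
  -- - ξ₁η₀ = 1`.
  let η : Pt → Fin 2 → ℂ := fun x =>
    ![-starRingEnd ℂ (ξ.ξ x 1) / N x, starRingEnd ℂ (ξ.ξ x 0) / N x]
  have hc : ∀ i, ContDiffOn ℝ ∞ (fun x => ξ.ξ x i) U := fun i => contDiffOn_pi.1 ξ.smooth i
  have hcc : ∀ i, ContDiffOn ℝ ∞ (fun x => starRingEnd ℂ (ξ.ξ x i)) U := fun i =>
    Complex.conjCLE.contDiff.comp_contDiffOn (hc i)
  have hNs : ContDiffOn ℝ ∞ N U := ((hc 0).mul (hcc 0)).add ((hc 1).mul (hcc 1))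
  have hη : ContDiffOn ℝ ∞ η U := by
    refine contDiffOn_pi.2 fun i => ?_
    fin_cases i
    · exact ((hcc 1).neg.mul (hNs.inv hN)).congr fun x _ => div_eq_mul_inv _ _
    · exact ((hcc 0).mul (hNs.inv hN)).congr fun x _ => div_eq_mul_inv _ _
  have hdet : ∀ x ∈ U, ξ.ξ x 0 * η x 1 - ξ.ξ x 1 * η x 0 = 1 := by
    intro x hx
    have := hN x hx
    simp only [η]
    simp
    field_simp
    simp only [N]
    ring
  refine ⟨⟨hσ.spinCoframe hg hθ₀ ξ.smooth hη hdet, fun _ => 1, contDiffOn_const,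
    fun _ _ => one_pos⟩, fun x hx => ?_⟩
  rw [Complex.ofReal_one, one_smul]
  exact hσ.lWedgeM_spinFrame hx (hdet x hx)

theorem EqModU1.symm {V : Type*} [AddCommGroup V] [Module ℂ V] {A B : Pt → V}
    (h : EqModU1 U A B) : EqModU1 U B A := by
  obtain ⟨c, hc, H⟩ := h
  have hc0 : c ≠ 0 := by rintro rfl; simp at hc
  exact ⟨c⁻¹, by simp [hc], fun x hx => by rw [H x hx, inv_smul_smul₀ hc0]⟩

theorem EqModU1.trans {V : Type*} [AddCommGroup V] [Module ℂ V] {A B C : Pt → V}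
    (h : EqModU1 U A B) (h' : EqModU1 U B C) : EqModU1 U A C := by
  obtain ⟨c, hc, H⟩ := h
  obtain ⟨c', hc', H'⟩ := h'
  exact ⟨c * c', by simp [hc, hc'], fun x hx => by rw [H x hx, H' x hx, smul_smul]⟩

theorem EqModU1.of_eqOn {V : Type*} [AddCommGroup V] [Module ℂ V] {A B : Pt → V}
    (h : ∀ x ∈ U, A x = B x) : EqModU1 U A B :=
  ⟨1, by simp, fun x hx => by rw [h x hx, one_smul]⟩

theorem EqModU1.sigmaXiXi {ξ ξ' : Pt → Fin 2 → ℂ} (h : EqModU1 U ξ ξ') :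
    EqModU1 U (sigmaXiXi σ ξ) (sigmaXiXi σ ξ') := by
  obtain ⟨c, hc, H⟩ := h
  refine ⟨c ^ 2, by simp [hc], fun x hx => ?_⟩
  ext α β
  simp only [Teleparallel.sigmaXiXi, H x hx, Pi.smul_apply, smul_eq_mul, Fin.sum_univ_two]
  ring

/-- The Pauli coframe is invertible, so equal forms mean equal squares `ξ ⊗ ξ` up to phase.
Connectedness then keeps the remaining sign constant. -/
theorem IsPauli.eqModU1_of_sigmaXiXi (hσ : IsPauli U g θ₀ σ) (hg : IsLorentzianMetric U g)
    (hθ₀ : IsOrientedCoframe U g θ₀) (hUsc : SimplyConnectedSpace U)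
    (ξ ξ' : NonvanishingSpinor U) (h : EqModU1 U (sigmaXiXi σ ξ'.ξ) (sigmaXiXi σ ξ.ξ)) :
    EqModU1 U ξ'.ξ ξ.ξ := by
  obtain ⟨c, hc, H⟩ := h
  have hUc : IsPreconnected U :=
    isPreconnected_iff_preconnectedSpace.2 inferInstance
  refine eqModU1_of_sq_eq hUc ξ.smooth.continuousOn ξ'.smooth.continuousOn ξ.nonvanishing hc
    fun x hx => ?_
  have h1 := H x hx
  rw [hσ.sigmaXiXi_eq_pull hx, hσ.sigmaXiXi_eq_pull hx] at h1
  have h2 := h1.trans (pull_smul _ _ _).symm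
  have h3 := pull_injective ((hσ.coframe hg hθ₀).det_ne_zero hx) h2
  rw [spinForm_smul] at h3
  exact spinForm_injective h3

theorem eqModU1_of_coframeScalar_equiv (p p' : CoframeScalar U g θ₀)
    (h : (coframeScalarSetoid U g θ₀).r p p') :
    EqModU1 U (fun x => (p'.s x : ℂ) • lWedgeM p'.θ x) (fun x => (p.s x : ℂ) • lWedgeM p.θ x) := by
  obtain ⟨t, ht, H⟩ := h
  obtain ⟨c, hc, hst⟩ := extGroup_le_formStabilizer p.toCoframe ht
  refine ⟨c, hc, fun x hx => ?_⟩
  obtain ⟨h1, h2⟩ := H x hx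
  have h3 := hst x hx
  simp only [lWedgeM_eq_pull]
  change (p'.s x : ℂ) • pull (p'.θ x) (spinForm 1 0 0) =
      c • (p.s x : ℂ) • pull (p.θ x) (spinForm 1 0 0)
  rw [h1, h2, Transf.actFrame, Transf.actScalar, pull_mul, Complex.ofReal_mul, mul_comm, mul_smul,
    ← pull_smul, h3, pull_smul, smul_comm]

/-- A relation that is compatible with two equivalence relations, and total and injective modulo
them in both directions, is the graph of a bijection of the quotients. -/
theorem exists_quotient_equiv {A B : Type*} (sA : Setoid A) (sB : Setoid B) (R : A → B → Prop)
    (hA : ∀ a a' b, sA.r a a' → R a b → R a' b) (hB : ∀ a b b', sB.r b b' → R a b → R a b')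
    (hA' : ∀ a a' b, R a b → R a' b → sA.r a a') (hB' : ∀ a b b', R a b → R a b' → sB.r b b')
    (eA : ∀ a, ∃ b, R a b) (eB : ∀ b, ∃ a, R a b) :
    ∃ Φ : Quotient sA ≃ Quotient sB,
      ∀ a b, Φ (Quotient.mk _ a) = Quotient.mk _ b ↔ R a b := by
  choose f hf using eA
  let F : Quotient sA → Quotient sB := Quotient.lift (fun a => Quotient.mk sB (f a)) fun a a' h =>
    Quotient.sound (hB' _ _ _ (hA _ _ _ h (hf a)) (hf a'))
  have hF : ∀ a b, F (Quotient.mk _ a) = Quotient.mk _ b ↔ R a b := fun a b =>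
    ⟨fun h => hB _ _ _ (Quotient.exact h) (hf a), fun h => Quotient.sound (hB' _ _ _ (hf a) h)⟩
  refine ⟨Equiv.ofBijective F ⟨?_, ?_⟩, hF⟩
  · rintro ⟨a⟩ ⟨a'⟩ h
    exact Quotient.sound (hA' _ _ _ ((hF a (f a')).1 h) (hf a'))
  · rintro ⟨b⟩
    obtain ⟨a, ha⟩ := eB b
    exact ⟨Quotient.mk _ a, (hF a b).2 ha⟩

end Correspondence


/-! ### Algebra of spinors in the standard frame -/

section SpinorAlgebra

/-- The standard Pauli matrices `τ_j`. -/
noncomputable def pauliMat : Fin 4 → Matrix (Fin 2) (Fin 2) ℂ :=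
  ![!![1, 0; 0, 1], !![0, 1; 1, 0], !![0, Complex.I; -Complex.I, 0], !![1, 0; 0, -1]]

/-- The null covector `ξ τ_j ξ̄`. -/
noncomputable def spinVec (ξ : Fin 2 → ℂ) : Fin 4 → ℝ :=
  ![(ξ 0).re ^ 2 + (ξ 0).im ^ 2 + (ξ 1).re ^ 2 + (ξ 1).im ^ 2,
    2 * ((ξ 0).re * (ξ 1).re + (ξ 0).im * (ξ 1).im),
    2 * ((ξ 0).re * (ξ 1).im - (ξ 0).im * (ξ 1).re),
    (ξ 0).re ^ 2 + (ξ 0).im ^ 2 - (ξ 1).re ^ 2 - (ξ 1).im ^ 2]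

theorem mul_minkowski_mul_apply (A B : Matrix (Fin 4) (Fin 4) ℂ) (i j : Fin 4) :
    (A * cplx minkowski * B) i j =
      A i 0 * B 0 j - A i 1 * B 1 j - A i 2 * B 2 j - A i 3 * B 3 j := by
  simp only [Matrix.mul_apply, Fin.sum_univ_four, cplx_apply, minkowski_apply]
  simp
  ring

/-- The quadratic expression `F o F†` of the null form `F` of `ξ` is `-2 v ⊗ v` with `v` its null
covector; the factor comes from `m · m̄ = -2`. It is insensitive to the phase of `F`, and so
recovers `v` from a form known only modulo `U(1)`. -/
theorem spinForm_energy (ξ : Fin 2 → ℂ) (i j : Fin 4) :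
    (spinForm (ξ 0 ^ 2) (ξ 0 * ξ 1) (ξ 1 ^ 2) * cplx minkowski *
      (spinForm (ξ 0 ^ 2) (ξ 0 * ξ 1) (ξ 1 ^ 2))ᴴ) i j =
      ((-2 * (spinVec ξ i * spinVec ξ j) : ℝ) : ℂ) := by
  rw [mul_minkowski_mul_apply]
  simp only [Matrix.conjTranspose_apply]
  apply Complex.ext
  · fin_cases i <;> fin_cases j <;> simp [spinForm, spinVec, pow_two] <;> ring
  · fin_cases i <;> fin_cases j <;> simp [spinForm, spinVec, pow_two] <;> ring

theorem cplx_conjTranspose (A : Matrix (Fin 4) (Fin 4) ℝ) : (cplx A)ᴴ = (cplx A)ᵀ := by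
  ext i j
  simp [Matrix.conjTranspose_apply]

/-- Comparing `F o F†` on both sides gives `v ⊗ v = s l ⊗ s l`, hence `v = ± s l`. Both time
components are positive, which excludes the minus sign. -/
theorem IsProperLorentz.spinVec_eq {Λ : Matrix (Fin 4) (Fin 4) ℝ} (h : IsProperLorentz Λ)
    {s : ℝ} (hs : 0 < s) {c : ℂ} (hc : ‖c‖ = 1) {ξ : Fin 2 → ℂ} (hξ : ξ ≠ 0)
    (H : (s : ℂ) • pull Λ (spinForm 1 0 0) = c • spinForm (ξ 0 ^ 2) (ξ 0 * ξ 1) (ξ 1 ^ 2))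
    (i : Fin 4) : spinVec ξ i = s * (Λ 0 i + Λ 3 i) := by
  have hcc : c * starRingEnd ℂ c = 1 := by
    rw [Complex.mul_conj, Complex.normSq_eq_norm_sq, hc]; simp
  have hl : ∀ i j, (pull Λ (spinForm 1 0 0) * cplx minkowski * (pull Λ (spinForm 1 0 0))ᴴ) i j =
      ((-2 * ((Λ 0 i + Λ 3 i) * (Λ 0 j + Λ 3 j)) : ℝ) : ℂ) := by
    intro i j
    have h1 : pull Λ (spinForm 1 0 0) * cplx minkowski * (pull Λ (spinForm 1 0 0))ᴴ =
        (cplx Λ)ᵀ * (spinForm 1 0 0 * cplx minkowski * (spinForm 1 0 0)ᴴ) * cplx Λ := by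
      have h2 : cplx Λ * cplx minkowski * (cplx Λ)ᵀ = cplx minkowski := by
        rw [← cplx_transpose, ← cplx_mul, ← cplx_mul, minkowski_swap h.eq]
      calc _ = (cplx Λ)ᵀ * spinForm 1 0 0 * (cplx Λ * cplx minkowski * (cplx Λ)ᵀ) *
            (spinForm 1 0 0)ᴴ * cplx Λ := by
            simp only [pull, Matrix.conjTranspose_mul, ← cplx_transpose, cplx_conjTranspose,
              Matrix.transpose_transpose, Matrix.mul_assoc]
        _ = _ := by rw [h2]; simp only [Matrix.mul_assoc]
    have h3 : spinForm 1 0 0 * cplx minkowski * (spinForm 1 0 0)ᴴ =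
        Matrix.of fun i j => ((-2 * (spinVec ![1, 0] i * spinVec ![1, 0] j) : ℝ) : ℂ) := by
      ext i j
      have := spinForm_energy ![1, 0] i j
      simpa using this
    rw [h1, h3]
    simp [Matrix.mul_apply, Fin.sum_univ_four, spinVec]
    ring
  have key : ∀ i j, s ^ 2 * ((Λ 0 i + Λ 3 i) * (Λ 0 j + Λ 3 j)) = spinVec ξ i * spinVec ξ j := by
    intro i j
    have h1 : ((s : ℂ) • pull Λ (spinForm 1 0 0)) * cplx minkowski *
        ((s : ℂ) • pull Λ (spinForm 1 0 0))ᴴ =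
        (c • spinForm (ξ 0 ^ 2) (ξ 0 * ξ 1) (ξ 1 ^ 2)) * cplx minkowski *
        (c • spinForm (ξ 0 ^ 2) (ξ 0 * ξ 1) (ξ 1 ^ 2))ᴴ := by rw [H]
    simp only [Matrix.conjTranspose_smul, Matrix.smul_mul, Matrix.mul_smul, smul_smul] at h1
    have h2 := congrFun (congrFun h1 i) j
    simp only [Matrix.smul_apply, hl, spinForm_energy, smul_eq_mul] at h2
    rw [show star c * c = 1 by rw [mul_comm]; exact hcc, one_mul] at h2
    have h3 : star (s : ℂ) = s := Complex.conj_ofReal s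
    rw [h3] at h2
    have h4 : s * s * (-2 * ((Λ 0 i + Λ 3 i) * (Λ 0 j + Λ 3 j))) =
        -2 * (spinVec ξ i * spinVec ξ j) := by exact_mod_cast h2
    linarith
  have hL0 : 0 < spinVec ξ 0 := by
    rcases lt_or_eq_of_le (show 0 ≤ spinVec ξ 0 by
      simp only [spinVec]; simp; positivity) with h0 | h0
    · exact h0
    · exfalso
      apply hξ
      simp only [spinVec] at h0
      simp at h0
      have a1 : (ξ 0).re = 0 := by
        nlinarith [sq_nonneg (ξ 0).re, sq_nonneg (ξ 0).im, sq_nonneg (ξ 1).re, sq_nonneg (ξ 1).im]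
      have a2 : (ξ 0).im = 0 := by
        nlinarith [sq_nonneg (ξ 0).re, sq_nonneg (ξ 0).im, sq_nonneg (ξ 1).re, sq_nonneg (ξ 1).im]
      have a3 : (ξ 1).re = 0 := by
        nlinarith [sq_nonneg (ξ 0).re, sq_nonneg (ξ 0).im, sq_nonneg (ξ 1).re, sq_nonneg (ξ 1).im]
      have a4 : (ξ 1).im = 0 := by
        nlinarith [sq_nonneg (ξ 0).re, sq_nonneg (ξ 0).im, sq_nonneg (ξ 1).re, sq_nonneg (ξ 1).im]
      ext k
      fin_cases k
      exacts [Complex.ext a1 a2, Complex.ext a3 a4]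
  -- The zeroth column is a future unit vector, so `Λ₀₀ > |Λ₃₀|`.
  have hl0 : 0 < Λ 0 0 + Λ 3 0 := by
    have h1 := congrFun (congrFun h.eq 0) 0
    simp [Matrix.mul_apply, Fin.sum_univ_four, minkowski_apply] at h1
    have h2 := h.time
    have h3 : (Λ 3 0) ^ 2 < (Λ 0 0) ^ 2 := by
      nlinarith [sq_nonneg (Λ 1 0), sq_nonneg (Λ 2 0)]
    have := abs_lt_of_sq_lt_sq h3 h2.le
    linarith [(abs_lt.1 this).1]
  have h00 : s * (Λ 0 0 + Λ 3 0) = spinVec ξ 0 := by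
    have h1 : (s * (Λ 0 0 + Λ 3 0)) ^ 2 = spinVec ξ 0 ^ 2 := by
      have := key 0 0
      linear_combination this
    exact (pow_left_inj₀ (mul_pos hs hl0).le hL0.le two_ne_zero).1 h1
  have h0i := key 0 i
  rw [← h00] at h0i
  have : s * (Λ 0 0 + Λ 3 0) * (s * (Λ 0 i + Λ 3 i) - spinVec ξ i) = 0 := by
    linear_combination h0i
  have := (mul_eq_zero.1 this).resolve_left (mul_pos hs hl0).ne'
  linarith

/-- The antihermitian part of a product of three Pauli matrices. -/
theorem pauliMat_triple (ξ : Fin 2 → ℂ) (r p j : Fin 4) :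
    minkowski r r * minkowski j j * (∑ a, ∑ b, ∑ c, ∑ d, starRingEnd ℂ (ξ b) * pauliMat r a b *
      (raiseSpin (pauliMat p) a c * pauliMat j d c * ξ d)).im =
      -minkowski p p * rowDet (spinVec ξ) (Pi.single p 1) (Pi.single r 1) (Pi.single j 1) := by
  simp only [Fin.sum_univ_two, raiseSpin, spinEps, rowDet_eq, minkowski_apply, pauliMat, spinVec]
  fin_cases r <;> fin_cases p <;> fin_cases j <;> simp <;> ring

/-- An infinitesimal Lorentz transformation acts on self-dual forms as the symmetric square of its
spin representation. Since `dξ ↦ ξ ⊙ dξ` is injective for `ξ ≠ 0`, the derivative of `ξ ⊗ ξ`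
determines that of `ξ`. -/
theorem spinor_deriv_eq {W : Matrix (Fin 4) (Fin 4) ℝ} (hW : Wᵀ = -W) {r : ℝ} {ξ dξ : Fin 2 → ℂ}
    (hξ : ξ ≠ 0)
    (H : (r : ℂ) • spinForm (ξ 0 ^ 2) (ξ 0 * ξ 1) (ξ 1 ^ 2) +
      ((cplx W)ᵀ * cplx minkowski * spinForm (ξ 0 ^ 2) (ξ 0 * ξ 1) (ξ 1 ^ 2) +
        spinForm (ξ 0 ^ 2) (ξ 0 * ξ 1) (ξ 1 ^ 2) * cplx minkowski * cplx W) =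
      spinForm (2 * (ξ 0 * dξ 0)) (ξ 0 * dξ 1 + ξ 1 * dξ 0) (2 * (ξ 1 * dξ 1))) :
    dξ 0 = (W 0 3 + Complex.I * W 1 2) / 2 * ξ 0 +
        (W 0 1 - W 1 3 - Complex.I * W 0 2 + Complex.I * W 2 3) / 2 * ξ 1 + r / 2 * ξ 0 ∧
      dξ 1 = (W 0 1 + W 1 3 + Complex.I * W 0 2 + Complex.I * W 2 3) / 2 * ξ 0 -
        (W 0 3 + Complex.I * W 1 2) / 2 * ξ 1 + r / 2 * ξ 1 := by
  have hanti : ∀ i j, W j i = -W i j := fun i j => congrFun (congrFun hW i) j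
  have hdiag : ∀ i, W i i = 0 := fun i => by linarith [hanti i i]
  have hI := Complex.I_mul_I
  -- The action of `W` in spinor components, induced by the traceless `2 × 2` matrix with rows `(w,
  -- u)` and `(v, -w)`, halved, in the notation introduced below.
  have key : ∀ X Y Z : ℂ, (cplx W)ᵀ * cplx minkowski * spinForm X Y Z +
      spinForm X Y Z * cplx minkowski * cplx W =
      spinForm ((W 0 3 + Complex.I * W 1 2) * X +
          (W 0 1 - W 1 3 - Complex.I * W 0 2 + Complex.I * W 2 3) * Y)
        ((W 0 1 + W 1 3 + Complex.I * W 0 2 + Complex.I * W 2 3) / 2 * X +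
          (W 0 1 - W 1 3 - Complex.I * W 0 2 + Complex.I * W 2 3) / 2 * Z)
        ((W 0 1 + W 1 3 + Complex.I * W 0 2 + Complex.I * W 2 3) * Y -
          (W 0 3 + Complex.I * W 1 2) * Z) := by
    intro X Y Z
    have h10 := hanti 0 1
    have h20 := hanti 0 2
    have h30 := hanti 0 3
    have h21 := hanti 1 2
    have h31 := hanti 1 3
    have h32 := hanti 2 3
    ext i j
    rw [Matrix.add_apply, mul_minkowski_mul_apply, mul_minkowski_mul_apply]
    simp only [Matrix.transpose_apply, cplx_apply]
    fin_cases i <;> fin_cases j <;>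
      simp [spinForm, hdiag, h10, h20, h30, h21, h31, h32] <;> ring_nf <;>
      (try simp only [Complex.I_sq]) <;> (try ring)
  rw [key, spinForm_smul] at H
  have H2 : ∀ A B C A' B' C' : ℂ, spinForm A B C + spinForm A' B' C' =
      spinForm (A + A') (B + B') (C + C') := by
    intro A B C A' B' C'
    ext i j
    fin_cases i <;> fin_cases j <;> simp [spinForm] <;> ring
  rw [H2] at H
  obtain ⟨e0, e1, e2⟩ := spinForm_injective H
  set w : ℂ := (W 0 3 + Complex.I * W 1 2) with hw
  set u : ℂ := (W 0 1 - W 1 3 - Complex.I * W 0 2 + Complex.I * W 2 3) with hu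
  set v : ℂ := (W 0 1 + W 1 3 + Complex.I * W 0 2 + Complex.I * W 2 3) with hv
  -- The deviation of `dξ` from the predicted value satisfies `ξ ⊙ δ = 0`, which forces `δ = 0`.
  set δ0 : ℂ := dξ 0 - (w / 2 * ξ 0 + u / 2 * ξ 1 + r / 2 * ξ 0) with hδ0
  set δ1 : ℂ := dξ 1 - (v / 2 * ξ 0 - w / 2 * ξ 1 + r / 2 * ξ 1) with hδ1
  have f0 : ξ 0 * δ0 = 0 := by rw [hδ0]; linear_combination (-1 / 2 : ℂ) * e0
  have f1 : ξ 0 * δ1 + ξ 1 * δ0 = 0 := by rw [hδ0, hδ1]; linear_combination (-1 : ℂ) * e1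
  have f2 : ξ 1 * δ1 = 0 := by rw [hδ1]; linear_combination (-1 / 2 : ℂ) * e2
  have hδ : δ0 = 0 ∧ δ1 = 0 := by
    by_cases h0 : ξ 0 = 0
    · have h1 : ξ 1 ≠ 0 := by
        intro h1
        apply hξ
        ext i; fin_cases i
        exacts [h0, h1]
      rw [h0, zero_mul, zero_add] at f1
      exact ⟨(mul_eq_zero.1 f1).resolve_left h1, (mul_eq_zero.1 f2).resolve_left h1⟩
    · have g0 := (mul_eq_zero.1 f0).resolve_left h0
      rw [g0, mul_zero, add_zero] at f1
      exact ⟨g0, (mul_eq_zero.1 f1).resolve_left h0⟩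
  exact ⟨sub_eq_zero.1 hδ.1, sub_eq_zero.1 hδ.2⟩

/-- Substitute the formula for `dξ`. The term in `r` contributes the real number `ξ̄ τ_i ξ` times `r
/ 2`, and so vanishes in the imaginary part; what is left is linear in `W`. -/
theorem rowDet_connection {W : Matrix (Fin 4) (Fin 4) ℝ} (hW : Wᵀ = -W) {r : ℝ}
    {ξ dξ : Fin 2 → ℂ} (hξ : ξ ≠ 0)
    (H : (r : ℂ) • spinForm (ξ 0 ^ 2) (ξ 0 * ξ 1) (ξ 1 ^ 2) +
      ((cplx W)ᵀ * cplx minkowski * spinForm (ξ 0 ^ 2) (ξ 0 * ξ 1) (ξ 1 ^ 2) +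
        spinForm (ξ 0 ^ 2) (ξ 0 * ξ 1) (ξ 1 ^ 2) * cplx minkowski * cplx W) =
      spinForm (2 * (ξ 0 * dξ 0)) (ξ 0 * dξ 1 + ξ 1 * dξ 0) (2 * (ξ 1 * dξ 1)))
    (v : Fin 4 → ℝ) :
    ∑ p, ∑ q, W p q * rowDet (spinVec ξ) (Pi.single p 1) v (Pi.single q 1) =
      4 * (∑ i, (v i * minkowski i i : ℂ) *
        ∑ a, ∑ b, starRingEnd ℂ (ξ b) * pauliMat i a b * dξ a).im := by
  obtain ⟨e0, e1⟩ := spinor_deriv_eq hW hξ H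
  have hanti : ∀ i j, W j i = -W i j := fun i j => congrFun (congrFun hW i) j
  have hdiag : ∀ i, W i i = 0 := fun i => by linarith [hanti i i]
  have h10 := hanti 0 1
  have h20 := hanti 0 2
  have h30 := hanti 0 3
  have h21 := hanti 1 2
  have h31 := hanti 1 3
  have h32 := hanti 2 3
  simp only [Fin.sum_univ_two, Fin.sum_univ_four, e0, e1, h10, h20, h30, h21, h31, h32, hdiag,
    rowDet_eq, spinVec, pauliMat, minkowski_apply]
  simp
  ring

end SpinorAlgebra


/-! ### Partial derivatives of matrix fields -/

section Derivatives

variable {U : Set Pt} {x : Pt}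

theorem pderiv_congr {F : Type*} [NormedAddCommGroup F] [NormedSpace ℝ F] (hU : IsOpen U)
    (hx : x ∈ U) {f f' : Pt → F} (h : ∀ y ∈ U, f y = f' y) (μ : Fin 4) :
    pderiv μ f x = pderiv μ f' x := by
  unfold pderiv
  rw [Filter.EventuallyEq.fderiv_eq (Filter.eventually_of_mem (hU.mem_nhds hx) h)]

variable {R : Type*} [NormedCommRing R] [NormedAlgebra ℝ R]

theorem pderiv_mul {f h : Pt → R} (hf : DifferentiableAt ℝ f x) (hh : DifferentiableAt ℝ h x)
    (μ : Fin 4) :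
    pderiv μ (fun y => f y * h y) x = pderiv μ f x * h x + f x * pderiv μ h x := by
  unfold pderiv
  rw [fderiv_fun_mul hf hh]
  simp only [_root_.add_apply, _root_.smul_apply, smul_eq_mul]
  ring

theorem pderiv_ofReal {f : Pt → ℝ} (hf : DifferentiableAt ℝ f x) (μ : Fin 4) :
    pderiv μ (fun y => (f y : ℂ)) x = ((pderiv μ f x : ℝ) : ℂ) := by
  unfold pderiv
  have h := Complex.ofRealCLM.hasFDerivAt.comp x hf.hasFDerivAt
  have h' : HasFDerivAt (fun y => (f y : ℂ)) (Complex.ofRealCLM.comp (fderiv ℝ f x)) x := h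
  rw [h'.fderiv]
  rfl

/-- The entrywise partial derivative of a matrix field. -/
noncomputable def dmat {m n : Type*} (μ : Fin 4) (A : Pt → Matrix m n R) (x : Pt) : Matrix m n R :=
  Matrix.of fun i j => pderiv μ (fun y => A y i j) x

theorem dmat_mul {m n k : Type*} [Fintype n] {A : Pt → Matrix m n R} {B : Pt → Matrix n k R}
    (hA : ∀ i j, DifferentiableAt ℝ (fun y => A y i j) x)
    (hB : ∀ i j, DifferentiableAt ℝ (fun y => B y i j) x) (μ : Fin 4) :
    dmat μ (fun y => A y * B y) x = dmat μ A x * B x + A x * dmat μ B x := by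
  ext i j
  simp only [dmat, Matrix.of_apply, Matrix.mul_apply, Matrix.add_apply]
  rw [← Finset.sum_add_distrib]
  simp only [← pderiv_mul (hA i _) (hB _ j)]
  unfold pderiv
  rw [fderiv_fun_sum (A := fun p y => A y i p * B y p j) (fun p _ => (hA i p).mul (hB p j))]
  simp

theorem dmat_congr {m n : Type*} (hU : IsOpen U) (hx : x ∈ U) {A B : Pt → Matrix m n R}
    (h : ∀ y ∈ U, A y = B y) (μ : Fin 4) : dmat μ A x = dmat μ B x := by
  ext i j
  exact pderiv_congr hU hx (fun y hy => by rw [h y hy]) μ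

theorem dmat_const {m n : Type*} (C : Matrix m n R) (μ : Fin 4) : dmat μ (fun _ => C) x = 0 := by
  ext i j
  simp [dmat, pderiv]

theorem dmat_cplx {A : Pt → Matrix (Fin 4) (Fin 4) ℝ}
    (hA : ∀ i j, DifferentiableAt ℝ (fun y => A y i j) x) (μ : Fin 4) :
    dmat μ (fun y => cplx (A y)) x = cplx (dmat μ A x) := by
  ext i j
  exact pderiv_ofReal (hA i j) μ

end Derivatives

/-! ### Axial torsion as a sum of determinants -/

section Determinants

variable {R : Type*} [CommRing R]

theorem sum_rowDet_mul (W A B : Matrix (Fin 4) (Fin 4) R) (u w : Fin 4 → R) :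
    ∑ j, ∑ k, W j k * rowDet u (A j) w (B k) =
      ∑ p, ∑ q, (Aᵀ * W * B) p q * rowDet u (Pi.single p 1) w (Pi.single q 1) := by
  have key (a b : Fin 4 → R) : rowDet u a w b =
      ∑ p, ∑ q, a p * b q * rowDet u (Pi.single p 1) w (Pi.single q 1) := by
    have h (c : Fin 4 → R) : c = fun i => ∑ p, c p * (Pi.single p 1 : Fin 4 → R) i := by
      ext i
      simp [Pi.single_apply]
    conv_lhs => rw [h a, rowDet_sum_second]
    refine Finset.sum_congr rfl fun p _ => ?_
    conv_lhs => rw [h b, rowDet_sum_fourth]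
    rw [Finset.mul_sum]
    exact Finset.sum_congr rfl fun q _ => by ring
  simp only [key (A _), Matrix.mul_apply, Matrix.transpose_apply, Finset.mul_sum, Finset.sum_mul]
  calc _ = ∑ j, ∑ k, ∑ p, ∑ q, A j p * W j k * B k q *
        rowDet u (Pi.single p 1) w (Pi.single q 1) := by
        refine Finset.sum_congr rfl fun j _ => Finset.sum_congr rfl fun k _ =>
          Finset.sum_congr rfl fun p _ => Finset.sum_congr rfl fun q _ => by ring
    _ = ∑ k, ∑ j, ∑ p, ∑ q, A j p * W j k * B k q *
        rowDet u (Pi.single p 1) w (Pi.single q 1) := Finset.sum_comm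
    _ = ∑ k, ∑ p, ∑ q, ∑ j, A j p * W j k * B k q *
        rowDet u (Pi.single p 1) w (Pi.single q 1) := by
        refine Finset.sum_congr rfl fun k _ => ?_
        rw [Finset.sum_comm]
        exact Finset.sum_congr rfl fun p _ => Finset.sum_comm
    _ = ∑ p, ∑ q, ∑ k, ∑ j, A j p * W j k * B k q *
        rowDet u (Pi.single p 1) w (Pi.single q 1) := by
        rw [Finset.sum_comm]
        exact Finset.sum_congr rfl fun p _ => Finset.sum_comm

/-- Every row can be written as a row vector times `e`, the coordinate vector `μ` being the row `e⁻¹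
μ` times `e`, so `det e` factors out. -/
theorem sum_rowDet_frame {e E : Matrix (Fin 4) (Fin 4) R} (hE : E * e = 1)
    (W : Matrix (Fin 4) (Fin 4) R) (l : Fin 4 → R) (μ : Fin 4) :
    ∑ p, ∑ q, (eᵀ * W * e) p q *
        rowDet (l ᵥ* e) (Pi.single p 1) (Pi.single μ 1) (Pi.single q 1) =
      e.det * ∑ p, ∑ q, W p q * rowDet l (Pi.single p 1) (E μ) (Pi.single q 1) := by
  have h1 : (Pi.single μ 1 : Fin 4 → R) = E μ ᵥ* e := by
    have : E μ ᵥ* e = (E * e) μ := rfl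
    rw [this, hE]
    ext i
    simp [Pi.single_apply, Matrix.one_apply, eq_comm]
  rw [← sum_rowDet_mul, Finset.mul_sum]
  refine Finset.sum_congr rfl fun p _ => ?_
  rw [Finset.mul_sum]
  refine Finset.sum_congr rfl fun q _ => ?_
  have h2 (i : Fin 4) : e i = (Pi.single i 1 : Fin 4 → R) ᵥ* e := by
    ext j
    simp
  rw [h1, h2 p, h2 q, rowDet_mul_det]
  ring

/-- A contraction with a connection which is symmetric in the form index vanishes. -/
theorem sum_rowDet_symm (F : Fin 4 → Matrix (Fin 4) (Fin 4) ℝ) (hF : ∀ μ p q, F μ p q = F q p μ)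
    (l : Fin 4 → ℝ) :
    ∑ μ, ∑ p, ∑ q, F μ p q * rowDet l (Pi.single p 1) (Pi.single μ 1) (Pi.single q 1) = 0 := by
  have h : ∑ μ, ∑ p, ∑ q, F μ p q * rowDet l (Pi.single p 1) (Pi.single μ 1) (Pi.single q 1) =
      -∑ μ, ∑ p, ∑ q, F μ p q * rowDet l (Pi.single p 1) (Pi.single μ 1) (Pi.single q 1) := by
    conv_lhs => rw [Finset.sum_comm]
    conv_rhs => rw [Finset.sum_comm]
    rw [← Finset.sum_neg_distrib]
    refine Finset.sum_congr rfl fun p _ => ?_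
    conv_lhs => rw [Finset.sum_comm]
    rw [← Finset.sum_neg_distrib]
    refine Finset.sum_congr rfl fun q _ => ?_
    rw [← Finset.sum_neg_distrib]
    refine Finset.sum_congr rfl fun μ _ => ?_
    -- Exchanging `μ` and `q` fixes the coefficient but transposes two rows of the determinant, so
    -- the sum equals its own negative.
    rw [hF μ p q, rowDet_eq, rowDet_eq]
    ring
  linarith

end Determinants

theorem wedge13_smul_sum {ι : Type*} (s : Finset ι) (u : Fin 4 → ℝ) (c : ι → ℝ)
    (T : ι → Fin 4 → Fin 4 → Fin 4 → ℝ) (α β γ δ : Fin 4) :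
    wedge13 u (fun α β γ => ∑ i ∈ s, c i * T i α β γ) α β γ δ =
      ∑ i ∈ s, c i * wedge13 u (T i) α β γ δ := by
  simp only [wedge13, Finset.mul_sum, ← Finset.sum_add_distrib, ← Finset.sum_sub_distrib]
  exact Finset.sum_congr rfl fun i _ => by ring

theorem wedge12_extDer {θ : Pt → Fin 4 → ℝ} (u : Fin 4 → ℝ) (x : Pt) (α β γ : Fin 4) :
    wedge12 u (extDer θ x) α β γ =
      ∑ μ, wedge12 u (wedge11 (Pi.single μ 1) (fun i => pderiv μ (fun y => θ y i) x)) α β γ := by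
  simp only [wedge12, wedge11, extDer]
  simp [Finset.sum_add_distrib, ← Finset.mul_sum, Pi.single_apply]

/-- With `dϑ^k = Σ dx^μ ∧ ∂_μ ϑ^k` the 4-form is a sum of determinants with rows `l`, `ϑ^j`, `dx^μ`,
`∂_μ ϑ^k`. Expanding the second and fourth rows isolates `ϑᵀ o ∂_μ ϑ`, the only place where
derivatives enter. -/
theorem teleLagrangian_eq (θ : Pt → Matrix (Fin 4) (Fin 4) ℝ) (x : Pt) (α β γ δ : Fin 4) :
    teleLagrangian θ x α β γ δ =
      (1 / 3) * (∑ μ, ∑ p, ∑ q, ((θ x)ᵀ * minkowski * dmat μ θ x) p q *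
        rowDet (covL θ x) (Pi.single p 1) (Pi.single μ 1) (Pi.single q 1)) *
        leviCivita α β γ δ := by
  simp only [← sum_rowDet_mul]
  have h : axialTorsion θ x = fun α β γ => ∑ i : Fin 4 × Fin 4 × Fin 4,
      (1 / 3 * minkowski i.2.1 i.2.2) *
        wedge12 (θ x i.2.1) (wedge11 (Pi.single i.1 1) (dmat i.1 θ x i.2.2)) α β γ := by
    ext α β γ
    simp only [axialTorsion, wedge12_extDer, Fintype.sum_prod_type, Finset.mul_sum]
    conv_rhs => rw [Finset.sum_comm]
    refine Finset.sum_congr rfl fun j _ => ?_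
    conv_rhs => rw [Finset.sum_comm]
    refine Finset.sum_congr rfl fun k _ => Finset.sum_congr rfl fun μ _ => ?_
    rw [mul_assoc]
    rfl
  rw [teleLagrangian, h, wedge13_smul_sum, Fintype.sum_prod_type]
  simp only [wedge13_wedge12_wedge11, Fintype.sum_prod_type, Finset.mul_sum, Finset.sum_mul]
  refine Finset.sum_congr rfl fun j _ => Finset.sum_congr rfl fun k _ =>
    Finset.sum_congr rfl fun μ _ => ?_
  ring


/-! ### Differentiating the relation between `Λ`, `s` and `ξ` -/

section LorentzConnection

variable {U : Set Pt} {x : Pt}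

theorem dmat_smul {R : Type*} [NormedCommRing R] [NormedAlgebra ℝ R] {m n : Type*} {f : Pt → R}
    {A : Pt → Matrix m n R} (hf : DifferentiableAt ℝ f x)
    (hA : ∀ i j, DifferentiableAt ℝ (fun y => A y i j) x) (μ : Fin 4) :
    dmat μ (fun y => f y • A y) x = pderiv μ f x • A x + f x • dmat μ A x := by
  ext i j
  exact pderiv_mul hf (hA i j) μ

theorem dmat_add {R : Type*} [NormedCommRing R] [NormedAlgebra ℝ R] {m n : Type*}
    {A B : Pt → Matrix m n R} (hA : ∀ i j, DifferentiableAt ℝ (fun y => A y i j) x)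
    (hB : ∀ i j, DifferentiableAt ℝ (fun y => B y i j) x) (μ : Fin 4) :
    dmat μ (fun y => A y + B y) x = dmat μ A x + dmat μ B x := by
  ext i j
  simp only [dmat, Matrix.of_apply, Matrix.add_apply]
  unfold pderiv
  rw [fderiv_fun_add (hA i j) (hB i j)]
  rfl

theorem spinForm_eq_add (X Y Z : ℂ) :
    spinForm X Y Z = X • spinForm 1 0 0 + Y • spinForm 0 1 0 + Z • spinForm 0 0 1 := by
  ext i j
  fin_cases i <;> fin_cases j <;> simp [spinForm] <;> ring

theorem dmat_spinForm {X Y Z : Pt → ℂ} (hX : DifferentiableAt ℝ X x) (hY : DifferentiableAt ℝ Y x)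
    (hZ : DifferentiableAt ℝ Z x) (μ : Fin 4) :
    dmat μ (fun y => spinForm (X y) (Y y) (Z y)) x =
      spinForm (pderiv μ X x) (pderiv μ Y x) (pderiv μ Z x) := by
  have h (f : Pt → ℂ) (hf : DifferentiableAt ℝ f x) (C : Matrix (Fin 4) (Fin 4) ℂ) (i j : Fin 4) :
      DifferentiableAt ℝ (fun y => (f y • C) i j) x := hf.mul_const (C i j)
  simp only [spinForm_eq_add (X _) (Y _) (Z _), spinForm_eq_add (pderiv μ _ _)]
  rw [dmat_add (A := fun y => X y • spinForm 1 0 0 + Y y • spinForm 0 1 0)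
      (fun i j => (h X hX _ i j).add (h Y hY _ i j)) (h Z hZ _),
    dmat_add (h X hX _) (h Y hY _),
    dmat_smul (A := fun _ => spinForm 1 0 0) hX (fun _ _ => differentiableAt_const _),
    dmat_smul (A := fun _ => spinForm 0 1 0) hY (fun _ _ => differentiableAt_const _),
    dmat_smul (A := fun _ => spinForm 0 0 1) hZ (fun _ _ => differentiableAt_const _)]
  simp [dmat_const]

variable {Λ : Pt → Matrix (Fin 4) (Fin 4) ℝ}

/-- The logarithmic derivative of a Lorentz transformation. -/
noncomputable def lorentzConn (Λ : Pt → Matrix (Fin 4) (Fin 4) ℝ) (x : Pt) (μ : Fin 4) :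
    Matrix (Fin 4) (Fin 4) ℝ :=
  (Λ x)ᵀ * minkowski * dmat μ Λ x

/-- Differentiate `Λᵀ o Λ = o`: the matrix takes values in the Lorentz algebra. -/
theorem lorentzConn_transpose (hU : IsOpen U) (hx : x ∈ U)
    (hΛ : ∀ i j, DifferentiableAt ℝ (fun y => Λ y i j) x)
    (h : ∀ y ∈ U, (Λ y)ᵀ * minkowski * Λ y = minkowski) (μ : Fin 4) :
    (lorentzConn Λ x μ)ᵀ = -lorentzConn Λ x μ := by
  have h1 := dmat_congr hU hx h μ
  have hc : ∀ i j, DifferentiableAt ℝ (fun y => ((fun _ : Pt => minkowski) y) i j) x :=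
    fun _ _ => differentiableAt_const _
  have hT : ∀ i j, DifferentiableAt ℝ (fun y => ((fun y => (Λ y)ᵀ) y) i j) x := fun i j => hΛ j i
  have hTo : ∀ i j, DifferentiableAt ℝ (fun y => ((fun y => (Λ y)ᵀ * minkowski) y) i j) x := by
    intro i j
    simp only [Matrix.mul_apply]
    exact DifferentiableAt.fun_sum fun k _ => (hΛ k i).mul_const _
  rw [dmat_const, dmat_mul hTo hΛ, dmat_mul hT hc, dmat_const, Matrix.mul_zero, add_zero] at h1
  have h2 : (lorentzConn Λ x μ)ᵀ = dmat μ (fun y => (Λ y)ᵀ) x * minkowski * Λ x := by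
    simp only [lorentzConn, Matrix.transpose_mul, minkowski_transpose, Matrix.transpose_transpose,
      Matrix.mul_assoc]
    rfl
  rw [h2]
  exact eq_neg_of_add_eq_zero_left h1

theorem dmat_eq_mul_lorentzConn (h : (Λ x)ᵀ * minkowski * Λ x = minkowski) (μ : Fin 4) :
    dmat μ Λ x = Λ x * minkowski * lorentzConn Λ x μ := by
  have h1 := minkowski_swap h
  rw [lorentzConn, ← Matrix.mul_assoc, ← Matrix.mul_assoc, h1, minkowski_mul_self, Matrix.one_mul]

theorem dmat_pull (hΛ : ∀ i j, DifferentiableAt ℝ (fun y => Λ y i j) x)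
    (h : (Λ x)ᵀ * minkowski * Λ x = minkowski) (B : Matrix (Fin 4) (Fin 4) ℂ) (μ : Fin 4) :
    dmat μ (fun y => pull (Λ y) B) x =
      (cplx (lorentzConn Λ x μ))ᵀ * cplx minkowski * pull (Λ x) B +
        pull (Λ x) B * cplx minkowski * cplx (lorentzConn Λ x μ) := by
  have hc : ∀ i j, DifferentiableAt ℝ (fun y => cplx (Λ y) i j) x :=
    fun i j => Complex.ofRealCLM.differentiableAt.comp x (hΛ i j)
  have hT : ∀ i j, DifferentiableAt ℝ (fun y => ((fun y => (cplx (Λ y))ᵀ) y) i j) x :=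
    fun i j => hc j i
  have hB : ∀ i j, DifferentiableAt ℝ (fun y => ((fun y => (cplx (Λ y))ᵀ * B) y) i j) x := by
    intro i j
    simp only [Matrix.mul_apply]
    exact DifferentiableAt.fun_sum fun k _ => (hc k i).mul_const _
  have hTd : dmat μ (fun y => (cplx (Λ y))ᵀ) x = (cplx (dmat μ Λ x))ᵀ := by
    rw [← dmat_cplx hΛ]; rfl
  simp only [pull]
  rw [dmat_mul hB hc, dmat_mul (B := fun _ => B) hT (fun _ _ => differentiableAt_const _), dmat_const,
    Matrix.mul_zero, add_zero, hTd, dmat_cplx hΛ, dmat_eq_mul_lorentzConn h]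
  simp only [← cplx_transpose, Matrix.transpose_mul, minkowski_transpose, cplx_mul, Matrix.mul_assoc]

/-- The product rule applied to the relation, which is then used once more to eliminate `Λ`. Because
the phase `c` is constant it contributes no derivative and cancels; a variable phase would add an
imaginary multiple of `ξ`. Only the logarithmic derivative of `s` remains. -/
theorem spinor_connection (hU : IsOpen U) (hx : x ∈ U)
    (hΛ : ∀ i j, DifferentiableAt ℝ (fun y => Λ y i j) x)
    (h : (Λ x)ᵀ * minkowski * Λ x = minkowski) {s : Pt → ℝ} (hs : DifferentiableAt ℝ s x)
    (hs0 : s x ≠ 0) {ξ : Pt → Fin 2 → ℂ} (hξ : ∀ a, DifferentiableAt ℝ (fun y => ξ y a) x) {c : ℂ}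
    (hc : c ≠ 0)
    (H : ∀ y ∈ U, (s y : ℂ) • pull (Λ y) (spinForm 1 0 0) =
      c • spinForm (ξ y 0 ^ 2) (ξ y 0 * ξ y 1) (ξ y 1 ^ 2)) (μ : Fin 4) :
    ((pderiv μ s x / s x : ℝ) : ℂ) • spinForm (ξ x 0 ^ 2) (ξ x 0 * ξ x 1) (ξ x 1 ^ 2) +
      ((cplx (lorentzConn Λ x μ))ᵀ * cplx minkowski *
          spinForm (ξ x 0 ^ 2) (ξ x 0 * ξ x 1) (ξ x 1 ^ 2) +
        spinForm (ξ x 0 ^ 2) (ξ x 0 * ξ x 1) (ξ x 1 ^ 2) * cplx minkowski *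
          cplx (lorentzConn Λ x μ)) =
      spinForm (2 * (ξ x 0 * pderiv μ (fun y => ξ y 0) x))
        (ξ x 0 * pderiv μ (fun y => ξ y 1) x + ξ x 1 * pderiv μ (fun y => ξ y 0) x)
        (2 * (ξ x 1 * pderiv μ (fun y => ξ y 1) x)) := by
  have hcx : ∀ i j, DifferentiableAt ℝ (fun y => cplx (Λ y) i j) x :=
    fun i j => Complex.ofRealCLM.differentiableAt.comp x (hΛ i j)
  have hp : ∀ i j, DifferentiableAt ℝ (fun y => pull (Λ y) (spinForm 1 0 0) i j) x := by
    intro i j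
    simp only [pull, Matrix.mul_apply, Matrix.transpose_apply]
    exact DifferentiableAt.fun_sum fun k _ =>
      (DifferentiableAt.fun_sum fun l _ => (hcx l i).mul_const _).mul (hcx k j)
  have hsc : DifferentiableAt ℝ (fun y => (s y : ℂ)) x :=
    Complex.ofRealCLM.differentiableAt.comp x hs
  have hf : ∀ i j, DifferentiableAt ℝ
      (fun y => spinForm (ξ y 0 ^ 2) (ξ y 0 * ξ y 1) (ξ y 1 ^ 2) i j) x := by
    intro i j
    simp only [spinForm_eq_add (_ ^ 2)]
    exact ((((hξ 0).pow 2).mul_const _).add (((hξ 0).mul (hξ 1)).mul_const _)).add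
      (((hξ 1).pow 2).mul_const _)
  have h1 := dmat_congr hU hx H μ
  rw [dmat_smul hsc hp, pderiv_ofReal hs, dmat_pull hΛ h, dmat_smul (differentiableAt_const c) hf,
    dmat_spinForm ((hξ 0).fun_pow 2) ((hξ 0).fun_mul (hξ 1)) ((hξ 1).fun_pow 2), pderiv_mul (hξ 0) (hξ 1)] at h1
  simp only [pow_two] at h1
  rw [pderiv_mul (hξ 0) (hξ 0), pderiv_mul (hξ 1) (hξ 1)] at h1
  have hc0 : pderiv μ (fun _ => c) x = 0 := by simp [pderiv]
  have hsx : (s x : ℂ) ≠ 0 := by exact_mod_cast hs0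
  have h2 : pull (Λ x) (spinForm 1 0 0) =
      (c / s x) • spinForm (ξ x 0 ^ 2) (ξ x 0 * ξ x 1) (ξ x 1 ^ 2) := by
    rw [div_eq_inv_mul, mul_smul, ← H x hx, inv_smul_smul₀ hsx]
  rw [hc0, zero_smul, zero_add, h2] at h1
  have h3 : ∀ M : Matrix (Fin 4) (Fin 4) ℂ, c⁻¹ • c • M = M := fun M => inv_smul_smul₀ hc M
  have h4 : pderiv μ (fun y => ξ y 0) x * ξ x 0 + ξ x 0 * pderiv μ (fun y => ξ y 0) x =
    2 * (ξ x 0 * pderiv μ (fun y => ξ y 0) x) := by ring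
  have h5 : pderiv μ (fun y => ξ y 1) x * ξ x 1 + ξ x 1 * pderiv μ (fun y => ξ y 1) x =
    2 * (ξ x 1 * pderiv μ (fun y => ξ y 1) x) := by ring
  have h6 : pderiv μ (fun y => ξ y 0) x * ξ x 1 + ξ x 0 * pderiv μ (fun y => ξ y 1) x =
    ξ x 0 * pderiv μ (fun y => ξ y 1) x + ξ x 1 * pderiv μ (fun y => ξ y 0) x := by ring
  rw [h4, h5, h6] at h1
  rw [← h3 (spinForm (2 * _) _ _), ← h1]
  simp only [smul_add, smul_smul, Matrix.mul_smul, Matrix.smul_mul]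
  have e1 : c⁻¹ * (((pderiv μ s x : ℝ) : ℂ) * (c / s x)) = ((pderiv μ s x / s x : ℝ) : ℂ) := by
    push_cast; field_simp
  have e2 : c⁻¹ * ((s x : ℂ) * (c / s x)) = 1 := by field_simp
  rw [e1, e2, one_smul, one_smul]

end LorentzConnection


/-! ### The Weyl Lagrangian in the coframe of the Pauli matrices -/

section Weyl

variable {U : Set Pt} {g θ₀ : Pt → Matrix (Fin 4) (Fin 4) ℝ}
  {σ : Pt → Fin 4 → Matrix (Fin 2) (Fin 2) ℂ} {x : Pt}

theorem IsPauli.apply_eq (hσ : IsPauli U g θ₀ σ) (hx : x ∈ U) (β : Fin 4) (a b : Fin 2) :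
    σ x β a b = ∑ p, (pauliFrame σ x p β : ℂ) * pauliMat p a b := by
  obtain ⟨h0, h1, h2, h3⟩ := hσ.eq_pauliFrame hx β
  fin_cases a <;> fin_cases b <;> simp [Fin.sum_univ_four, pauliMat, h0, h1, h2, h3] <;> ring

theorem IsPauli.raiseSpin_eq (hσ : IsPauli U g θ₀ σ) (hx : x ∈ U) (β : Fin 4) (a b : Fin 2) :
    raiseSpin (σ x β) a b = ∑ p, (pauliFrame σ x p β : ℂ) * raiseSpin (pauliMat p) a b := by
  simp only [raiseSpin, hσ.apply_eq hx, Finset.mul_sum]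
  conv_lhs => enter [2, c]; rw [Finset.sum_comm]
  rw [Finset.sum_comm]
  exact Finset.sum_congr rfl fun p _ => Finset.sum_congr rfl fun c _ =>
    Finset.sum_congr rfl fun d _ => by ring

/-- Raising the index turns `e` into its inverse, by `g⁻¹ eᵀ = e⁻¹ o`. -/
theorem IsPauli.sigmaUp_eq (hσ : IsPauli U g θ₀ σ) (hg : IsLorentzianMetric U g)
    (hθ₀ : IsOrientedCoframe U g θ₀) (hx : x ∈ U) (μ : Fin 4) (a b : Fin 2) :
    sigmaUp g σ x μ a b =
      ∑ r, ((pauliFrame σ x)⁻¹ μ r : ℂ) * (minkowski r r * pauliMat r a b) := by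
  have h1 : (g x)⁻¹ * (pauliFrame σ x)ᵀ = (pauliFrame σ x)⁻¹ * minkowski := by
    rw [inv_metric ((hσ.coframe hg hθ₀).isOriented.metric_eq hx)]
    change (pauliFrame σ x)⁻¹ * minkowski * ((pauliFrame σ x)⁻¹)ᵀ * (pauliFrame σ x)ᵀ = _
    have h2 : pauliFrame σ x * (pauliFrame σ x)⁻¹ = 1 := (hσ.coframe hg hθ₀).mul_inv hx
    rw [Matrix.mul_assoc, ← Matrix.transpose_mul, h2, Matrix.transpose_one, Matrix.mul_one]
  have h3 (r : Fin 4) : ∑ β, ((g x)⁻¹ μ β : ℂ) * (pauliFrame σ x r β : ℂ) =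
      ((pauliFrame σ x)⁻¹ μ r : ℂ) * minkowski r r := by
    have := congrFun (congrFun h1 μ) r
    rw [minkowski, Matrix.mul_diagonal, Matrix.mul_apply] at this
    rw [minkowski, Matrix.diagonal_apply_eq]
    exact_mod_cast this
  simp only [sigmaUp, hσ.apply_eq hx, Finset.mul_sum]
  rw [Finset.sum_comm]
  refine Finset.sum_congr rfl fun r _ => ?_
  rw [← mul_assoc, ← h3, Finset.sum_mul]
  exact Finset.sum_congr rfl fun β _ => by ring

theorem IsPauli.pderiv_sigmaUp (hσ : IsPauli U g θ₀ σ) (hg : IsLorentzianMetric U g)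
    (hθ₀ : IsOrientedCoframe U g θ₀) (hU : IsOpen U) (hx : x ∈ U)
    (hE : ∀ i j, DifferentiableAt ℝ (fun y => (pauliFrame σ y)⁻¹ i j) x) (μ β : Fin 4)
    (a b : Fin 2) :
    pderiv μ (fun y => sigmaUp g σ y β a b) x =
      ∑ r, ((dmat μ (fun y => (pauliFrame σ y)⁻¹) x β r : ℝ) : ℂ) *
        (minkowski r r * pauliMat r a b) := by
  have hEc : ∀ i j, DifferentiableAt ℝ (fun y => cplx ((pauliFrame σ y)⁻¹) i j) x :=
    fun i j => Complex.ofRealCLM.differentiableAt.comp x (hE i j)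
  -- The constant coefficients form a single column, so the product rule for matrices applies.
  let B : Matrix (Fin 4) Unit ℂ := Matrix.of fun r _ => minkowski r r * pauliMat r a b
  have h := dmat_mul (B := fun _ => B) hEc (fun _ _ => differentiableAt_const _) μ
  rw [dmat_const, Matrix.mul_zero, add_zero, dmat_cplx hE] at h
  rw [pderiv_congr hU hx (fun y hy => hσ.sigmaUp_eq hg hθ₀ hy β a b)]
  exact congrFun (congrFun h β) ()

/-- The matrix of the spinor connection in terms of the coframe of the Pauli matrices. -/
noncomputable def frameConn (g : Pt → Matrix (Fin 4) (Fin 4) ℝ)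
    (e : Pt → Matrix (Fin 4) (Fin 4) ℝ) (x : Pt) (μ : Fin 4) : Matrix (Fin 4) (Fin 4) ℝ :=
  e x * (dmat μ (fun y => (e y)⁻¹) x + Matrix.of (fun β γ => christoffel g x β μ γ) * (e x)⁻¹)

theorem IsPauli.spinCovDeriv_eq (hσ : IsPauli U g θ₀ σ) (hg : IsLorentzianMetric U g)
    (hθ₀ : IsOrientedCoframe U g θ₀) (hU : IsOpen U) (hx : x ∈ U)
    (hE : ∀ i j, DifferentiableAt ℝ (fun y => (pauliFrame σ y)⁻¹ i j) x) (ξ : Pt → Fin 2 → ℂ)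
    (μ : Fin 4) (a : Fin 2) :
    spinCovDeriv g σ ξ x μ a = pderiv μ (fun y => ξ y a) x +
      (1 / 4) * ∑ p, ∑ j, (frameConn g (pauliFrame σ) x μ p j : ℂ) * minkowski j j *
        ∑ c, ∑ d, raiseSpin (pauliMat p) a c * pauliMat j d c * ξ x d := by
  have h1 (β : Fin 4) (b c : Fin 2) : pderiv μ (fun y => sigmaUp g σ y β b c) x +
      ∑ γ, (christoffel g x β μ γ : ℂ) * sigmaUp g σ x γ b c =
      ∑ j, (((dmat μ (fun y => (pauliFrame σ y)⁻¹) x +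
        Matrix.of (fun β γ => christoffel g x β μ γ) * (pauliFrame σ x)⁻¹) β j : ℝ) : ℂ) *
          (minkowski j j * pauliMat j b c) := by
    rw [hσ.pderiv_sigmaUp hg hθ₀ hU hx hE]
    simp only [hσ.sigmaUp_eq hg hθ₀ hx, Matrix.add_apply, Complex.ofReal_add, add_mul,
      Finset.sum_add_distrib, Matrix.mul_apply, Complex.ofReal_sum, Complex.ofReal_mul,
      Finset.mul_sum, Finset.sum_mul, Matrix.of_apply]
    congr 1
    rw [Finset.sum_comm]
    exact Finset.sum_congr rfl fun j _ => Finset.sum_congr rfl fun γ _ => by ring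
  rw [spinCovDeriv]
  congr 2
  simp only [h1, hσ.raiseSpin_eq hx, frameConn]
  generalize dmat μ (fun y => (pauliFrame σ y)⁻¹) x +
        Matrix.of (fun β γ => christoffel g x β μ γ) * (pauliFrame σ x)⁻¹ = N
  simp only [Matrix.mul_apply, Complex.ofReal_sum, Complex.ofReal_mul, Fin.sum_univ_two]
  simp only [Finset.sum_mul, Finset.mul_sum, ← Finset.sum_add_distrib]
  calc _ = ∑ β, ∑ j, ∑ p, (pauliFrame σ x p β : ℂ) * N β j * minkowski j j *
        (raiseSpin (pauliMat p) a 0 * pauliMat j 0 0 * ξ x 0 +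
          raiseSpin (pauliMat p) a 0 * pauliMat j 1 0 * ξ x 1 +
        (raiseSpin (pauliMat p) a 1 * pauliMat j 0 1 * ξ x 0 +
          raiseSpin (pauliMat p) a 1 * pauliMat j 1 1 * ξ x 1)) := by
        refine Finset.sum_congr rfl fun β _ => Finset.sum_congr rfl fun j _ =>
          Finset.sum_congr rfl fun p _ => ?_
        ring
    _ = _ := by
        rw [Finset.sum_comm]
        conv_lhs => enter [2, j]; rw [Finset.sum_comm]
        rw [Finset.sum_comm]

theorem IsPauli.volDensity_eq (hσ : IsPauli U g θ₀ σ) (hg : IsLorentzianMetric U g)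
    (hθ₀ : IsOrientedCoframe U g θ₀) (hx : x ∈ U) : volDensity g x = (pauliFrame σ x).det := by
  have h : 0 < (pauliFrame σ x).det := (hσ.coframe hg hθ₀).isOriented.orient x hx
  have h1 : g x = (pauliFrame σ x)ᵀ * minkowski * pauliFrame σ x :=
    (hσ.coframe hg hθ₀).isOriented.metric_eq hx
  rw [volDensity, h1, Matrix.det_mul, Matrix.det_mul, Matrix.det_transpose, minkowski_det]
  rw [show (pauliFrame σ x).det * -1 * (pauliFrame σ x).det = -((pauliFrame σ x).det ^ 2) by ring,
    abs_neg, abs_sq, Real.sqrt_sq h.le]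

/-- The contraction `ξ̄ σ^μ ∇_μ ξ`. -/
noncomputable def spinCurrent (g : Pt → Matrix (Fin 4) (Fin 4) ℝ)
    (σ : Pt → Fin 4 → Matrix (Fin 2) (Fin 2) ℂ) (ξ : Pt → Fin 2 → ℂ) (x : Pt) : ℂ :=
  ∑ μ, ∑ a, ∑ b, starRingEnd ℂ (ξ x b) * sigmaUp g σ x μ a b * spinCovDeriv g σ ξ x μ a

/-- As `σ` is Hermitian, the bracket is `z - z̄ = 2i Im z` for the current `z`, and `(i/2)(2i) =
-1`. -/
theorem IsPauli.weylLagrangian_eq (hσ : IsPauli U g θ₀ σ) (hg : IsLorentzianMetric U g)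
    (hθ₀ : IsOrientedCoframe U g θ₀) (hx : x ∈ U) (ξ : Pt → Fin 2 → ℂ) (α β γ δ : Fin 4) :
    weylLagrangian g σ ξ x α β γ δ =
      ((-((spinCurrent g σ ξ x).im * (pauliFrame σ x).det * leviCivita α β γ δ) : ℝ) : ℂ) := by
  have hup (μ : Fin 4) (a b : Fin 2) :
      sigmaUp g σ x μ a b = starRingEnd ℂ (sigmaUp g σ x μ b a) := by
    simp only [sigmaUp, map_sum, map_mul, Complex.conj_ofReal]
    refine Finset.sum_congr rfl fun ν _ => ?_
    rw [← (hσ.hermitian x hx ν).apply a b]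
    rfl
  have h1 : ∑ μ, ∑ a, ∑ b,
      (starRingEnd ℂ (ξ x b) * sigmaUp g σ x μ a b * spinCovDeriv g σ ξ x μ a -
      ξ x a * sigmaUp g σ x μ a b * starRingEnd ℂ (spinCovDeriv g σ ξ x μ b)) =
      spinCurrent g σ ξ x - starRingEnd ℂ (spinCurrent g σ ξ x) := by
    simp only [spinCurrent, map_sum, map_mul, Complex.conj_conj, Finset.sum_sub_distrib]
    congr 1
    refine Finset.sum_congr rfl fun μ _ => ?_
    rw [Finset.sum_comm]
    refine Finset.sum_congr rfl fun a _ => Finset.sum_congr rfl fun b _ => ?_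
    rw [hup μ b a]
  rw [weylLagrangian, h1, Complex.sub_conj, volForm, hσ.volDensity_eq hg hθ₀ hx]
  push_cast
  linear_combination ((spinCurrent g σ ξ x).im : ℂ) * ((pauliFrame σ x).det : ℂ) *
    (leviCivita α β γ δ : ℂ) * Complex.I_mul_I

/-- The connection term is a product of three Pauli matrices between `ξ̄` and `ξ`, whose imaginary
part is a determinant by `pauliMat_triple`. The coefficient `1/4` of the spin connection cancels the
`4`. -/
theorem IsPauli.spinCurrent_im (hσ : IsPauli U g θ₀ σ) (hg : IsLorentzianMetric U g)
    (hθ₀ : IsOrientedCoframe U g θ₀) (hU : IsOpen U) (hx : x ∈ U)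
    (hE : ∀ i j, DifferentiableAt ℝ (fun y => (pauliFrame σ y)⁻¹ i j) x) (ξ : Pt → Fin 2 → ℂ) :
    4 * (spinCurrent g σ ξ x).im = ∑ μ,
      (4 * (∑ i, ((pauliFrame σ x)⁻¹ μ i * minkowski i i : ℂ) * ∑ a, ∑ b,
          starRingEnd ℂ (ξ x b) * pauliMat i a b * pderiv μ (fun y => ξ y a) x).im -
        ∑ p, ∑ j, (minkowski * frameConn g (pauliFrame σ) x μ) p j *
          rowDet (spinVec (ξ x)) (Pi.single p 1) ((pauliFrame σ x)⁻¹ μ) (Pi.single j 1)) := by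
  have h1 (μ : Fin 4) : ∑ a, ∑ b,
      starRingEnd ℂ (ξ x b) * sigmaUp g σ x μ a b * spinCovDeriv g σ ξ x μ a =
      (∑ i, ((pauliFrame σ x)⁻¹ μ i * minkowski i i : ℂ) * ∑ a, ∑ b,
          starRingEnd ℂ (ξ x b) * pauliMat i a b * pderiv μ (fun y => ξ y a) x) +
      (1 / 4) * ∑ p, ∑ j, ∑ r, (((pauliFrame σ x)⁻¹ μ r : ℝ) : ℂ) *
        (frameConn g (pauliFrame σ) x μ p j : ℂ) *
        (((minkowski r r * minkowski j j : ℝ) : ℂ) *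
          ∑ a, ∑ b, ∑ c, ∑ d, starRingEnd ℂ (ξ x b) * pauliMat r a b *
            (raiseSpin (pauliMat p) a c * pauliMat j d c * ξ x d)) := by
    simp only [hσ.sigmaUp_eq hg hθ₀ hx, hσ.spinCovDeriv_eq hg hθ₀ hU hx hE, mul_add,
      Finset.sum_add_distrib]
    congr 1
    · simp only [Finset.mul_sum, Finset.sum_mul]
      conv_lhs => enter [2, a]; rw [Finset.sum_comm]
      rw [Finset.sum_comm]
      refine Finset.sum_congr rfl fun r _ => Finset.sum_congr rfl fun a _ =>
        Finset.sum_congr rfl fun b _ => by ring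
    · simp only [Finset.mul_sum, Finset.sum_mul, Fin.sum_univ_two (M := ℂ), ← Finset.sum_add_distrib]
      refine Finset.sum_congr rfl fun p _ => Finset.sum_congr rfl fun j _ =>
        Finset.sum_congr rfl fun r _ => ?_
      push_cast
      ring
  have h2 (μ p j : Fin 4) :
      (∑ r, (((pauliFrame σ x)⁻¹ μ r : ℝ) : ℂ) * (frameConn g (pauliFrame σ) x μ p j : ℂ) *
        (((minkowski r r * minkowski j j : ℝ) : ℂ) *
          ∑ a, ∑ b, ∑ c, ∑ d, starRingEnd ℂ (ξ x b) * pauliMat r a b *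
            (raiseSpin (pauliMat p) a c * pauliMat j d c * ξ x d))).im =
      -((minkowski * frameConn g (pauliFrame σ) x μ) p j *
          rowDet (spinVec (ξ x)) (Pi.single p 1) ((pauliFrame σ x)⁻¹ μ) (Pi.single j 1)) := by
    have h3 : (pauliFrame σ x)⁻¹ μ =
        fun i => ∑ r, (pauliFrame σ x)⁻¹ μ r * (Pi.single r 1 : Fin 4 → ℝ) i := by
      ext i
      simp [Pi.single_apply]
    conv_rhs => rw [h3, rowDet_sum_third]
    rw [minkowski, Matrix.diagonal_mul, Complex.im_sum, Finset.mul_sum, ← Finset.sum_neg_distrib]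
    refine Finset.sum_congr rfl fun r _ => ?_
    rw [← Complex.ofReal_mul, Complex.im_ofReal_mul, Complex.im_ofReal_mul]
    have h4 := pauliMat_triple (ξ x) r p j
    rw [minkowski, Matrix.diagonal_apply_eq, Matrix.diagonal_apply_eq,
      Matrix.diagonal_apply_eq] at h4
    rw [Matrix.diagonal_apply_eq, Matrix.diagonal_apply_eq, h4]
    ring
  rw [spinCurrent, Complex.im_sum, Finset.mul_sum]
  refine Finset.sum_congr rfl fun μ _ => ?_
  rw [h1 μ, Complex.add_im, show (1 / 4 : ℂ) = ((1 / 4 : ℝ) : ℂ) by push_cast; rfl,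
    Complex.im_ofReal_mul, Complex.im_sum]
  simp only [Complex.im_sum (s := Finset.univ) (f := fun j => ∑ r, _), h2, Finset.sum_neg_distrib]
  ring

end Weyl


/-! ### Comparison of the two Lagrangians -/

section Lagrangian

variable {U : Set Pt} {g θ₀ : Pt → Matrix (Fin 4) (Fin 4) ℝ}
  {σ : Pt → Fin 4 → Matrix (Fin 2) (Fin 2) ℂ} {x : Pt}

theorem IsLorentzianMetric.christoffel_symm (hg : IsLorentzianMetric U g) (hU : IsOpen U)
    (hx : x ∈ U) (β α γ : Fin 4) : christoffel g x β α γ = christoffel g x β γ α := by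
  have h (δ : Fin 4) : pderiv δ (fun y => g y α γ) x = pderiv δ (fun y => g y γ α) x :=
    pderiv_congr hU hx (fun y hy => (congrFun (congrFun (hg.symm hy) α) γ).symm) δ
  simp only [christoffel, h]
  congr 1
  exact Finset.sum_congr rfl fun δ _ => by ring

/-- Differentiating `e⁻¹ e = 1` trades `∂(e⁻¹)` for `-∂e`. The spin connection is thereby separated
into a Christoffel part and the part `eᵀ o ∂e` that occurs in the torsion. -/
theorem transpose_mul_frameConn {e : Pt → Matrix (Fin 4) (Fin 4) ℝ} (hU : IsOpen U) (hx : x ∈ U)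
    (he : ∀ i j, DifferentiableAt ℝ (fun y => e y i j) x)
    (hE : ∀ i j, DifferentiableAt ℝ (fun y => (e y)⁻¹ i j) x)
    (he0 : ∀ y ∈ U, (e y)⁻¹ * e y = 1) (hm : g x = (e x)ᵀ * minkowski * e x) (μ : Fin 4) :
    (e x)ᵀ * (minkowski * frameConn g e x μ) * e x =
      g x * Matrix.of (fun β γ => christoffel g x β μ γ) -
        (e x)ᵀ * minkowski * dmat μ e x := by
  have h1 := dmat_congr hU hx he0 μ
  rw [dmat_const, dmat_mul hE he] at h1
  have h2 : e x * (e x)⁻¹ = 1 := mul_eq_one_comm.1 (he0 x hx)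
  have h3 : e x * dmat μ (fun y => (e y)⁻¹) x * e x = -dmat μ e x := by
    rw [Matrix.mul_assoc, eq_neg_of_add_eq_zero_left h1, Matrix.mul_neg, ← Matrix.mul_assoc, h2,
      Matrix.one_mul]
  have h4 : frameConn g e x μ * e x =
      -dmat μ e x + e x * Matrix.of (fun β γ => christoffel g x β μ γ) := by
    rw [frameConn, Matrix.mul_add, Matrix.add_mul, h3, Matrix.mul_assoc, Matrix.mul_assoc,
      he0 x hx, Matrix.mul_one]
  rw [Matrix.mul_assoc, Matrix.mul_assoc, h4, hm]
  simp only [Matrix.mul_add, Matrix.mul_neg, Matrix.mul_assoc]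
  abel

theorem transpose_mul_dmat {e Λ θ : Pt → Matrix (Fin 4) (Fin 4) ℝ} (hU : IsOpen U) (hx : x ∈ U)
    (he : ∀ i j, DifferentiableAt ℝ (fun y => e y i j) x)
    (hΛ : ∀ i j, DifferentiableAt ℝ (fun y => Λ y i j) x)
    (hθ : ∀ y ∈ U, θ y = Λ y * e y) (h : (Λ x)ᵀ * minkowski * Λ x = minkowski) (μ : Fin 4) :
    (θ x)ᵀ * minkowski * dmat μ θ x =
      (e x)ᵀ * lorentzConn Λ x μ * e x + (e x)ᵀ * minkowski * dmat μ e x := by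
  rw [dmat_congr hU hx hθ, dmat_mul hΛ he, hθ x hx]
  conv_rhs => rw [← h]
  simp only [lorentzConn, Matrix.transpose_mul, Matrix.mul_add, Matrix.mul_assoc]

theorem smul_rowDet (c : ℝ) (u v w z : Fin 4 → ℝ) : c * rowDet u v w z = rowDet (c • u) v w z := by
  simp only [rowDet_eq, Pi.smul_apply, smul_eq_mul]
  ring

/-- With `F = frameConn`, one has `ϑᵀ o ∂ϑ = eᵀ (W - o F) e + g Γ`. The last term is symmetric in
`μ` and the second matrix index because `Γ` is torsion-free, so the antisymmetric determinant
annihilates it. -/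
theorem sum_rowDet_dmat (hg : IsLorentzianMetric U g) {e Λ θ : Pt → Matrix (Fin 4) (Fin 4) ℝ}
    (hU : IsOpen U) (hx : x ∈ U)
    (he : ∀ i j, DifferentiableAt ℝ (fun y => e y i j) x)
    (hE : ∀ i j, DifferentiableAt ℝ (fun y => (e y)⁻¹ i j) x)
    (hΛ : ∀ i j, DifferentiableAt ℝ (fun y => Λ y i j) x)
    (he0 : ∀ y ∈ U, (e y)⁻¹ * e y = 1) (hm : g x = (e x)ᵀ * minkowski * e x)
    (hθ : ∀ y ∈ U, θ y = Λ y * e y) (h : (Λ x)ᵀ * minkowski * Λ x = minkowski) (l : Fin 4 → ℝ) :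
    ∑ μ, ∑ i, ∑ j, ((θ x)ᵀ * minkowski * dmat μ θ x) i j *
        rowDet (l ᵥ* e x) (Pi.single i 1) (Pi.single μ 1) (Pi.single j 1) =
      (e x).det * ∑ μ, (∑ i, ∑ j, lorentzConn Λ x μ i j *
          rowDet l (Pi.single i 1) ((e x)⁻¹ μ) (Pi.single j 1) -
        ∑ i, ∑ j, (minkowski * frameConn g e x μ) i j *
          rowDet l (Pi.single i 1) ((e x)⁻¹ μ) (Pi.single j 1)) := by
  have hΓ := sum_rowDet_symm (fun μ => g x * Matrix.of (fun β γ => christoffel g x β μ γ))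
    (fun μ i j => by
      simp only [Matrix.mul_apply, Matrix.of_apply]
      exact Finset.sum_congr rfl fun k _ => by rw [hg.christoffel_symm hU hx])
    (l ᵥ* e x)
  rw [Finset.mul_sum, ← sub_eq_zero, ← Finset.sum_sub_distrib, ← hΓ]
  refine Finset.sum_congr rfl fun μ _ => ?_
  have hW := sum_rowDet_frame (he0 x hx) (lorentzConn Λ x μ) l μ
  have hM := sum_rowDet_frame (he0 x hx) (minkowski * frameConn g e x μ) l μ
  rw [transpose_mul_frameConn hU hx he hE he0 hm] at hM
  rw [transpose_mul_dmat hU hx he hΛ hθ h, mul_sub, ← hW, ← hM]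
  simp only [Matrix.sub_apply, sub_mul, Finset.sum_sub_distrib, Matrix.add_apply, add_mul,
    Finset.sum_add_distrib]
  ring

theorem modTeleLagrangian_eq_rowDet (θ : Pt → Matrix (Fin 4) (Fin 4) ℝ) (s : Pt → ℝ) (x : Pt)
    (α β γ δ : Fin 4) :
    modTeleLagrangian θ s x α β γ δ =
      (1 / 3) * (∑ μ, ∑ p, ∑ q, ((θ x)ᵀ * minkowski * dmat μ θ x) p q *
        rowDet (s x • covL θ x) (Pi.single p 1) (Pi.single μ 1) (Pi.single q 1)) *
        leviCivita α β γ δ := by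
  rw [modTeleLagrangian, teleLagrangian_eq]
  simp only [← smul_rowDet, mul_left_comm _ (s x), ← Finset.mul_sum]
  ring

/-- After `s l` is identified with the null covector of `ξ`, the determinant sum splits into the `W`
part, which is the `∂ξ` part of the current, and the spin connection part, which is the rest of it.
-/
theorem IsPauli.modTeleLagrangian_eq (hσ : IsPauli U g θ₀ σ) (hg : IsLorentzianMetric U g)
    (hθ₀ : IsOrientedCoframe U g θ₀) (hU : IsOpen U) (p : CoframeScalar U g θ₀)
    (ξ : NonvanishingSpinor U)
    (h : EqModU1 U (fun x => (p.s x : ℂ) • lWedgeM p.θ x) (sigmaXiXi σ ξ.ξ)) (hx : x ∈ U)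
    (α β γ δ : Fin 4) :
    (modTeleLagrangian p.θ p.s x α β γ δ : ℂ) =
      -(4 / 3) * weylLagrangian g σ ξ.ξ x α β γ δ := by
  obtain ⟨c, hc, H⟩ := h
  have hc0 : c ≠ 0 := by rintro rfl; simp at hc
  obtain ⟨e, hσe⟩ : ∃ e : Coframe U g θ₀, pauliFrame σ = e.θ := ⟨hσ.coframe hg hθ₀, rfl⟩
  let Λ : Pt → Matrix (Fin 4) (Fin 4) ℝ := fun y => p.θ y * (e.θ y)⁻¹
  have hdiff {f : Pt → ℝ} (hf : ContDiffOn ℝ ∞ f U) : DifferentiableAt ℝ f x :=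
    (hf.contDiffAt (hU.mem_nhds hx)).differentiableAt (by simp)
  have hEs := contDiffOn_matrix_inv e.isOriented.smooth fun y hy => e.det_ne_zero hy
  have he : ∀ i j, DifferentiableAt ℝ (fun y => e.θ y i j) x :=
    fun i j => hdiff (e.isOriented.smooth i j)
  have hE : ∀ i j, DifferentiableAt ℝ (fun y => (e.θ y)⁻¹ i j) x := fun i j => hdiff (hEs i j)
  have hΛ : ∀ i j, DifferentiableAt ℝ (fun y => Λ y i j) x :=
    fun i j => hdiff (contDiffOn_matrix_mul p.isOriented.smooth hEs i j)
  have hΛl : ∀ y ∈ U, IsProperLorentz (Λ y) := fun y hy => e.transition p.toCoframe hθ₀ hy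
  have hθ : ∀ y ∈ U, p.θ y = Λ y * e.θ y := fun y hy => by
    rw [Matrix.mul_assoc, e.inv_mul hy, Matrix.mul_one]
  have hrel : ∀ y ∈ U, (p.s y : ℂ) • pull (Λ y) (spinForm 1 0 0) =
      c • spinForm (ξ.ξ y 0 ^ 2) (ξ.ξ y 0 * ξ.ξ y 1) (ξ.ξ y 1 ^ 2) := by
    intro y hy
    apply pull_injective (e.det_ne_zero hy)
    rw [pull_smul, pull_smul, ← pull_mul, ← hθ y hy, ← lWedgeM_eq_pull]
    have h1 := H y hy
    rw [hσ.sigmaXiXi_eq_pull hy ξ.ξ, hσe] at h1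
    exact h1
  have hξ : ∀ a, DifferentiableAt ℝ (fun y => ξ.ξ y a) x := fun a =>
    ((contDiffOn_pi.1 ξ.smooth a).contDiffAt (hU.mem_nhds hx)).differentiableAt (by simp)
  have hL : p.s x • covL p.θ x = spinVec (ξ.ξ x) ᵥ* e.θ x := by
    ext i
    have h1 := (hΛl x hx).spinVec_eq (p.pos x hx) hc (ξ.nonvanishing x hx) (hrel x hx)
    simp only [Pi.smul_apply, smul_eq_mul, covL, hθ x hx, Matrix.vecMul, dotProduct, h1,
      Matrix.mul_apply, ← Finset.sum_add_distrib, Finset.mul_sum]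
    exact Finset.sum_congr rfl fun k _ => by ring
  have hcur := hσ.spinCurrent_im hg hθ₀ hU hx (by rwa [hσe]) ξ.ξ
  rw [hσe] at hcur
  have hconn (μ : Fin 4) := rowDet_connection
    (dξ := fun a => pderiv μ (fun y => ξ.ξ y a) x)
    (lorentzConn_transpose hU hx hΛ (fun y hy => (hΛl y hy).eq) μ) (ξ.nonvanishing x hx)
    (spinor_connection hU hx hΛ (hΛl x hx).eq (hdiff p.smooth_s) (p.pos x hx).ne' hξ hc0 hrel μ)
    ((e.θ x)⁻¹ μ)
  rw [hσ.weylLagrangian_eq hg hθ₀ hx, modTeleLagrangian_eq_rowDet, hL,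
    sum_rowDet_dmat hg hU hx he hE hΛ (fun y hy => e.inv_mul hy) (e.isOriented.metric_eq hx) hθ
      (hΛl x hx).eq]
  simp only [hconn]
  -- One side is now `(1/3) · 4 Im z · det e · ε` and the Weyl Lagrangian is `-Im z · det e · ε`,
  -- with `z` the current; hence the factor `-4/3`.
  rw [← hcur, hσe]
  push_cast
  ring

end Lagrangian

end Teleparallel

/-! ### The theorem -/

theorem theorem4
    (U : Set Pt) (hU : IsOpen U) (hUsc : SimplyConnectedSpace U)
    (g : Pt → Matrix (Fin 4) (Fin 4) ℝ) (hg : IsLorentzianMetric U g)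
    (θ₀ : Pt → Matrix (Fin 4) (Fin 4) ℝ) (hθ₀ : IsOrientedCoframe U g θ₀)
    (σ : Pt → Fin 4 → Matrix (Fin 2) (Fin 2) ℂ) (hσ : IsPauli U g θ₀ σ) :
    (∃ Φ : Quotient (coframeScalarSetoid U g θ₀) ≃ Quotient (spinorSetoid U),
      ∀ (p : CoframeScalar U g θ₀) (ξ : NonvanishingSpinor U),
        Φ (Quotient.mk _ p) = Quotient.mk _ ξ ↔
          EqModU1 U (fun x => (p.s x : ℂ) • lWedgeM p.θ x) (sigmaXiXi σ ξ.ξ)) ∧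
    ∀ (p : CoframeScalar U g θ₀) (ξ : NonvanishingSpinor U),
      EqModU1 U (fun x => (p.s x : ℂ) • lWedgeM p.θ x) (sigmaXiXi σ ξ.ξ) →
        ∀ x ∈ U, ∀ α β γ δ : Fin 4,
          (modTeleLagrangian p.θ p.s x α β γ δ : ℂ) =
            -(4 / 3) * weylLagrangian g σ ξ.ξ x α β γ δ := by
  refine ⟨exists_quotient_equiv _ _ _ ?_ ?_ ?_ ?_ ?_ ?_, fun p ξ h x hx α β γ δ =>
    hσ.modTeleLagrangian_eq hg hθ₀ hU p ξ h hx α β γ δ⟩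
  · exact fun p p' ξ h h' => (eqModU1_of_coframeScalar_equiv p p' h).trans h'
  · exact fun p ξ ξ' h h' => h'.trans (EqModU1.sigmaXiXi h)
  · exact fun p p' ξ h h' => coframeScalar_equiv_of_form hθ₀ p p' (h'.trans h.symm)
  · exact fun p ξ ξ' h h' => hσ.eqModU1_of_sigmaXiXi hg hθ₀ hUsc ξ' ξ (h.symm.trans h')
  · exact fun p => (hσ.exists_spinor hg hθ₀ hU hUsc p).imp fun ξ h => EqModU1.of_eqOn h
  · exact fun ξ => (hσ.exists_coframeScalar hg hθ₀ ξ).imp fun p h => EqModU1.of_eqOn h
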